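/- Let $d\ge 1$, $p\ge 2$, $\gamma>0$ and $\nu>0$. Write $\mathcal F(g)(\xi)=\int_{\mathbb R^d}e^{-ix\cdot\xi}g(x)\,dx$ and $\mathcal F^{-1}(g)(x)=(2\pi)^{-d}\int_{\mathbb R^d}e^{i\xi\cdot x}g(\xi)\,d\xi$, and let $(-\Delta)^{\sigma/2}u=\mathcal F^{-1}(|\xi|^{\sigma}\mathcal F(u))$ be the operator with symbol $|\xi|^\sigma$. There is a constant $N$ depending only on $p,\nu,\gamma,d$ such that the following holds. Let $\psi(t,\xi)$ be a complex-valued function, measurable in $t>0$ for each $\xi\ne0$, such that for almost every $t>0$ the function $\psi(t,\cdot)$ is $\lfloor d/2\rfloor+2$ times continuously differentiable on $\mathbb R^d\setminus\{0\}$ and, for all $\xi\neq 0$ and all multi-indices $\alpha$ with $|\alpha|\le\lfloor d/2\rfloor+2$, $$\operatorname{Re}\psi(t,\xi)\le-\nu|\xi|^\gamma,\qquad |D_\xi^\alpha\psi(t,\xi)|\le\nu^{-1}|\xi|^{\gamma-|\alpha|}.$$ Put $$p(t,s,x)=I_{0\le s<t}\,\mathcal F^{-1}\Big(\exp\Big(\int_s^t\psi(r,\cdot)\,dr\Big)\Big)(x).$$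 Then for every complex Hilbert space $H$ (real Hilbert spaces being included through their complexification) and every $f\in C_0^\infty(\mathbb R^{d+1};H)$, the function $(t,x)\mapsto\big(\int_0^t|(-\Delta)^{\gamma/4}p(t,s,\cdot)*f(s,\cdot)(x)|_H^2\,ds\big)^{1/2}$ (equal to $0$ for $t\le 0$) is measurable and $$\Big\|\Big(\int_0^t\big|(-\Delta)^{\gamma/4}p(t,s,\cdot)*f(s,\cdot)(x)\big|_H^2\,ds\Big)^{1/2}\Big\|_{L_p(\mathbb R^{d+1})}\le N\,\big\||f|_H\big\|_{L_p(\mathbb R^{d+1})}.$$ -/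

import Mathlib

open MeasureTheory Set
open scoped ENNReal NNReal ContDiff

noncomputable section

namespace ParabolicLP

/-- Euclidean space `ℝ^d`. -/
abbrev Rd (d : ℕ) : Type := EuclideanSpace ℝ (Fin d)

/-- The Fourier transform `F(g)(ξ) = ∫ e^{-i x·ξ} g(x) dx`. -/
def fourierT {d : ℕ} (g : Rd d → ℂ) (ξ : Rd d) : ℂ :=
  ∫ x : Rd d, Complex.exp (-(Complex.I * ((inner ℝ x ξ : ℝ) : ℂ))) * g x

/-- The inverse Fourier transform `F⁻¹(g)(x) = (2π)^{-d} ∫ e^{i ξ·x} g(ξ) dξ`. -/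
def invFourierT {d : ℕ} (g : Rd d → ℂ) (x : Rd d) : ℂ :=
  ((((2 * Real.pi) ^ d)⁻¹ : ℝ) : ℂ) *
    ∫ ξ : Rd d, Complex.exp (Complex.I * ((inner ℝ ξ x : ℝ) : ℂ)) * g ξ

/-- The fractional Laplacian `(-Δ)^{σ/2}`, the operator with symbol `|ξ|^σ`. -/
def fracLaplacian {d : ℕ} (σ : ℝ) (u : Rd d → ℂ) : Rd d → ℂ :=
  invFourierT fun ξ => ((‖ξ‖ ^ σ : ℝ) : ℂ) * fourierT u ξ

/-- The kernel `p(t,s,x) = 1_{0 ≤ s < t} F⁻¹(exp(∫_s^t ψ(r,·) dr))(x)`. -/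
def kernel {d : ℕ} (ψ : ℝ → Rd d → ℂ) (t s : ℝ) (x : Rd d) : ℂ :=
  open Classical in
  if 0 ≤ s ∧ s < t then invFourierT (fun ξ => Complex.exp (∫ r in s..t, ψ r ξ)) x else 0

/-- The conditions on a time-dependent symbol `ψ(t,ξ)` of order `γ` with constant `ν`.
Only `t > 0` and `ξ ≠ 0` matter. -/
structure IsEllipticSymbol (d : ℕ) (γ ν : ℝ) (ψ : ℝ → Rd d → ℂ) : Prop where
  /-- measurability in time -/
  aemeasurable : ∀ ξ : Rd d, ξ ≠ 0 → AEMeasurable (fun t => ψ t ξ) (volume.restrict (Ioi 0))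
  /-- differentiability in `ξ ≠ 0` up to the order `⌊d/2⌋ + 2` -/
  contDiffOn : ∀ᵐ t ∂(volume.restrict (Ioi (0 : ℝ))),
    ContDiffOn ℝ ((d / 2 + 2 : ℕ) : ℕ∞) (ψ t) {0}ᶜ
  /-- `Re ψ(t,ξ) ≤ -ν |ξ|^γ` -/
  re_le : ∀ᵐ t ∂(volume.restrict (Ioi (0 : ℝ))), ∀ ξ : Rd d, ξ ≠ 0 →
    (ψ t ξ).re ≤ -ν * ‖ξ‖ ^ γ
  /-- `|D^α ψ(t,ξ)| ≤ ν⁻¹ |ξ|^{γ - |α|}` for `|α| ≤ ⌊d/2⌋ + 2`. Here the multi-index `α`, of order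
  `n`, is given as the list `i` of the `n` coordinate directions of differentiation. -/
  deriv_le : ∀ᵐ t ∂(volume.restrict (Ioi (0 : ℝ))), ∀ ξ : Rd d, ξ ≠ 0 →
    ∀ n : ℕ, n ≤ d / 2 + 2 → ∀ i : Fin n → Fin d,
      ‖iteratedFDeriv ℝ n (ψ t) ξ (fun j => EuclideanSpace.single (i j) (1 : ℝ))‖
        ≤ ν⁻¹ * ‖ξ‖ ^ (γ - (n : ℝ))

/-- The square function
`(t,x) ↦ (∫_0^t |((-Δ)^{γ/4} p(t,s,·) * f(s,·))(x)|_H² ds)^{1/2}`, with values in `[0,∞]`.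
The integral over `(0,t)` is `0` when `t ≤ 0`. -/
def squareFunction {d : ℕ} {H : Type*} [NormedAddCommGroup H] [InnerProductSpace ℂ H]
    (γ : ℝ) (ψ : ℝ → Rd d → ℂ) (f : ℝ × Rd d → H) (z : ℝ × Rd d) : ℝ≥0∞ :=
  (∫⁻ s in Ioo 0 z.1,
    ‖convolution (fracLaplacian (γ / 2) (kernel ψ z.1 s)) (fun y => f (s, y))
      (ContinuousLinearMap.lsmul ℂ ℂ) volume z.2‖ₑ ^ (2 : ℝ)) ^ (1 / 2 : ℝ)

end ParabolicLP

end

/-!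
# The square function estimate by a weighted inequality and duality

Let `G f` denote the square function. The estimate for every `p ≥ 2` follows from one weighted
inequality (`ParabolicLP.exists_lintegral_sq_mul_le`): for every measurable `h ≥ 0`,
`∫ (G f)² h ≤ C ∫ |f|² M_x M_t M_x h`,
where `M_x` and `M_t` are the Hardy–Littlewood maximal operators in space and in time. For `p = 2`
take `h = 1`. For `p > 2` apply Hölder's inequality with the exponents `p / 2` and `(p / 2)'` and
the boundedness of the maximal operators on `L^{(p/2)'}`, and conclude by the duality of `L^{p/2}`
and `L^{(p/2)'}`.

For the weighted inequality, the kernel `(-Δ)^{γ/4} p(t,s,·)` is decomposed into dyadic frequency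
pieces `K_j`, `j ∈ ℤ`. Let `T_j` be convolution with `2^{jd} ρ(2^j ·)`, where `ρ` is the
distribution of the difference of two independent uniform points of the unit cube. The symbol of
`T_j - T_{j-m}` does not vanish at the frequencies of size `a 2^j`, for suitable `a` and `m`, so
that `K_j * f = K̃_j * (T_j - T_{j-m}) f` with `K̃_j` of the same nature as `K_j`
(`ParabolicLP.FreqCutoff`, `ParabolicLP.enorm_integral_invFourierT_smul_le`). Then three facts are
combined.

* Weighted Littlewood–Paley inequality (`ParabolicLP.tsum_lintegral_smoothing_sub_le`):
  `∑_j ∫ |(T_j - T_{j-m}) f|² w ≤ C ∫ |f|² M_x w`. Since `T_j f` is the average over all translates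
  of the dyadic grid of the conditional expectations of `f` given the cubes of side `2⁻ʲ`, this
  follows from a weighted inequality for martingale differences, which is a telescoping sum of
  Pythagorean identities.
* Kernel bounds (`ParabolicLP.IsExponent.exists_lintegral_piece_le`): with `θ = t - s`,
  `∫ (|K̃_j| * g)² w ≤ C (2^{jγ/2} exp(-c θ 2^{jγ}))² ∫ g² M_x w`. The symbol of `K̃_j`, rescaled to
  frequency one, has `⌊d/2⌋ + 2` bounded derivatives by the Faà di Bruno formula. By Bessel's
  inequality `K̃_j` lies in a weighted `L²` space, whose weight is strong enough to dominate, by the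
  Cauchy–Schwarz inequality, `(|K̃_j| * g)²` by averages of `g²` over balls.
* Summation: `∑_j 2^{jγ/2} exp(-c θ 2^{jγ}) ≤ C θ^{-1/2}`, and the average of a function of `t`
  against `θ^{-1/2} 2^{jγ/2} exp(-c θ 2^{jγ})` is at most a constant times `M_t`, uniformly in `j`
  (`ParabolicLP.lintegral_time_le_maximalFn`).

The operator `(-Δ)^{γ/4}` is applied to `p(t,s,·)` through the Fourier transform of `p(t,s,·)`. That
this is `exp(∫_s^t ψ)` requires `p(t,s,·) ∈ L¹`, which the same kernel bounds provide
(`ParabolicLP.IsExponent.lintegral_invFourierT_exp_lt_top`).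
-/

namespace ParabolicLP

/-! ### Geometric sums over the integers -/

/-- The powers of `b` that are at most `y` have a sum of order at most `y`, which may be `0` or
`⊤`. -/
theorem tsum_zpow_le {b : ℝ} (hb : 1 < b) (y : ℝ≥0∞) :
    ∑' k : ℤ, (if ENNReal.ofReal (b ^ k) ≤ y then ENNReal.ofReal (b ^ k) else 0)
      ≤ ENNReal.ofReal (b / (b - 1)) * y := by
  have hb0 : 0 < b := by linarith
  have hc : 0 < b / (b - 1) := div_pos hb0 (by linarith)
  rcases eq_or_ne y ⊤ with rfl | hy
  · rw [ENNReal.mul_top (by simpa using hc)]; exact le_top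
  rcases eq_or_ne y 0 with rfl | hy0
  · simp only [mul_zero, nonpos_iff_eq_zero, ENNReal.tsum_eq_zero]
    intro k
    have : 0 < b ^ k := by positivity
    simp only [ENNReal.ofReal_eq_zero, not_le.2 this, if_false]
  have hyr : 0 < y.toReal := ENNReal.toReal_pos hy0 hy
  obtain ⟨k₀, h1, h2⟩ := exists_mem_Ico_zpow hyr hb
  have hinj : Function.Injective (fun n : ℕ => k₀ - (n : ℤ)) := fun a c h => by
    simp only at h; omega
  rw [← hinj.tsum_eq]
  · calc _ ≤ ∑' n : ℕ, ENNReal.ofReal (b ^ k₀) * ENNReal.ofReal (b⁻¹) ^ n := by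
          refine ENNReal.tsum_le_tsum fun n => ?_
          split_ifs
          · rw [zpow_sub₀ hb0.ne', ← ENNReal.ofReal_pow (by positivity),
              ← ENNReal.ofReal_mul (by positivity)]
            simp [div_eq_mul_inv]
          · exact zero_le
      _ = ENNReal.ofReal (b ^ k₀) * ENNReal.ofReal (b / (b - 1)) := by
          rw [ENNReal.tsum_mul_left, ENNReal.tsum_geometric]
          congr 1
          rw [← ENNReal.ofReal_one, ← ENNReal.ofReal_sub _ (by positivity),
            ← ENNReal.ofReal_inv_of_pos]
          · congr 1
            have : b - 1 ≠ 0 := by linarith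
            field_simp
          · rw [sub_pos]; exact inv_lt_one_of_one_lt₀ hb
      _ ≤ _ := by
          rw [mul_comm]
          gcongr
          rw [← ENNReal.ofReal_toReal hy]
          exact ENNReal.ofReal_le_ofReal h1
  · intro k hk
    simp only [Function.mem_support, ne_eq, ite_eq_right_iff, Classical.not_imp] at hk
    have h3 : b ^ k ≤ y.toReal := (ENNReal.ofReal_le_iff_le_toReal hy).1 hk.1
    have h4 : k < k₀ + 1 := (zpow_lt_zpow_iff_right₀ hb).1 (h3.trans_lt h2)
    exact ⟨(k₀ - k).toNat, by simp only; omega⟩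

/-- The function `r ↦ r e^{-c r²}` has bounded sums over geometric progressions. -/
theorem tsum_zpow_mul_exp_le {b c : ℝ} (hb : 1 < b) (hc : 0 < c) :
    ∃ C : ℝ≥0, ∀ L : ℝ, 0 < L →
      ∑' k : ℤ, ENNReal.ofReal (b ^ k * Real.exp (-(c * (L * b ^ k) ^ 2)))
        ≤ C * ENNReal.ofReal L⁻¹ := by
  have hb0 : 0 < b := by linarith
  set C₁ : ℝ≥0 := (b / (b - 1)).toNNReal
  refine ⟨C₁ + C₁ * c⁻¹.toNNReal, fun L hL => ?_⟩
  -- the terms with `b ^ k ≤ 1 / L` are bounded by `b ^ k`, the others by `b ^ (-k) / (c L²)`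
  have key : ∀ k : ℤ, ENNReal.ofReal (b ^ k * Real.exp (-(c * (L * b ^ k) ^ 2))) ≤
      (if ENNReal.ofReal (b ^ k) ≤ ENNReal.ofReal L⁻¹ then ENNReal.ofReal (b ^ k) else 0) +
      ENNReal.ofReal (c * L ^ 2)⁻¹ *
      (if ENNReal.ofReal (b ^ (-k)) ≤ ENNReal.ofReal L then ENNReal.ofReal (b ^ (-k)) else 0) := by
    intro k
    have hbk : 0 < b ^ k := by positivity
    by_cases h : b ^ k ≤ L⁻¹
    · rw [if_pos (ENNReal.ofReal_le_ofReal h)]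
      refine le_add_right (ENNReal.ofReal_le_ofReal ?_)
      have : Real.exp (-(c * (L * b ^ k) ^ 2)) ≤ 1 := Real.exp_le_one_iff.2 (by
        simp only [Left.neg_nonpos_iff]; positivity)
      nlinarith
    · push Not at h
      have h' : b ^ (-k) ≤ L := by
        rw [zpow_neg]; exact (inv_le_comm₀ hL hbk).1 h.le
      rw [if_pos (ENNReal.ofReal_le_ofReal h'), ← ENNReal.ofReal_mul (by positivity)]
      refine le_add_left (ENNReal.ofReal_le_ofReal ?_)
      have h5 : c * (L * b ^ k) ^ 2 ≤ Real.exp (c * (L * b ^ k) ^ 2) := by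
        linarith [Real.add_one_le_exp (c * (L * b ^ k) ^ 2)]
      rw [Real.exp_neg, zpow_neg, ← mul_inv, ← div_eq_mul_inv, div_le_iff₀ (Real.exp_pos _),
        ← div_eq_inv_mul, le_div_iff₀ (by positivity)]
      calc _ = c * (L * b ^ k) ^ 2 := by ring
        _ ≤ _ := h5
  calc _ ≤ _ := ENNReal.tsum_le_tsum key
    _ ≤ ENNReal.ofReal (b / (b - 1)) * ENNReal.ofReal L⁻¹ +
        ENNReal.ofReal (c * L ^ 2)⁻¹ * (ENNReal.ofReal (b / (b - 1)) * ENNReal.ofReal L) := by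
      rw [ENNReal.tsum_add, ENNReal.tsum_mul_left]
      gcongr
      · exact tsum_zpow_le hb _
      · have := tsum_zpow_le hb (ENNReal.ofReal L)
        rwa [← (Equiv.neg ℤ).tsum_eq] at this
    _ = _ := by
      have e1 : ENNReal.ofReal (c * L ^ 2)⁻¹ * (ENNReal.ofReal (b / (b - 1)) * ENNReal.ofReal L)
          = ENNReal.ofReal (b / (b - 1)) * ENNReal.ofReal c⁻¹ * ENNReal.ofReal L⁻¹ := by
        have : 0 ≤ b / (b - 1) := div_nonneg hb0.le (by linarith)
        rw [← ENNReal.ofReal_mul this, ← ENNReal.ofReal_mul (by positivity),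
          ← ENNReal.ofReal_mul this, ← ENNReal.ofReal_mul (by positivity)]
        congr 1
        field_simp
      rw [e1]
      push_cast
      rw [add_mul]
      rfl

/-! ### The Hardy–Littlewood maximal function -/

section Maximal

variable {E : Type*} [NormedAddCommGroup E] [NormedSpace ℝ E] [FiniteDimensional ℝ E]
  [MeasurableSpace E] [BorelSpace E]

/-- The centred Hardy–Littlewood maximal function, with the supremum taken over the balls of radius
`2 ^ k`, `k ∈ ℤ`, only: this changes it by a constant factor at most, and keeps measurability
in parameters trivial. -/
noncomputable def maximalFn (μ : Measure E) (w : E → ℝ≥0∞) (x : E) : ℝ≥0∞ :=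
  ⨆ k : ℤ, (μ (Metric.ball x ((2 : ℝ) ^ k)))⁻¹ * ∫⁻ y in Metric.ball x ((2 : ℝ) ^ k), w y ∂μ

variable (μ : Measure E) [μ.IsAddHaarMeasure]

theorem measurable_maximalFn_prod {T : Type*} [MeasurableSpace T] {w : T × E → ℝ≥0∞}
    (hw : Measurable w) :
    Measurable fun z : T × E => maximalFn μ (fun y => w (z.1, y)) z.2 := by
  unfold maximalFn
  refine Measurable.iSup fun k => ?_
  have h1 : ∀ z : T × E, μ (Metric.ball z.2 ((2 : ℝ) ^ k)) = μ (Metric.ball 0 ((2 : ℝ) ^ k)) :=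
    fun z => Measure.addHaar_ball_center μ z.2 _
  simp_rw [h1]
  refine Measurable.const_mul ?_ _
  have h2 : ∀ z : T × E, ∫⁻ y in Metric.ball z.2 ((2 : ℝ) ^ k), w (z.1, y) ∂μ =
      ∫⁻ y, ({q : (T × E) × E | dist q.2 q.1.2 < (2 : ℝ) ^ k}.indicator
        (fun q => w (q.1.1, q.2))) (z, y) ∂μ := by
    intro z
    rw [← lintegral_indicator Metric.isOpen_ball.measurableSet]
    rfl
  simp_rw [h2]
  refine Measurable.lintegral_prod_right ?_
  refine Measurable.indicator ?_ ?_
  · exact hw.comp (by fun_prop)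
  · exact measurableSet_lt (by fun_prop) measurable_const

theorem measurable_maximalFn {w : E → ℝ≥0∞} (hw : Measurable w) : Measurable (maximalFn μ w) := by
  have h := measurable_maximalFn_prod μ (T := Unit) (w := w ∘ Prod.snd) (hw.comp measurable_snd)
  have h' : Measurable fun x : E => (((), x) : Unit × E) := by fun_prop
  simpa only [Function.comp_def] using h.comp h'

omit [NormedSpace ℝ E] [FiniteDimensional ℝ E] [BorelSpace E] [μ.IsAddHaarMeasure] in
theorem maximalFn_one_le (x : E) : maximalFn μ (fun _ => 1) x ≤ 1 := by
  refine iSup_le fun k => ?_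
  simp only [lintegral_const, MeasurableSet.univ, Measure.restrict_apply, univ_inter, one_mul]
  exact ENNReal.inv_mul_le_one _

omit [BorelSpace E] in
theorem lintegral_ball_le_maximalFn (w : E → ℝ≥0∞) (x : E) (k : ℤ) :
    ∫⁻ y in Metric.ball x ((2 : ℝ) ^ k), w y ∂μ
      ≤ μ (Metric.ball x ((2 : ℝ) ^ k)) * maximalFn μ w x := by
  have h0 : μ (Metric.ball x ((2 : ℝ) ^ k)) ≠ 0 :=
    (Metric.measure_ball_pos μ x (by positivity)).ne'
  have ht : μ (Metric.ball x ((2 : ℝ) ^ k)) ≠ ⊤ := measure_ball_lt_top.ne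
  rw [mul_comm, ← ENNReal.div_le_iff h0 ht, ENNReal.div_eq_inv_mul]
  exact le_iSup (fun k : ℤ => (μ (Metric.ball x ((2 : ℝ) ^ k)))⁻¹ *
    ∫⁻ y in Metric.ball x ((2 : ℝ) ^ k), w y ∂μ) k

omit [NormedSpace ℝ E] [FiniteDimensional ℝ E] in
theorem maximalFn_comp_add_right (w : E → ℝ≥0∞) (a x : E) :
    maximalFn μ (fun y => w (y + a)) x = maximalFn μ w (x + a) := by
  unfold maximalFn
  congr 1
  ext k
  rw [Measure.addHaar_ball_center μ (x + a), Measure.addHaar_ball_center μ x]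
  congr 1
  rw [← lintegral_indicator Metric.isOpen_ball.measurableSet,
    ← lintegral_indicator Metric.isOpen_ball.measurableSet,
    ← lintegral_add_right_eq_self ((Metric.ball (x + a) ((2 : ℝ) ^ k)).indicator w) a]
  refine lintegral_congr fun y => ?_
  by_cases h : y ∈ Metric.ball x ((2 : ℝ) ^ k)
  · rw [indicator_of_mem h, indicator_of_mem (by simpa using h)]
  · rw [indicator_of_notMem h, indicator_of_notMem (by simpa using h)]

/-- The weak type `(1,1)` bound, from the Vitali covering lemma. -/
theorem meas_lt_maximalFn_le (g : E → ℝ≥0∞) (l : ℝ≥0∞) :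
    l * μ {x | l < maximalFn μ g x}
      ≤ ENNReal.ofReal (4 ^ Module.finrank ℝ E) * ∫⁻ y, g y ∂μ := by
  set n := Module.finrank ℝ E
  -- the covering lemma needs bounded radii
  set S : ℕ → Set E := fun K => {x | ∃ k : ℤ, k ≤ K ∧
    l * μ (Metric.ball x ((2 : ℝ) ^ k)) < ∫⁻ y in Metric.ball x ((2 : ℝ) ^ k), g y ∂μ}
  have hS : {x | l < maximalFn μ g x} ⊆ ⋃ K, S K := by
    intro x hx
    obtain ⟨k, hk⟩ := lt_iSup_iff.1 (show l < maximalFn μ g x from hx)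
    refine mem_iUnion.2 ⟨k.toNat, k, Int.self_le_toNat k, ?_⟩
    have h0 : μ (Metric.ball x ((2 : ℝ) ^ k)) ≠ 0 :=
      (Metric.measure_ball_pos μ x (by positivity)).ne'
    have ht : μ (Metric.ball x ((2 : ℝ) ^ k)) ≠ ⊤ := measure_ball_lt_top.ne
    rwa [← ENNReal.div_eq_inv_mul, ENNReal.lt_div_iff_mul_lt (Or.inl h0) (Or.inl ht)] at hk
  have hmono : Monotone S := fun K K' h x ⟨k, hk, hk'⟩ =>
    ⟨k, hk.trans (by exact_mod_cast h), hk'⟩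
  have hK : ∀ K, l * μ (S K) ≤ ENNReal.ofReal (4 ^ n) * ∫⁻ y, g y ∂μ := by
    intro K
    choose! k hk hk' using fun x (hx : x ∈ S K) => hx
    obtain ⟨u, huS, hdisj, hcov⟩ := Vitali.exists_disjoint_subfamily_covering_enlargement_ball
      (S K) id (fun x => (2 : ℝ) ^ k x) ((2 : ℝ) ^ (K : ℤ))
      (fun x hx => zpow_le_zpow_right₀ (by norm_num) (hk x hx)) 4 (by norm_num)
    simp only [id] at hdisj hcov
    have hcount : u.Countable := hdisj.countable_of_isOpen (fun x _ => Metric.isOpen_ball)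
      (fun x _ => ⟨x, Metric.mem_ball_self (by positivity)⟩)
    have hsub : S K ⊆ ⋃ b ∈ u, Metric.ball b (4 * (2 : ℝ) ^ k b) := by
      intro x hx
      obtain ⟨b, hb, hxb⟩ := hcov x hx
      exact mem_biUnion hb (hxb (Metric.mem_ball_self (by positivity)))
    calc l * μ (S K) ≤ l * ∑' b : u, μ (Metric.ball (b : E) (4 * (2 : ℝ) ^ k b)) := by
          gcongr
          exact (measure_mono hsub).trans (measure_biUnion_le μ hcount _)
      _ = ENNReal.ofReal (4 ^ n) * ∑' b : u, l * μ (Metric.ball (b : E) ((2 : ℝ) ^ k b)) := by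
          rw [← ENNReal.tsum_mul_left, ← ENNReal.tsum_mul_left]
          congr 1; ext b
          rw [Measure.addHaar_ball_mul_of_pos μ _ (by norm_num),
            Measure.addHaar_ball_center μ (b : E)]
          ring
      _ ≤ ENNReal.ofReal (4 ^ n) *
            ∑' b : u, ∫⁻ y in Metric.ball (b : E) ((2 : ℝ) ^ k b), g y ∂μ := by
          gcongr with b
          exact (hk' b (huS b.2)).le
      _ = ENNReal.ofReal (4 ^ n) * ∫⁻ y in ⋃ b ∈ u, Metric.ball b ((2 : ℝ) ^ k b), g y ∂μ := by
          rw [lintegral_biUnion hcount (fun _ _ => Metric.isOpen_ball.measurableSet) hdisj]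
      _ ≤ _ := by
          gcongr
          exact Measure.restrict_le_self
  calc l * μ {x | l < maximalFn μ g x} ≤ l * μ (⋃ K, S K) := by gcongr
    _ = ⨆ K, l * μ (S K) := by rw [hmono.measure_iUnion, ENNReal.mul_iSup]
    _ ≤ _ := iSup_le hK

/-- The weak type bound for the part of `w` above the level `l`, since the maximal function of the
other part is at most `l`. -/
theorem meas_two_mul_lt_maximalFn_le (w : E → ℝ≥0∞) (l : ℝ≥0∞) :
    l * μ {x | 2 * l < maximalFn μ w x}
      ≤ ENNReal.ofReal (4 ^ Module.finrank ℝ E) * ∫⁻ y, {y | l < w y}.indicator w y ∂μ := by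
  refine le_trans ?_ (meas_lt_maximalFn_le μ _ l)
  refine mul_le_mul_right (measure_mono fun x hx => ?_) _
  change 2 * l < maximalFn μ w x at hx
  change l < maximalFn μ ({y | l < w y}.indicator w) x
  by_contra! hcon
  refine hx.not_ge (?_ : maximalFn μ w x ≤ 2 * l)
  refine iSup_le fun k => ?_
  calc _ ≤ (μ (Metric.ball x ((2 : ℝ) ^ k)))⁻¹ * ∫⁻ y in Metric.ball x ((2 : ℝ) ^ k),
          (l + {y | l < w y}.indicator w y) ∂μ := by
        gcongr with y
        by_cases h : l < w y
        · simp [h]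
        · push Not at h
          exact le_add_right h
    _ = (μ (Metric.ball x ((2 : ℝ) ^ k)))⁻¹ * μ (Metric.ball x ((2 : ℝ) ^ k)) * l +
        (μ (Metric.ball x ((2 : ℝ) ^ k)))⁻¹ * ∫⁻ y in Metric.ball x ((2 : ℝ) ^ k),
          {y | l < w y}.indicator w y ∂μ := by
        rw [lintegral_add_left measurable_const, mul_add]
        rw [setLIntegral_const]
        ring
    _ ≤ 1 * l + l := by
        gcongr
        · exact ENNReal.inv_mul_le_one _
        · refine le_trans ?_ hcon
          exact le_iSup (fun k : ℤ => (μ (Metric.ball x ((2 : ℝ) ^ k)))⁻¹ *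
            ∫⁻ y in Metric.ball x ((2 : ℝ) ^ k), {y | l < w y}.indicator w y ∂μ) k
    _ = 2 * l := by ring

/-- A dyadic form of the layer cake formula. The level `2 * 2 ^ k` is the one at which
`meas_two_mul_lt_maximalFn_le` is applied. -/
theorem rpow_le_tsum_zpow {q : ℝ} (hq : 0 < q) (y : ℝ≥0∞) :
    y ^ q ≤ ∑' k : ℤ, if (2 : ℝ≥0∞) * ENNReal.ofReal (2 ^ k) < y then
      ENNReal.ofReal (2 ^ (k + 2)) ^ q else 0 := by
  rcases eq_or_ne y 0 with rfl | hy0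
  · simp [hq]
  rcases eq_or_ne y ⊤ with rfl | hy
  · have hinj : Function.Injective (fun n : ℕ => (n : ℤ)) := Nat.cast_injective
    refine le_trans ?_ (ENNReal.tsum_comp_le_tsum_of_injective hinj _)
    refine le_top.trans
      ((ENNReal.tsum_const_eq_top_of_ne_zero (α := ℕ) one_ne_zero).symm.le.trans ?_)
    refine ENNReal.tsum_le_tsum fun n => ?_
    rw [if_pos (ENNReal.mul_lt_top (by simp) ENNReal.ofReal_lt_top)]
    refine ENNReal.one_le_rpow ?_ hq
    rw [← ENNReal.ofReal_one]
    exact ENNReal.ofReal_le_ofReal (one_le_zpow₀ (by norm_num) (by positivity))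
  have hyr : 0 < y.toReal := ENNReal.toReal_pos hy0 hy
  obtain ⟨k, h1, h2⟩ := exists_mem_Ioc_zpow hyr (one_lt_two)
  refine le_trans ?_ (ENNReal.le_tsum (k - 1))
  have e : (2 : ℝ≥0∞) * ENNReal.ofReal (2 ^ (k - 1)) = ENNReal.ofReal (2 ^ k) := by
    rw [show (2 : ℝ≥0∞) = ENNReal.ofReal 2 by simp, ← ENNReal.ofReal_mul (by norm_num),
      zpow_sub_one₀ (by norm_num)]
    have : (2 : ℝ) * (2 ^ k * 2⁻¹) = 2 ^ k := by ring
    rw [this]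
  rw [e, if_pos]
  · gcongr
    rw [← ENNReal.ofReal_toReal hy]
    refine ENNReal.ofReal_le_ofReal ?_
    rw [show k - 1 + 2 = k + 1 by ring]
    exact h2
  · rw [← ENNReal.ofReal_toReal hy]
    exact (ENNReal.ofReal_lt_ofReal_iff hyr).2 h1

/-- The maximal function is bounded on `L^q`, `q > 1`. -/
theorem lintegral_maximalFn_rpow_le {q : ℝ} (hq : 1 < q) :
    ∃ C : ℝ≥0, ∀ w : E → ℝ≥0∞, Measurable w →
      ∫⁻ x, maximalFn μ w x ^ q ∂μ ≤ C * ∫⁻ x, w x ^ q ∂μ := by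
  -- the weak type bound at the level `2 ^ k` is multiplied by `2 ^ (k (q - 1)) = b ^ k` and summed
  set b : ℝ := 2 ^ (q - 1)
  have hb : 1 < b := Real.one_lt_rpow (by norm_num) (by linarith)
  set D : ℝ≥0∞ := ENNReal.ofReal (4 ^ Module.finrank ℝ E)
  refine ⟨((4 ^ q) * (4 ^ Module.finrank ℝ E) * (b / (b - 1))).toNNReal, fun w hw => ?_⟩
  have hM := measurable_maximalFn μ hw
  have hms : ∀ k : ℤ, MeasurableSet {x | ENNReal.ofReal (2 ^ k) < w x} := fun k =>
    measurableSet_lt measurable_const hw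
  have term : ∀ k : ℤ, ∫⁻ x, (if (2 : ℝ≥0∞) * ENNReal.ofReal (2 ^ k) < maximalFn μ w x then
      ENNReal.ofReal (2 ^ (k + 2)) ^ q else 0) ∂μ ≤ ∫⁻ x, ENNReal.ofReal (4 ^ q) * D *
        (w x * (if ENNReal.ofReal (2 ^ k) < w x then ENNReal.ofReal (b ^ k) else 0)) ∂μ := by
    intro k
    have e1 : ENNReal.ofReal (2 ^ (k + 2)) ^ q =
        ENNReal.ofReal (4 ^ q) * ENNReal.ofReal (b ^ k) * ENNReal.ofReal (2 ^ k) := by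
      rw [ENNReal.ofReal_rpow_of_pos (by positivity), ← ENNReal.ofReal_mul (by positivity),
        ← ENNReal.ofReal_mul (by positivity)]
      congr 1
      rw [zpow_add₀ (by norm_num), mul_comm, Real.mul_rpow (by norm_num) (by positivity)]
      have : ((2 : ℝ) ^ k) ^ q = b ^ k * 2 ^ k := by
        rw [← Real.rpow_intCast, ← Real.rpow_intCast, ← Real.rpow_mul (by norm_num),
          ← Real.rpow_mul (by norm_num), ← Real.rpow_add (by norm_num)]
        congr 1; ring
      rw [this]; norm_num; ring
    calc _ = ∫⁻ x, {x | 2 * ENNReal.ofReal (2 ^ k) < maximalFn μ w x}.indicator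
          (fun _ => ENNReal.ofReal (2 ^ (k + 2)) ^ q) x ∂μ := by
          refine lintegral_congr fun x => ?_
          simp [indicator_apply]
      _ = ENNReal.ofReal (4 ^ q) * ENNReal.ofReal (b ^ k) * (ENNReal.ofReal (2 ^ k) *
          μ {x | 2 * ENNReal.ofReal (2 ^ k) < maximalFn μ w x}) := by
          rw [lintegral_indicator_const (measurableSet_lt measurable_const hM), e1]
          ring
      _ ≤ ENNReal.ofReal (4 ^ q) * ENNReal.ofReal (b ^ k) * (D * ∫⁻ x,
          {y | ENNReal.ofReal (2 ^ k) < w y}.indicator w x ∂μ) := by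
          exact mul_le_mul_right (meas_two_mul_lt_maximalFn_le μ w _) _
      _ = ENNReal.ofReal (4 ^ q) * D * ENNReal.ofReal (b ^ k) * ∫⁻ x,
          {y | ENNReal.ofReal (2 ^ k) < w y}.indicator w x ∂μ := by ring
      _ = _ := by
          rw [← lintegral_const_mul _ (hw.indicator (hms k))]
          refine lintegral_congr fun x => ?_
          simp only [indicator_apply, mem_ofPred_eq]
          split_ifs
          · ring
          · simp
  calc _ ≤ ∫⁻ x, ∑' k : ℤ, (if (2 : ℝ≥0∞) * ENNReal.ofReal (2 ^ k) < maximalFn μ w x then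
      ENNReal.ofReal (2 ^ (k + 2)) ^ q else 0) ∂μ :=
        lintegral_mono fun x => rpow_le_tsum_zpow (by linarith) _
    _ ≤ ∑' k : ℤ, ∫⁻ x, ENNReal.ofReal (4 ^ q) * D *
        (w x * (if ENNReal.ofReal (2 ^ k) < w x then ENNReal.ofReal (b ^ k) else 0)) ∂μ := by
        rw [lintegral_tsum]
        · exact ENNReal.tsum_le_tsum term
        · intro k
          exact (Measurable.ite (measurableSet_lt measurable_const hM) measurable_const
            measurable_const).aemeasurable
    _ = ∫⁻ x, ENNReal.ofReal (4 ^ q) * D * (w x * ∑' k : ℤ,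
          (if ENNReal.ofReal (2 ^ k) < w x then ENNReal.ofReal (b ^ k) else 0)) ∂μ := by
        rw [← lintegral_tsum]
        · simp_rw [ENNReal.tsum_mul_left]
        · intro k
          exact ((hw.mul (Measurable.ite (hms k) measurable_const
            measurable_const)).const_mul _).aemeasurable
    _ ≤ ∫⁻ x, ENNReal.ofReal (4 ^ q) * D *
          (w x * (ENNReal.ofReal (b / (b - 1)) * w x ^ (q - 1))) ∂μ := by
        gcongr with x
        refine le_trans (ENNReal.tsum_le_tsum fun k => ?_) (tsum_zpow_le hb (w x ^ (q - 1)))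
        have e2 : ENNReal.ofReal (b ^ k) = ENNReal.ofReal (2 ^ k) ^ (q - 1) := by
          rw [ENNReal.ofReal_rpow_of_pos (by positivity)]
          congr 1
          rw [← Real.rpow_intCast, ← Real.rpow_intCast, ← Real.rpow_mul (by norm_num),
            ← Real.rpow_mul (by norm_num), mul_comm]
        split_ifs with h1 h2
        · exact le_rfl
        · exact absurd (by rw [e2]; gcongr) h2
        · exact zero_le
        · exact zero_le
    _ = _ := by
        rw [← lintegral_const_mul _ (hw.pow_const q)]
        refine lintegral_congr fun x => ?_
        have e3 : w x ^ q = w x * w x ^ (q - 1) := by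
          nth_rewrite 2 [← ENNReal.rpow_one (w x)]
          rw [← ENNReal.rpow_add_of_nonneg _ _ (by norm_num) (by linarith)]
          congr 1; ring
        rw [e3]
        have hnn : 0 ≤ b / (b - 1) := div_nonneg (by positivity) (by linarith)
        change _ = ENNReal.ofReal _ * _
        rw [ENNReal.ofReal_mul (by positivity), ENNReal.ofReal_mul (by positivity)]
        ring

end Maximal

/-! ### Duality -/

/-- A nonnegative function whose integrals against weights `h` are bounded by the `L^{a'}` norms of
`h` lies in `L^a`. The finiteness needed to divide is obtained by truncation. -/
theorem lintegral_rpow_le_of_forall_lintegral_mul_le {X : Type*} [MeasurableSpace X]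
    {μ : Measure X} [SigmaFinite μ] {a b : ℝ} (hab : a.HolderConjugate b) {F : X → ℝ≥0∞}
    (hF : Measurable F) (Y : ℝ≥0∞)
    (h : ∀ w : X → ℝ≥0∞, Measurable w → ∫⁻ x, F x * w x ∂μ ≤ Y * (∫⁻ x, w x ^ b ∂μ) ^ (1 / b)) :
    ∫⁻ x, F x ^ a ∂μ ≤ Y ^ a := by
  have ha : 0 < a := hab.pos
  have hb : 0 < b := hab.symm.pos
  -- truncations of `F` in size and in support, for which the integral in question is finite
  set G : ℕ → X → ℝ≥0∞ := fun n => (spanningSets μ n).indicator fun x => min (F x) n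
  have hG : ∀ n, Measurable (G n) := fun n =>
    (hF.min measurable_const).indicator (measurableSet_spanningSets μ n)
  have hGF : ∀ n x, G n x ≤ F x := fun n x => by
    by_cases hx : x ∈ spanningSets μ n
    · simp [G, hx]
    · simp [G, hx]
  have hmono : Monotone G := by
    intro n m hnm x
    by_cases hx : x ∈ spanningSets μ n
    · have hx' : x ∈ spanningSets μ m := monotone_spanningSets μ hnm hx
      simp only [G, hx, hx', indicator_of_mem]
      gcongr
    · simp [G, hx]
  have hsup : ∀ x, F x = ⨆ n, G n x := by
    intro x
    refine le_antisymm ?_ (iSup_le fun n => hGF n x)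
    refine le_of_forall_lt fun c hc => ?_
    obtain ⟨n, hn⟩ := ENNReal.exists_nat_gt hc.ne_top
    obtain ⟨m, hm⟩ := mem_iUnion.1 ((iUnion_spanningSets μ).symm ▸ mem_univ x)
    refine lt_of_lt_of_le ?_ (le_iSup (fun n => G n x) (max n m))
    have hx : x ∈ spanningSets μ (max n m) := monotone_spanningSets μ (le_max_right _ _) hm
    simp only [G, hx, indicator_of_mem, lt_min_iff]
    exact ⟨hc, hn.trans_le (by exact_mod_cast le_max_left _ _)⟩
  have key : ∀ n, ∫⁻ x, G n x ^ a ∂μ ≤ Y ^ a := by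
    intro n
    set I := ∫⁻ x, G n x ^ a ∂μ
    have hIfin : I ≠ ⊤ := by
      refine ne_top_of_le_ne_top (b := (n : ℝ≥0∞) ^ a * μ (spanningSets μ n)) ?_ ?_
      · exact ENNReal.mul_ne_top (ENNReal.rpow_ne_top_of_nonneg ha.le (by simp))
          (measure_spanningSets_lt_top μ n).ne
      · rw [← lintegral_indicator_const (measurableSet_spanningSets μ n)]
        refine lintegral_mono fun x => ?_
        by_cases hx : x ∈ spanningSets μ n
        · simp only [G, hx, indicator_of_mem]
          gcongr
          exact min_le_right _ _
        · simp [G, hx, ha]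
    -- the extremal function in Hölder's inequality
    have h1 := h (fun x => G n x ^ (a - 1)) ((hG n).pow_const _)
    have e1 : ∀ x, (G n x ^ (a - 1)) ^ b = G n x ^ a := fun x => by
      rw [← ENNReal.rpow_mul, hab.sub_one_mul_conj]
    simp_rw [e1] at h1
    have h2 : I ≤ Y * I ^ (1 / b) := by
      refine le_trans (lintegral_mono fun x => ?_) h1
      have : G n x ^ a = G n x * G n x ^ (a - 1) := by
        nth_rewrite 2 [← ENNReal.rpow_one (G n x)]
        rw [← ENNReal.rpow_add_of_nonneg _ _ (by norm_num) (by linarith [hab.lt])]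
        congr 1; ring
      rw [this]
      gcongr
      exact hGF n x
    rcases eq_or_ne I 0 with h0 | h0
    · rw [h0]; exact zero_le
    have h3 : I ^ (1 / a) ≤ Y := by
      have hpos : I ^ (1 / b) ≠ 0 := by
        simp [ENNReal.rpow_eq_zero_iff, h0, hIfin]
      have hfin : I ^ (1 / b) ≠ ⊤ := ENNReal.rpow_ne_top_of_nonneg (by positivity) hIfin
      have e2 : I = I ^ (1 / a) * I ^ (1 / b) := by
        rw [← ENNReal.rpow_add _ _ h0 hIfin]
        have := hab.inv_add_inv_eq_one
        rw [one_div, one_div, this, ENNReal.rpow_one]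
      rw [e2] at h2
      conv at h2 => rhs; rw [← e2]
      exact (ENNReal.mul_le_mul_iff_left hpos hfin).1 h2
    calc I = (I ^ (1 / a)) ^ a := by
          rw [← ENNReal.rpow_mul, one_div, inv_mul_cancel₀ ha.ne', ENNReal.rpow_one]
      _ ≤ Y ^ a := by gcongr
  have hlim : ∫⁻ x, F x ^ a ∂μ = ⨆ n, ∫⁻ x, G n x ^ a ∂μ := by
    rw [← lintegral_iSup (fun n => (hG n).pow_const _)]
    · refine lintegral_congr fun x => ?_
      rw [hsup x]
      exact (ENNReal.monotone_rpow_of_nonneg ha.le).map_iSup_of_continuousAt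
        ENNReal.continuous_rpow_const.continuousAt (by simp [ha])
    · intro n m hnm x
      simp only
      gcongr
      exact hmono hnm x
  rw [hlim]
  exact iSup_le key

/-! ### Averages over countable partitions -/

section Partition

variable {X ι : Type*} [MeasurableSpace X] [Countable ι] [MeasurableSpace ι]
  [MeasurableSingletonClass ι] {μ : Measure X}
  {H : Type*} [NormedAddCommGroup H] [InnerProductSpace ℂ H] [CompleteSpace H]

/-- The conditional expectation of `f` given the countable partition of `X` into the fibres of `c`:
its value at `x` is the average of `f` over the fibre through `x`. -/
noncomputable def cellAvg (μ : Measure X) (c : X → ι) (f : X → H) (x : X) : H :=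
  ⨍ y in c ⁻¹' {c x}, f y ∂μ

omit [Countable ι] [MeasurableSpace ι] [MeasurableSingletonClass ι] [CompleteSpace H] in
theorem cellAvg_congr (c : X → ι) (f : X → H) {x y : X} (h : c x = c y) :
    cellAvg μ c f x = cellAvg μ c f y := by
  simp only [cellAvg, h]

theorem lintegral_eq_tsum_fiber {c : X → ι} (hc : Measurable c) (G : X → ℝ≥0∞) :
    ∫⁻ x, G x ∂μ = ∑' i, ∫⁻ x in c ⁻¹' {i}, G x ∂μ := by
  rw [← lintegral_iUnion (fun i => hc (measurableSet_singleton i)), ← setLIntegral_univ]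
  · congr 2
    ext x; simp
  · intro i j hij
    exact Disjoint.preimage _ (by simpa using hij)

/-- To compare two integrals it suffices to do so on the fibres of a countable partition. -/
theorem lintegral_mono_fiber {c : X → ι} (hc : Measurable c) {F G : X → ℝ≥0∞}
    (h : ∀ x₀, ∫⁻ x in c ⁻¹' {c x₀}, F x ∂μ ≤ ∫⁻ x in c ⁻¹' {c x₀}, G x ∂μ) :
    ∫⁻ x, F x ∂μ ≤ ∫⁻ x, G x ∂μ := by
  rw [lintegral_eq_tsum_fiber hc, lintegral_eq_tsum_fiber hc G]
  refine ENNReal.tsum_le_tsum fun i => ?_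
  rcases (c ⁻¹' {i}).eq_empty_or_nonempty with he | ⟨x₀, hx₀⟩
  · simp [he]
  · obtain rfl : c x₀ = i := hx₀
    exact h x₀

/-- A function that is constant on the fibres is adapted to the partition. -/
theorem measurable_of_const_fiber
    {Y : Type*} [MeasurableSpace Y] {c : X → ι} (hc : Measurable c) {V : X → Y}
    (hV : ∀ x y, c x = c y → V x = V y) : Measurable V := by
  intro s _
  have : V ⁻¹' s = c ⁻¹' (c '' (V ⁻¹' s)) := by
    refine subset_antisymm (subset_preimage_image _ _) ?_
    rintro x ⟨y, hy, hxy⟩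
    rw [mem_preimage, ← hV y x hxy]
    exact hy
  rw [this]
  exact hc (to_countable _).measurableSet

/-- Pythagoras' theorem for the mean value. -/
theorem lintegral_sub_average_add {Q : Set X} (hQ : μ Q ≠ ⊤) {f : X → H}
    (hf : AEStronglyMeasurable f μ) {B : ℝ} (hB : ∀ x, ‖f x‖ ≤ B) :
    ∫⁻ x in Q, ‖f x - ⨍ y in Q, f y ∂μ‖ₑ ^ 2 ∂μ + μ Q * ‖⨍ y in Q, f y ∂μ‖ₑ ^ 2
      = ∫⁻ x in Q, ‖f x‖ₑ ^ 2 ∂μ := by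
  have : IsFiniteMeasure (μ.restrict Q) := ⟨by simpa using hQ.lt_top⟩
  set m := ⨍ y in Q, f y ∂μ
  have hint : Integrable f (μ.restrict Q) :=
    Integrable.of_bound hf.restrict B (Filter.Eventually.of_forall hB)
  have hsq : ∀ v : H, ‖v‖ₑ ^ 2 = ENNReal.ofReal (‖v‖ ^ 2) := fun v => by
    rw [← ofReal_norm, ENNReal.ofReal_pow (norm_nonneg _)]
  have hint2 : ∀ v : H, Integrable (fun x => ‖f x - v‖ ^ 2) (μ.restrict Q) := fun v =>
    Integrable.of_bound ((hf.restrict.sub aestronglyMeasurable_const).norm.pow 2) ((B + ‖v‖) ^ 2)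
      (Filter.Eventually.of_forall fun x => by
        rw [norm_pow, norm_norm]
        gcongr
        exact (norm_sub_le _ _).trans (by gcongr; exact hB x))
  have hint0 : Integrable (fun x => ‖f x‖ ^ 2) (μ.restrict Q) := by simpa using hint2 0
  have hm : (μ Q).toReal • m = ∫ x in Q, f x ∂μ := by
    have := measure_smul_setAverage (μ := μ) f hQ
    exact this
  have hreal : ∫ x in Q, ‖f x - m‖ ^ 2 ∂μ + (μ Q).toReal * ‖m‖ ^ 2 = ∫ x in Q, ‖f x‖ ^ 2 ∂μ := by
    have e1 : ∀ x, ‖f x - m‖ ^ 2 = ‖f x‖ ^ 2 - 2 * RCLike.re (inner ℂ m (f x)) + ‖m‖ ^ 2 :=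
      fun x => by rw [norm_sub_sq (𝕜 := ℂ), inner_re_symm]
    have hi : Integrable (fun x => inner ℂ m (f x)) (μ.restrict Q) := hint.const_inner m
    have hir : Integrable (fun x => RCLike.re (inner ℂ m (f x))) (μ.restrict Q) := hi.re
    simp_rw [e1]
    have hsub : Integrable (fun x => ‖f x‖ ^ 2 - 2 * RCLike.re (inner ℂ m (f x)))
        (μ.restrict Q) := hint0.sub (hir.const_mul 2)
    rw [integral_add hsub (integrable_const _),
      integral_sub hint0 (hir.const_mul 2), integral_const_mul, integral_re hi,
      integral_inner hint, ← hm]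
    have e2 : inner ℂ m ((μ Q).toReal • m) = (((μ Q).toReal * ‖m‖ ^ 2 : ℝ) : ℂ) := by
      rw [← Complex.coe_smul, inner_smul_right, inner_self_eq_norm_sq_to_K]
      push_cast
      rfl
    have e3 : RCLike.re ((((μ Q).toReal * ‖m‖ ^ 2 : ℝ) : ℂ)) = (μ Q).toReal * ‖m‖ ^ 2 :=
      Complex.ofReal_re _
    rw [e2, e3]
    simp [Measure.real]
    ring
  simp_rw [hsq]
  rw [← ofReal_integral_eq_lintegral_ofReal (hint2 m) (ae_of_all _ fun x => by positivity),
    ← ofReal_integral_eq_lintegral_ofReal hint0 (ae_of_all _ fun x => by positivity),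
    ← hreal, ENNReal.ofReal_add (by positivity) (by positivity),
    ENNReal.ofReal_mul (by positivity), ENNReal.ofReal_toReal hQ]

omit [CompleteSpace H] in
theorem stronglyMeasurable_cellAvg {c : X → ι} (hc : Measurable c) (f : X → H) :
    StronglyMeasurable (cellAvg μ c f) :=
  (StronglyMeasurable.of_discrete (f := fun i => ⨍ y in c ⁻¹' {i}, f y ∂μ)).comp_measurable hc

omit [Countable ι] [MeasurableSpace ι] [MeasurableSingletonClass ι] [CompleteSpace H] in
theorem norm_cellAvg_le (c : X → ι) {f : X → H} {B : ℝ} (hB : ∀ x, ‖f x‖ ≤ B) (x : X) :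
    ‖cellAvg μ c f x‖ ≤ B := by
  have hB0 : 0 ≤ B := (norm_nonneg _).trans (hB x)
  unfold cellAvg
  rw [setAverage_eq, norm_smul, Real.norm_of_nonneg (by positivity)]
  by_cases h : μ (c ⁻¹' {c x}) = ⊤
  · simp [Measure.real, h, hB0]
  · have := norm_setIntegral_le_of_norm_le_const (μ := μ) (lt_top_iff_ne_top.2 h) fun y _ => hB y
    calc _ ≤ (μ.real (c ⁻¹' {c x}))⁻¹ * (B * μ.real (c ⁻¹' {c x})) := by gcongr
      _ = B * ((μ.real (c ⁻¹' {c x}))⁻¹ * μ.real (c ⁻¹' {c x})) := by ring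
      _ ≤ B * 1 := by gcongr; exact inv_mul_le_one
      _ = B := mul_one _

/-- Pythagoras' theorem for averages over a partition, with a weight that is constant on the
fibres. -/
theorem lintegral_sub_cellAvg_add_le {c : X → ι} (hc : Measurable c)
    (hfin : ∀ i, μ (c ⁻¹' {i}) ≠ ⊤) {f : X → H}
    (hf : StronglyMeasurable f) {B : ℝ} (hB : ∀ x, ‖f x‖ ≤ B) {V : X → ℝ≥0∞}
    (hV : ∀ x y, c x = c y → V x = V y) :
    ∫⁻ x, ‖f x - cellAvg μ c f x‖ₑ ^ 2 * V x ∂μ + ∫⁻ x, ‖cellAvg μ c f x‖ₑ ^ 2 * V x ∂μ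
      ≤ ∫⁻ x, ‖f x‖ₑ ^ 2 * V x ∂μ := by
  have hVm := measurable_of_const_fiber hc hV
  have hAm : Measurable fun x => ‖cellAvg μ c f x‖ₑ ^ 2 * V x :=
    ((stronglyMeasurable_cellAvg hc f).enorm.pow_const 2).mul hVm
  rw [← lintegral_add_right _ hAm]
  refine lintegral_mono_fiber hc fun x₀ => ?_
  have hms : MeasurableSet (c ⁻¹' {c x₀}) := hc (measurableSet_singleton _)
  refine le_of_eq ?_
  calc _ = ∫⁻ x in c ⁻¹' {c x₀}, (‖f x - ⨍ y in c ⁻¹' {c x₀}, f y ∂μ‖ₑ ^ 2 +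
        ‖⨍ y in c ⁻¹' {c x₀}, f y ∂μ‖ₑ ^ 2) * V x₀ ∂μ := by
        refine setLIntegral_congr_fun hms fun x hx => ?_
        have hx : c x = c x₀ := hx
        simp only [cellAvg, hx, hV x x₀ hx]
        ring
    _ = (∫⁻ x in c ⁻¹' {c x₀}, ‖f x‖ₑ ^ 2 ∂μ) * V x₀ := by
        rw [lintegral_mul_const _ (by
            exact ((hf.sub stronglyMeasurable_const).enorm.pow_const 2).add measurable_const),
          lintegral_add_right _ measurable_const, setLIntegral_const,
          mul_comm (‖_‖ₑ ^ 2) (μ _), lintegral_sub_average_add (hfin _) hf.aestronglyMeasurable hB]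
    _ = _ := by
        rw [← lintegral_mul_const _ (hf.enorm.pow_const 2)]
        refine setLIntegral_congr_fun hms fun x hx => ?_
        have hx : c x = c x₀ := hx
        simp only [hV x x₀ hx]

/-- The tower property. -/
theorem cellAvg_cellAvg {c c' : X → ι} (hc : Measurable c) (hc' : Measurable c')
    (hcc : ∀ x y, c x = c y → c' x = c' y)
    (hfin : ∀ i, μ (c ⁻¹' {i}) ≠ ⊤) (hfin' : ∀ i, μ (c' ⁻¹' {i}) ≠ ⊤) {f : X → H}
    (hf : StronglyMeasurable f) {B : ℝ} (hB : ∀ x, ‖f x‖ ≤ B) :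
    cellAvg μ c' (cellAvg μ c f) = cellAvg μ c' f := by
  ext x
  unfold cellAvg
  rw [setAverage_eq, setAverage_eq]
  congr 1
  set Q := c' ⁻¹' {c' x}
  have : IsFiniteMeasure (μ.restrict Q) := ⟨by simpa using (hfin' _).lt_top⟩
  have hQ : MeasurableSet Q := hc' (measurableSet_singleton _)
  have hU : ⋃ i, Q ∩ c ⁻¹' {i} = Q := by ext y; simp
  have hd : Pairwise (Function.onFun Disjoint fun i => Q ∩ c ⁻¹' {i}) := fun i j hij =>
    (Disjoint.preimage c (by simpa using hij)).mono inter_subset_right inter_subset_right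
  have hm : ∀ i, MeasurableSet (Q ∩ c ⁻¹' {i}) := fun i => hQ.inter (hc (measurableSet_singleton i))
  have i1 : IntegrableOn f Q μ :=
    Integrable.of_bound hf.aestronglyMeasurable B (Filter.Eventually.of_forall hB)
  have i2 : IntegrableOn (cellAvg μ c f) Q μ :=
    Integrable.of_bound (stronglyMeasurable_cellAvg hc f).aestronglyMeasurable B
      (Filter.Eventually.of_forall (norm_cellAvg_le c hB))
  have h1 := hasSum_integral_iUnion hm hd (f := f) (by rwa [hU])
  have h2 := hasSum_integral_iUnion hm hd (f := cellAvg μ c f) (by rwa [hU])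
  rw [hU] at h1 h2
  suffices hterm : ∀ i, ∫ z in Q ∩ c ⁻¹' {i}, cellAvg μ c f z ∂μ = ∫ z in Q ∩ c ⁻¹' {i}, f z ∂μ by
    simp_rw [hterm] at h2
    exact h2.unique h1
  intro i
  rcases (Q ∩ c ⁻¹' {i}).eq_empty_or_nonempty with he | ⟨y, hy, hyi⟩
  · simp [he]
  · obtain rfl : c y = i := hyi
    have e : Q ∩ c ⁻¹' {c y} = c ⁻¹' {c y} := by
      refine inter_eq_right.2 fun z hz => ?_
      exact (hcc z y hz).trans hy
    rw [e]
    have e2 : ∫ z in c ⁻¹' {c y}, cellAvg μ c f z ∂μ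
        = ∫ z in c ⁻¹' {c y}, (⨍ w in c ⁻¹' {c y}, f w ∂μ) ∂μ := by
      refine setIntegral_congr_fun (hc (measurableSet_singleton _)) fun z hz => ?_
      exact cellAvg_congr c f hz
    rw [e2, setIntegral_const]
    exact measure_smul_setAverage f (hfin _)

/-- The weighted square function estimate for martingale differences, with increasing adapted
weights. -/
theorem sum_lintegral_cellAvg_sub_le {c : ℤ → X → ι} (hc : ∀ k, Measurable (c k))
    (hcc : ∀ k x y, c (k + 1) x = c (k + 1) y → c k x = c k y)
    (hfin : ∀ k i, μ (c k ⁻¹' {i}) ≠ ⊤) {f : X → H}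
    (hf : StronglyMeasurable f) {B : ℝ} (hB : ∀ x, ‖f x‖ ≤ B) {V : ℤ → X → ℝ≥0∞}
    (hV : ∀ k x y, c k x = c k y → V k x = V k y) (hmono : Monotone V) (n : ℤ) (N : ℕ) :
    ∑ i ∈ Finset.range N, ∫⁻ x, ‖cellAvg μ (c (n + i + 1)) f x - cellAvg μ (c (n + i)) f x‖ₑ ^ 2 *
        V (n + i) x ∂μ
      ≤ ∫⁻ x, ‖f x‖ₑ ^ 2 * V (n + N) x ∂μ := by
  have key : ∀ N : ℕ, ∑ i ∈ Finset.range N, ∫⁻ x, ‖cellAvg μ (c (n + i + 1)) f x -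
        cellAvg μ (c (n + i)) f x‖ₑ ^ 2 * V (n + i) x ∂μ
      ≤ ∫⁻ x, ‖cellAvg μ (c (n + N)) f x‖ₑ ^ 2 * V (n + N) x ∂μ := by
    intro N
    induction N with
    | zero => simp
    | succ N ih =>
      rw [Finset.sum_range_succ]
      calc _ ≤ ∫⁻ x, ‖cellAvg μ (c (n + N + 1)) f x - cellAvg μ (c (n + N)) f x‖ₑ ^ 2 *
            V (n + N) x ∂μ + ∫⁻ x, ‖cellAvg μ (c (n + N)) f x‖ₑ ^ 2 * V (n + N) x ∂μ := by
            rw [add_comm]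
            gcongr
        _ ≤ ∫⁻ x, ‖cellAvg μ (c (n + N + 1)) f x‖ₑ ^ 2 * V (n + N) x ∂μ := by
            have := lintegral_sub_cellAvg_add_le (hc (n + N)) (hfin (n + N))
              (stronglyMeasurable_cellAvg (μ := μ) (hc (n + N + 1)) f)
              (norm_cellAvg_le (c (n + N + 1)) hB) (hV (n + N))
            rwa [cellAvg_cellAvg (hc _) (hc _) (hcc _) (hfin _) (hfin _) hf hB] at this
        _ ≤ _ := by
            push_cast
            rw [← add_assoc]
            gcongr with x
            exact hmono (by omega) x
  refine (key N).trans ?_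
  refine le_trans ?_ (lintegral_sub_cellAvg_add_le (hc (n + N)) (hfin (n + N)) hf hB (hV (n + N)))
  exact le_add_self

omit [CompleteSpace H] in
/-- For martingale differences, a general weight is dominated by its averages over the cells of the
coarser partition, if consecutive partitions have comparable cells. -/
theorem lintegral_cellAvg_sub_mul_le {c c' : X → ι} (hc : Measurable c)
    (hcc : ∀ x y, c x = c y → c' x = c' y) (hfin : ∀ i, μ (c' ⁻¹' {i}) ≠ ⊤)
    (hpos : ∀ x, μ (c' ⁻¹' {c' x}) ≠ 0)
    {K : ℝ≥0∞} (hK : ∀ x, μ (c' ⁻¹' {c' x}) ≤ K * μ (c ⁻¹' {c x})) (f : X → H)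
    (w V : X → ℝ≥0∞) (hV : ∀ x y, c' x = c' y → V x = V y)
    (hwV : ∀ x, (μ (c' ⁻¹' {c' x}))⁻¹ * ∫⁻ y in c' ⁻¹' {c' x}, w y ∂μ ≤ V x) :
    ∫⁻ x, ‖cellAvg μ c f x - cellAvg μ c' f x‖ₑ ^ 2 * w x ∂μ
      ≤ K * ∫⁻ x, ‖cellAvg μ c f x - cellAvg μ c' f x‖ₑ ^ 2 * V x ∂μ := by
  have hdm : Measurable fun x => ‖cellAvg μ c f x - cellAvg μ c' f x‖ₑ ^ 2 :=
    measurable_of_const_fiber hc fun x y h => by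
      rw [cellAvg_congr c f h, cellAvg_congr c' f (hcc x y h)]
  have hVm : Measurable V := measurable_of_const_fiber hc fun x y h => hV x y (hcc x y h)
  have hdVm : Measurable fun x => ‖cellAvg μ c f x - cellAvg μ c' f x‖ₑ ^ 2 * V x := hdm.mul hVm
  rw [← lintegral_const_mul _ hdVm]
  refine lintegral_mono_fiber hc fun x₀ => ?_
  have hms : MeasurableSet (c ⁻¹' {c x₀}) := hc (measurableSet_singleton _)
  set D := ‖cellAvg μ c f x₀ - cellAvg μ c' f x₀‖ₑ ^ 2
  have hD : D ≠ ⊤ := by simp [D]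
  have hdc : ∀ x ∈ c ⁻¹' {c x₀}, ‖cellAvg μ c f x - cellAvg μ c' f x‖ₑ ^ 2 = D := fun x hx => by
    have hx : c x = c x₀ := hx
    simp only [D, cellAvg_congr c f hx, cellAvg_congr c' f (hcc x x₀ hx)]
  calc _ = ∫⁻ x in c ⁻¹' {c x₀}, D * w x ∂μ :=
        setLIntegral_congr_fun hms fun x hx => by simp only [hdc x hx]
    _ = D * ∫⁻ x in c ⁻¹' {c x₀}, w x ∂μ := lintegral_const_mul' _ _ hD
    _ ≤ D * ∫⁻ x in c' ⁻¹' {c' x₀}, w x ∂μ := by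
        gcongr
        exact fun x hx => hcc x x₀ hx
    _ ≤ D * (μ (c' ⁻¹' {c' x₀}) * V x₀) := by
        gcongr
        rw [mul_comm, ← ENNReal.div_le_iff (hpos x₀) (hfin _), ENNReal.div_eq_inv_mul]
        exact hwV x₀
    _ ≤ D * ((K * μ (c ⁻¹' {c x₀})) * V x₀) := by gcongr; exact hK x₀
    _ = ∫⁻ x in c ⁻¹' {c x₀}, K * (D * V x₀) ∂μ := by rw [setLIntegral_const]; ring
    _ = _ := setLIntegral_congr_fun hms fun x hx => by
        have h2 : c x = c x₀ := hx
        simp only [hdc x hx, hV x x₀ (hcc x x₀ h2)]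

end Partition

/-! ### The dyadic grid -/

/-- For `ω` uniformly distributed on `[0, 1)`, so is the fractional part of `y - M ω`. -/
theorem measurePreserving_fract_sub (y : ℝ) {M : ℕ} (hM : M ≠ 0) :
    MeasurePreserving (fun w : ℝ => Int.fract (y - M * w))
      (volume.restrict (Ico 0 1)) (volume.restrict (Ico 0 1)) := by
  have hmk : MeasurePreserving (fun w : ℝ => (w : UnitAddCircle)) (volume.restrict (Ico 0 1))
      volume := by
    have := UnitAddCircle.measurePreserving_mk 0
    rw [zero_add] at this
    rwa [Measure.restrict_congr_set Ico_ae_eq_Ioc]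
  have hg : Measurable fun z : UnitAddCircle => (AddCircle.equivIco 1 0 z : ℝ) :=
    measurable_subtype_coe.comp (AddCircle.measurableEquivIco 1 0).measurable
  have hfr : ∀ t : ℝ, (AddCircle.equivIco 1 0 (t : UnitAddCircle) : ℝ) = Int.fract t := fun t => by
    have := AddCircle.coe_equivIco_mk_apply (p := (1 : ℝ)) t
    rw [div_one, mul_one] at this
    exact this
  have hg' : MeasurePreserving (fun z : UnitAddCircle => (AddCircle.equivIco 1 0 z : ℝ)) volume
      (volume.restrict (Ico 0 1)) := by
    refine ⟨hg, ?_⟩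
    rw [← hmk.map_eq, Measure.map_map hg hmk.measurable]
    have : Measure.map id (volume.restrict (Ico (0 : ℝ) 1)) = volume.restrict (Ico 0 1) :=
      Measure.map_id
    conv_rhs => rw [← this]
    refine Measure.map_congr ?_
    filter_upwards [ae_restrict_mem measurableSet_Ico] with t ht
    simp only [Function.comp_apply, hfr, id]
    exact Int.fract_eq_self.2 ht
  have hz : MeasurePreserving (fun z : UnitAddCircle => (y : UnitAddCircle) - M • z)
      volume volume := by
    have h1 := Measure.measurePreserving_zsmul (volume : Measure UnitAddCircle) (n := -(M : ℤ))
      (by simpa)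
    have h2 := (measurePreserving_add_left (volume : Measure UnitAddCircle)
      (y : UnitAddCircle)).comp h1
    convert h2 using 1
    ext z
    simp [sub_eq_add_neg]
  have := hg'.comp (hz.comp hmk)
  convert this using 1
  ext w
  simp only [Function.comp_apply]
  rw [← hfr]
  congr 2
  simp

variable {d : ℕ}

/-- The uniform distribution on the unit cube `[0, 1)^d`. -/
noncomputable def unitCube (d : ℕ) : Measure (Rd d) :=
  volume.restrict {x | ∀ i, x i ∈ Ico (0 : ℝ) 1}

/-- The vector of fractional parts of the coordinates. -/
noncomputable def fractVec (x : Rd d) : Rd d := WithLp.toLp 2 fun i => Int.fract (x i)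

/-- The index in `ℤ^d` of the dyadic cube of side `2⁻ᵏ` containing `x`. -/
noncomputable def dyadicIdx (k : ℤ) (x : Rd d) : Fin d → ℤ := fun i => ⌊(2 : ℝ) ^ k * x i⌋

theorem unitCube_eq_map : unitCube d =
    (Measure.pi fun _ : Fin d => (volume : Measure ℝ).restrict (Ico 0 1)).map
      (WithLp.toLp 2) := by
  rw [← Measure.restrict_pi_pi, ← volume_pi]
  have h := PiLp.volume_preserving_toLp (Fin d)
  have := h.restrict_preimage_emb (MeasurableEquiv.toLp 2 (Fin d → ℝ)).measurableEmbedding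
    {x : Rd d | ∀ i, x i ∈ Ico (0 : ℝ) 1}
  rw [unitCube, ← this.map_eq]
  congr 2
  ext x
  simp [mem_pi]

instance : IsProbabilityMeasure (unitCube d) := by
  rw [unitCube_eq_map]
  have : IsProbabilityMeasure ((volume : Measure ℝ).restrict (Ico 0 1)) := ⟨by simp⟩
  exact Measure.isProbabilityMeasure_map
    (MeasurableEquiv.toLp 2 (Fin d → ℝ)).measurable.aemeasurable

theorem measurable_fractVec : Measurable (fractVec (d := d)) := by
  unfold fractVec
  refine (MeasurableEquiv.toLp 2 (Fin d → ℝ)).measurable.comp (measurable_pi_lambda _ fun i => ?_)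
  exact measurable_fract.comp (by fun_prop)

theorem measurePreserving_fractVec_sub (y : Rd d) {M : ℕ} (hM : M ≠ 0) :
    MeasurePreserving (fun w : Rd d => fractVec (y - (M : ℝ) • w)) (unitCube d) (unitCube d) := by
  have h1 := measurePreserving_pi (fun _ : Fin d => (volume : Measure ℝ).restrict (Ico 0 1))
    (fun _ => (volume : Measure ℝ).restrict (Ico 0 1))
    (fun i => measurePreserving_fract_sub (y i) hM)
  have hL : Measurable (WithLp.toLp 2 : (Fin d → ℝ) → Rd d) :=
    (MeasurableEquiv.toLp 2 (Fin d → ℝ)).measurable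
  have hm : Measurable fun w : Rd d => fractVec (y - (M : ℝ) • w) :=
    measurable_fractVec.comp (by fun_prop)
  refine ⟨hm, ?_⟩
  rw [unitCube_eq_map, Measure.map_map hm hL]
  conv_rhs => rw [← h1.map_eq, Measure.map_map hL h1.measurable]
  rfl

theorem measurable_dyadicIdx (k : ℤ) : Measurable (dyadicIdx (d := d) k) := by
  refine measurable_pi_lambda _ fun i => ?_
  exact Int.measurable_floor.comp (by fun_prop)

theorem dyadicIdx_of_succ (k : ℤ) (x y : Rd d) (h : dyadicIdx (k + 1) x = dyadicIdx (k + 1) y) :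
    dyadicIdx k x = dyadicIdx k y := by
  ext i
  have hi := congrFun h i
  simp only [dyadicIdx] at hi ⊢
  have e : ∀ t : ℝ, ⌊(2 : ℝ) ^ k * t⌋ = ⌊(2 : ℝ) ^ (k + 1) * t⌋ / (2 : ℕ) := fun t => by
    rw [← Int.floor_div_natCast, zpow_add_one₀ (by norm_num)]
    congr 1
    push_cast
    ring
  rw [e, e, hi]

theorem dyadicIdx_of_le {k l : ℤ} (hkl : k ≤ l) (x y : Rd d) (h : dyadicIdx l x = dyadicIdx l y) :
    dyadicIdx k x = dyadicIdx k y := by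
  obtain ⟨n, rfl⟩ := Int.le.dest hkl
  induction n with
  | zero => simpa using h
  | succ n ih =>
    rw [Nat.cast_succ, ← add_assoc] at h
    exact ih (by omega) (dyadicIdx_of_succ _ _ _ h)

/-- The dyadic cube of side `2⁻ᵏ` containing `x` is the affine image of the unit cube, with
the corner obtained by rounding down the coordinates of `x`. -/
theorem volume_dyadicCell_and_average (k : ℤ) (x : Rd d) :
    volume.restrict (dyadicIdx k ⁻¹' {dyadicIdx k x}) = ENNReal.ofReal (((2 : ℝ) ^ k)⁻¹ ^ d) •
      (unitCube d).map
        (fun v => x - ((2 : ℝ) ^ k)⁻¹ • fractVec ((2 : ℝ) ^ k • x) + ((2 : ℝ) ^ k)⁻¹ • v) := by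
  set r : ℝ := (2 : ℝ) ^ k
  have hr : 0 < r := by positivity
  set a : Rd d := x - r⁻¹ • fractVec (r • x)
  have ha : ∀ i, r * a i = (dyadicIdx k x i : ℝ) := fun i => by
    simp only [a, PiLp.sub_apply, PiLp.smul_apply, smul_eq_mul, fractVec, dyadicIdx]
    rw [mul_sub, mul_inv_cancel_left₀ hr.ne']
    have := Int.self_sub_fract (r * x i)
    linarith
  have hm : Measurable fun v : Rd d => a + r⁻¹ • v := by fun_prop
  have hset : ∀ v : Rd d, (a + r⁻¹ • v ∈ dyadicIdx k ⁻¹' {dyadicIdx k x}) ↔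
      ∀ i, v i ∈ Ico (0 : ℝ) 1 := fun v => by
    simp only [mem_preimage, mem_singleton_iff, funext_iff]
    refine forall_congr' fun i => ?_
    have : (2 : ℝ) ^ k * (a + r⁻¹ • v) i = (dyadicIdx k x i : ℝ) + v i := by
      simp only [PiLp.add_apply, PiLp.smul_apply, smul_eq_mul]
      rw [mul_add, ← ha i, mul_inv_cancel_left₀ hr.ne']
    rw [dyadicIdx, this, Int.floor_eq_iff]
    simp only [mem_Ico]
    constructor <;> rintro ⟨h1, h2⟩ <;> constructor <;> linarith
  ext s hs
  rw [Measure.restrict_apply hs, Measure.smul_apply, Measure.map_apply hm hs, unitCube,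
    Measure.restrict_apply (hm hs), smul_eq_mul]
  have hpre : (fun v : Rd d => a + r⁻¹ • v) ⁻¹' (s ∩ dyadicIdx k ⁻¹' {dyadicIdx k x}) =
      (fun v : Rd d => a + r⁻¹ • v) ⁻¹' s ∩ {v | ∀ i, v i ∈ Ico (0 : ℝ) 1} := by
    ext v
    rw [preimage_inter, mem_inter_iff, mem_inter_iff]
    exact and_congr Iff.rfl (hset v)
  rw [← hpre]
  have hpre2 : (fun v : Rd d => a + r⁻¹ • v) ⁻¹' (s ∩ dyadicIdx k ⁻¹' {dyadicIdx k x}) =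
      (fun v : Rd d => r⁻¹ • v) ⁻¹' ((fun v => a + v) ⁻¹'
        (s ∩ dyadicIdx k ⁻¹' {dyadicIdx k x})) := rfl
  rw [hpre2, Measure.addHaar_preimage_smul _ (inv_ne_zero hr.ne'), measure_preimage_add,
    ← mul_assoc, ← ENNReal.ofReal_mul (by positivity)]
  have : r⁻¹ ^ d * |(r⁻¹ ^ Module.finrank ℝ (Rd d))⁻¹| = 1 := by
    rw [finrank_euclideanSpace_fin, abs_of_pos (by positivity), mul_inv_cancel₀ (by positivity)]
  rw [this, ENNReal.ofReal_one, one_mul]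

theorem volume_dyadicCell (k : ℤ) (x : Rd d) :
    volume (dyadicIdx k ⁻¹' {dyadicIdx k x}) = ENNReal.ofReal (((2 : ℝ) ^ k)⁻¹ ^ d) := by
  rw [← Measure.restrict_apply_univ, volume_dyadicCell_and_average, Measure.smul_apply,
    Measure.map_apply (by fun_prop) MeasurableSet.univ]
  simp

theorem volume_dyadicCell_ne_top (k : ℤ) (i : Fin d → ℤ) :
    volume (dyadicIdx (d := d) k ⁻¹' {i}) ≠ ⊤ := by
  rcases (dyadicIdx (d := d) k ⁻¹' {i}).eq_empty_or_nonempty with he | ⟨x, hx⟩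
  · simp [he]
  · obtain rfl : dyadicIdx k x = i := hx
    rw [volume_dyadicCell]
    exact ENNReal.ofReal_ne_top

/-- A dyadic cube is contained in a ball of comparable radius. -/
theorem dyadicCell_subset_ball (k : ℤ) (x : Rd d) :
    dyadicIdx k ⁻¹' {dyadicIdx k x} ⊆ Metric.ball x ((2 : ℝ) ^ ((d : ℤ) - k)) := by
  intro y hy
  have hy : dyadicIdx k y = dyadicIdx k x := hy
  rw [Metric.mem_ball, dist_eq_norm, EuclideanSpace.norm_eq, Real.sqrt_lt' (by positivity)]
  have hi : ∀ i, ‖(y - x) i‖ ^ 2 ≤ ((2 : ℝ) ^ k)⁻¹ ^ 2 := fun i => by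
    have h := Int.abs_sub_lt_one_of_floor_eq_floor (congrFun hy i)
    rw [← mul_sub, abs_mul, abs_of_pos (by positivity)] at h
    gcongr
    rw [Real.norm_eq_abs, PiLp.sub_apply, ← one_div, le_div_iff₀' (by positivity)]
    exact h.le
  calc ∑ i, ‖(y - x) i‖ ^ 2 ≤ ∑ _i : Fin d, ((2 : ℝ) ^ k)⁻¹ ^ 2 := Finset.sum_le_sum fun i _ => hi i
    _ = d * ((2 : ℝ) ^ k)⁻¹ ^ 2 := by simp
    _ < (2 ^ d) ^ 2 * ((2 : ℝ) ^ k)⁻¹ ^ 2 := by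
        gcongr
        have h1 : (d : ℝ) < 2 ^ d := by exact_mod_cast Nat.lt_two_pow_self
        have h2 : (1 : ℝ) ≤ 2 ^ d := one_le_pow₀ (by norm_num)
        nlinarith
    _ = _ := by
        rw [zpow_sub₀ (by norm_num), zpow_natCast]
        field_simp

/-- The constant in the comparison of dyadic averages with the maximal function. -/
theorem dyadic_average_le_maximalFn (k : ℤ) (w : Rd d → ℝ≥0∞) (x : Rd d) :
    (volume (dyadicIdx k ⁻¹' {dyadicIdx k x}))⁻¹ * ∫⁻ y in dyadicIdx k ⁻¹' {dyadicIdx k x}, w y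
      ≤ ENNReal.ofReal ((2 ^ d) ^ d) * volume (Metric.ball (0 : Rd d) 1)
          * maximalFn volume w x := by
  have hb := lintegral_ball_le_maximalFn volume w x ((d : ℤ) - k)
  have hv : volume (Metric.ball x ((2 : ℝ) ^ ((d : ℤ) - k))) =
      ENNReal.ofReal (((2 : ℝ) ^ k)⁻¹ ^ d) *
      (ENNReal.ofReal ((2 ^ d) ^ d) * volume (Metric.ball (0 : Rd d) 1)) := by
    rw [Measure.addHaar_ball_of_pos _ _ (by positivity), finrank_euclideanSpace_fin, ← mul_assoc,
      ← ENNReal.ofReal_mul (by positivity), ← mul_pow]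
    congr 3
    rw [zpow_sub₀ (by norm_num), zpow_natCast]
    field_simp
  rw [hv] at hb
  have h0 : ENNReal.ofReal (((2 : ℝ) ^ k)⁻¹ ^ d) ≠ 0 := by
    simp only [ne_eq, ENNReal.ofReal_eq_zero, not_le]; positivity
  rw [volume_dyadicCell, ← ENNReal.div_eq_inv_mul, ENNReal.div_le_iff h0 ENNReal.ofReal_ne_top,
    mul_comm]
  refine le_trans (lintegral_mono_set (dyadicCell_subset_ball k x)) (hb.trans (le_of_eq ?_))
  ring

section

variable {H : Type*} [NormedAddCommGroup H] [InnerProductSpace ℂ H] [CompleteSpace H]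

omit [CompleteSpace H] in
/-- In the coordinates of the unit cube, the point `x` enters the conditional expectation through
its position `fractVec (2ᵏ x)` in its dyadic cube. -/
theorem cellAvg_dyadicIdx (k : ℤ) {f : Rd d → H} (hf : Continuous f) (x : Rd d) :
    cellAvg volume (dyadicIdx k) f x =
      ∫ v, f (x - ((2 : ℝ) ^ k)⁻¹ • fractVec ((2 : ℝ) ^ k • x) + ((2 : ℝ) ^ k)⁻¹ • v)
        ∂(unitCube d) := by
  rw [cellAvg, setAverage_eq, Measure.real, volume_dyadicCell, volume_dyadicCell_and_average,
    integral_smul_measure, ENNReal.toReal_ofReal (by positivity), smul_smul,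
    inv_mul_cancel₀ (by positivity), one_smul, integral_map (by fun_prop)]
  exact hf.stronglyMeasurable.aestronglyMeasurable

/-- The weighted square function estimate for dyadic martingale differences. -/
theorem sum_lintegral_dyadic_sub_le (n : ℤ) (N : ℕ) {f : Rd d → H} (hf : StronglyMeasurable f)
    {B : ℝ} (hB : ∀ x, ‖f x‖ ≤ B) (w : Rd d → ℝ≥0∞) :
    ∑ i ∈ Finset.range N, ∫⁻ x, ‖cellAvg volume (dyadicIdx (n + i + 1)) f x -
        cellAvg volume (dyadicIdx (n + i)) f x‖ₑ ^ 2 * w x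
      ≤ ENNReal.ofReal (2 ^ d) *
          (ENNReal.ofReal ((2 ^ d) ^ d) * volume (Metric.ball (0 : Rd d) 1)) *
        ∫⁻ x, ‖f x‖ₑ ^ 2 * maximalFn volume w x := by
  -- the largest average of `w` over the cubes containing `x` of levels up to `k`: increasing in
  -- `k`, constant on the cubes of level `k`, and dominated by the maximal function
  set V : ℤ → Rd d → ℝ≥0∞ := fun k x => ⨆ l : ℤ, ⨆ _ : l ≤ k,
    (volume (dyadicIdx l ⁻¹' {dyadicIdx l x}))⁻¹ * ∫⁻ y in dyadicIdx l ⁻¹' {dyadicIdx l x}, w y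
  have hVc : ∀ k x y, dyadicIdx k x = dyadicIdx k y → V k x = V k y := fun k x y h => by
    simp only [V]
    refine iSup_congr fun l => iSup_congr fun hl => ?_
    rw [dyadicIdx_of_le hl x y h]
  have hVmono : Monotone V := fun k k' h x => by
    refine iSup_mono fun l => iSup_le fun hl => ?_
    exact le_iSup_of_le (hl.trans h) le_rfl
  have hVle : ∀ k x, V k x ≤ ENNReal.ofReal ((2 ^ d) ^ d) * volume (Metric.ball (0 : Rd d) 1)
          * maximalFn volume w x := fun k x =>
    iSup_le fun l => iSup_le fun _ => dyadic_average_le_maximalFn l w x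
  have hC : ENNReal.ofReal ((2 ^ d) ^ d) * volume (Metric.ball (0 : Rd d) 1) ≠ ⊤ :=
    ENNReal.mul_ne_top ENNReal.ofReal_ne_top measure_ball_lt_top.ne
  calc _ ≤ ∑ i ∈ Finset.range N, ENNReal.ofReal (2 ^ d) *
        ∫⁻ x, ‖cellAvg volume (dyadicIdx (n + i + 1)) f x -
        cellAvg volume (dyadicIdx (n + i)) f x‖ₑ ^ 2 * V (n + i) x := by
        refine Finset.sum_le_sum fun i _ => ?_
        refine lintegral_cellAvg_sub_mul_le (measurable_dyadicIdx _) (dyadicIdx_of_succ _)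
          (volume_dyadicCell_ne_top _) (fun x => ?_) (fun x => ?_) f w _ (hVc _) (fun x => ?_)
        · rw [volume_dyadicCell]
          simp only [ne_eq, ENNReal.ofReal_eq_zero, not_le]; positivity
        · rw [volume_dyadicCell, volume_dyadicCell, ← ENNReal.ofReal_mul (by positivity), ← mul_pow]
          refine ENNReal.ofReal_le_ofReal (le_of_eq ?_)
          congr 1
          rw [zpow_add_one₀ (by norm_num)]
          field_simp
        · exact le_iSup₂_of_le (n + i) le_rfl le_rfl
    _ ≤ ENNReal.ofReal (2 ^ d) * ∫⁻ x, ‖f x‖ₑ ^ 2 * V (n + N) x := by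
        rw [← Finset.mul_sum]
        gcongr
        exact sum_lintegral_cellAvg_sub_le measurable_dyadicIdx dyadicIdx_of_succ
          volume_dyadicCell_ne_top hf hB hVc hVmono n N
    _ ≤ ENNReal.ofReal (2 ^ d) * ∫⁻ x, (ENNReal.ofReal ((2 ^ d) ^ d) *
          volume (Metric.ball (0 : Rd d) 1)) * (‖f x‖ₑ ^ 2 * maximalFn volume w x) := by
        refine mul_le_mul_right (lintegral_mono fun x => ?_) _
        refine (mul_le_mul_right (hVle (n + N) x) _).trans (le_of_eq ?_)
        ring
    _ = _ := by
        rw [lintegral_const_mul' _ _ hC, ← mul_assoc]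

/-! ### Averaging over translates of the grid -/

/-- The distribution of the difference of two independent uniform points of the unit cube. -/
noncomputable def symCube (d : ℕ) : Measure (Rd d) :=
  ((unitCube d).prod (unitCube d)).map fun p => p.1 - p.2

instance : IsProbabilityMeasure (symCube d) :=
  Measure.isProbabilityMeasure_map (by fun_prop)

/-- Convolution with the dilate of `symCube` to scale `2⁻ᵏ`. This is the average over all
translates of the dyadic grid of the conditional expectation at level `k`. -/
noncomputable def smoothing (k : ℤ) (f : Rd d → H) (x : Rd d) : H :=
  ∫ z, f (x - ((2 : ℝ) ^ k)⁻¹ • z) ∂(symCube d)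

omit [CompleteSpace H] in
/-- Jensen's inequality for the square of the norm. -/
theorem enorm_integral_sq_le {X : Type*} [MeasurableSpace X] {P : Measure X}
    [IsProbabilityMeasure P] {g : X → H} (hg : AEStronglyMeasurable g P) :
    ‖∫ x, g x ∂P‖ₑ ^ 2 ≤ ∫⁻ x, ‖g x‖ₑ ^ 2 ∂P := by
  have h1 := ENNReal.lintegral_mul_le_Lp_mul_Lq P Real.HolderConjugate.two_two
    hg.enorm (aemeasurable_const (b := (1 : ℝ≥0∞)))
  calc ‖∫ x, g x ∂P‖ₑ ^ 2 ≤ (∫⁻ x, ‖g x‖ₑ ∂P) ^ 2 := by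
        gcongr; exact enorm_integral_le_lintegral_enorm _
    _ ≤ ((∫⁻ x, ‖g x‖ₑ ^ (2 : ℝ) ∂P) ^ (1 / 2 : ℝ)) ^ 2 := by
        gcongr
        simpa using h1
    _ = _ := by
        rw [← ENNReal.rpow_natCast, ← ENNReal.rpow_mul]
        simp

omit [CompleteSpace H] in
theorem stronglyMeasurable_integral_unitCube (c : ℝ) {f : Rd d → H} (hf : Continuous f) :
    StronglyMeasurable fun p : Rd d × Rd d => ∫ v, f (p.1 - c • p.2 + c • v) ∂(unitCube d) := by
  have : Continuous fun q : (Rd d × Rd d) × Rd d => f (q.1.1 - c • q.1.2 + c • q.2) := by fun_prop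
  exact this.stronglyMeasurable.integral_prod_right'

omit [CompleteSpace H] in
/-- For the grid translated by `2⁻ⁿ w`, the position of `x` in its cube of side `2⁻⁽ⁿ⁺ʲ⁾` is the
fractional part of `2ⁿ⁺ʲ x - 2ʲ w`. -/
theorem cellAvg_translate (n : ℤ) (j : ℕ) {f : Rd d → H} (hf : Continuous f) (x w : Rd d) :
    cellAvg volume (dyadicIdx (n + j)) (fun y => f (y + ((2 : ℝ) ^ n)⁻¹ • w))
      (x - ((2 : ℝ) ^ n)⁻¹ • w) =
    ∫ v, f (x - ((2 : ℝ) ^ (n + j))⁻¹ • fractVec ((2 : ℝ) ^ (n + j) • x - ((2 ^ j : ℕ) : ℝ) • w) +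
      ((2 : ℝ) ^ (n + j))⁻¹ • v) ∂(unitCube d) := by
  rw [cellAvg_dyadicIdx _ (by fun_prop)]
  refine integral_congr_ae (Filter.Eventually.of_forall fun v => ?_)
  simp only
  have : (2 : ℝ) ^ (n + j) • (x - ((2 : ℝ) ^ n)⁻¹ • w) =
      (2 : ℝ) ^ (n + j) • x - ((2 ^ j : ℕ) : ℝ) • w := by
    rw [smul_sub, smul_smul, zpow_add₀ (by norm_num), zpow_natCast]
    congr 2
    push_cast
    field_simp
  rw [this]
  congr 1
  abel

omit [CompleteSpace H] in
theorem smoothing_eq_integral (k : ℤ) {f : Rd d → H} (hf : Continuous f) {B : ℝ}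
    (hB : ∀ x, ‖f x‖ ≤ B) (x : Rd d) :
    smoothing k f x = ∫ u, ∫ v, f (x - ((2 : ℝ) ^ k)⁻¹ • u + ((2 : ℝ) ^ k)⁻¹ • v)
      ∂(unitCube d) ∂(unitCube d) := by
  have hc : Continuous fun p : Rd d × Rd d => f (x - ((2 : ℝ) ^ k)⁻¹ • (p.1 - p.2)) := by fun_prop
  rw [smoothing, symCube, integral_map (by fun_prop)
    (by exact (by fun_prop : Continuous fun z => f (x - ((2 : ℝ) ^ k)⁻¹ • z)).aestronglyMeasurable),
    integral_prod _ (Integrable.of_bound hc.aestronglyMeasurable B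
      (Filter.Eventually.of_forall fun _ => hB _))]
  congr 1; ext u; congr 1; ext v
  congr 1
  rw [smul_sub]
  abel

omit [CompleteSpace H] in
/-- For `w` uniform in the unit cube, the position of `x` in its cube of the translated grid is
uniform in the unit cube as well, at all levels `n + j`, so that the average over the translations
is `smoothing`. -/
theorem integral_cellAvg_translate (n : ℤ) (j : ℕ) {f : Rd d → H} (hf : Continuous f) {B : ℝ}
    (hB : ∀ x, ‖f x‖ ≤ B) (x : Rd d) :
    ∫ w, cellAvg volume (dyadicIdx (n + j)) (fun y => f (y + ((2 : ℝ) ^ n)⁻¹ • w))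
      (x - ((2 : ℝ) ^ n)⁻¹ • w) ∂(unitCube d) = smoothing (n + j) f x := by
  simp_rw [cellAvg_translate n j hf]
  rw [smoothing_eq_integral _ hf hB]
  have hp := measurePreserving_fractVec_sub ((2 : ℝ) ^ (n + j) • x) (M := 2 ^ j) (by positivity)
  have hG := ((stronglyMeasurable_integral_unitCube ((2 : ℝ) ^ (n + j))⁻¹ hf).comp_measurable
    (measurable_prodMk_left (x := x))).aestronglyMeasurable (μ := unitCube d)
  rw [← hp.map_eq] at hG
  have h := integral_map hp.aemeasurable hG
  rw [hp.map_eq] at h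
  exact h.symm

/-- The constant of the weighted square function estimate. -/
noncomputable def squareConst (d : ℕ) : ℝ≥0∞ :=
  ENNReal.ofReal (2 ^ d) * (ENNReal.ofReal ((2 ^ d) ^ d) * volume (Metric.ball (0 : Rd d) 1))

theorem squareConst_ne_top : squareConst d ≠ ⊤ :=
  ENNReal.mul_ne_top ENNReal.ofReal_ne_top
    (ENNReal.mul_ne_top ENNReal.ofReal_ne_top measure_ball_lt_top.ne)

/-- Averaging the martingale inequality over the translates of the grid. -/
theorem sum_lintegral_smoothing_sub_le (n : ℤ) (N : ℕ) {f : Rd d → H} (hf : Continuous f)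
    {B : ℝ} (hB : ∀ x, ‖f x‖ ≤ B) {w : Rd d → ℝ≥0∞} (hw : Measurable w) :
    ∑ i ∈ Finset.range N, ∫⁻ x, ‖smoothing (n + i + 1) f x - smoothing (n + i) f x‖ₑ ^ 2 * w x
      ≤ squareConst d * ∫⁻ x, ‖f x‖ₑ ^ 2 * maximalFn volume w x := by
  set c : ℝ := ((2 : ℝ) ^ n)⁻¹
  -- the conditional expectation of `f` at the level `n + j` for the grid translated by `c • u`
  set A : ℕ → Rd d → Rd d → H := fun j x u =>
    cellAvg volume (dyadicIdx (n + j)) (fun y => f (y + c • u)) (x - c • u)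
  have hA : ∀ j, StronglyMeasurable (Function.uncurry (A j)) := fun j => by
    have h1 := stronglyMeasurable_integral_unitCube ((2 : ℝ) ^ (n + j))⁻¹ hf
    have h2 : Measurable fun p : Rd d × Rd d =>
        (p.1, fractVec ((2 : ℝ) ^ (n + j) • p.1 - ((2 ^ j : ℕ) : ℝ) • p.2)) :=
      measurable_fst.prodMk (measurable_fractVec.comp (by fun_prop))
    have h3 := h1.comp_measurable h2
    convert h3 using 1
    ext p
    exact cellAvg_translate n j hf p.1 p.2
  have hAB : ∀ j x u, ‖A j x u‖ ≤ B := fun j x u => norm_cellAvg_le _ (fun y => hB _) _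
  have hAi : ∀ j x, Integrable (A j x) (unitCube d) := fun j x =>
    Integrable.of_bound ((hA j).comp_measurable measurable_prodMk_left).aestronglyMeasurable B
      (Filter.Eventually.of_forall fun u => hAB j x u)
  have hterm : ∀ i : ℕ, ∫⁻ x, ‖smoothing (n + i + 1) f x - smoothing (n + i) f x‖ₑ ^ 2 * w x ≤
      ∫⁻ u, ∫⁻ x, ‖A (i + 1) x u - A i x u‖ₑ ^ 2 * w x ∂volume ∂(unitCube d) := by
    intro i
    have hm : Measurable (Function.uncurry fun (x : Rd d) (u : Rd d) =>
        ‖A (i + 1) x u - A i x u‖ₑ ^ 2 * w x) :=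
      (((hA (i + 1)).sub (hA i)).enorm.pow_const 2).mul (hw.comp measurable_fst)
    rw [lintegral_lintegral_swap (by
      exact (hm.comp measurable_swap).aemeasurable)]
    refine lintegral_mono fun x => ?_
    have hms : Measurable fun u => ‖A (i + 1) x u - A i x u‖ₑ ^ 2 :=
      ((((hA (i + 1)).sub (hA i)).comp_measurable measurable_prodMk_left).enorm.pow_const 2)
    simp only
    rw [lintegral_mul_const _ hms]
    gcongr
    have e : smoothing (n + i + 1) f x - smoothing (n + i) f x =
        ∫ u, (A (i + 1) x u - A i x u) ∂(unitCube d) := by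
      rw [integral_sub (hAi _ x) (hAi _ x), integral_cellAvg_translate n (i + 1) hf hB,
        integral_cellAvg_translate n i hf hB]
      rw [Nat.cast_succ, ← add_assoc]
    rw [e]
    exact enorm_integral_sq_le ((hAi _ x).sub (hAi _ x)).aestronglyMeasurable
  -- the martingale inequality for a fixed translate of the grid
  have hu : ∀ u, ∑ i ∈ Finset.range N, ∫⁻ x, ‖A (i + 1) x u - A i x u‖ₑ ^ 2 * w x ≤
      squareConst d * ∫⁻ x, ‖f x‖ₑ ^ 2 * maximalFn volume w x := by
    intro u
    have h1 := sum_lintegral_dyadic_sub_le n N (f := fun y => f (y + c • u))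
      (by fun_prop : Continuous fun y => f (y + c • u)).stronglyMeasurable (fun y => hB _)
      (fun y => w (y + c • u))
    have h2 : ∫⁻ x, ‖f (x + c • u)‖ₑ ^ 2 * maximalFn volume (fun y => w (y + c • u)) x =
        ∫⁻ x, ‖f x‖ₑ ^ 2 * maximalFn volume w x := by
      simp_rw [maximalFn_comp_add_right]
      exact lintegral_add_right_eq_self (fun x => ‖f x‖ₑ ^ 2 * maximalFn volume w x) (c • u)
    rw [h2] at h1
    refine le_trans (le_of_eq ?_) h1
    refine Finset.sum_congr rfl fun i _ => ?_
    rw [← lintegral_add_right_eq_self _ (c • u)]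
    simp only [A, add_sub_cancel_right, Nat.cast_succ, ← add_assoc]
  calc _ ≤ ∑ i ∈ Finset.range N, ∫⁻ u, ∫⁻ x, ‖A (i + 1) x u - A i x u‖ₑ ^ 2 * w x
        ∂volume ∂(unitCube d) := Finset.sum_le_sum fun i _ => hterm i
    _ = ∫⁻ u, ∑ i ∈ Finset.range N, ∫⁻ x, ‖A (i + 1) x u - A i x u‖ₑ ^ 2 * w x
        ∂volume ∂(unitCube d) := by
        rw [lintegral_finsetSum]
        intro i _
        have hm : Measurable (Function.uncurry fun (u : Rd d) (x : Rd d) =>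
            ‖A (i + 1) x u - A i x u‖ₑ ^ 2 * w x) :=
          ((((hA (i + 1)).sub (hA i)).comp_measurable measurable_swap).enorm.pow_const 2).mul
            (hw.comp measurable_snd)
        exact hm.lintegral_prod_right'
    _ ≤ ∫⁻ u, squareConst d * ∫⁻ x, ‖f x‖ₑ ^ 2 * maximalFn volume w x ∂volume ∂(unitCube d) :=
        lintegral_mono hu
    _ = _ := by rw [lintegral_const, measure_univ, mul_one]

/-- The weighted Littlewood–Paley inequality, for the differences of smoothing operators whose
scales differ by the factor `2 ^ m`. -/
theorem tsum_lintegral_smoothing_sub_le (m : ℕ) {f : Rd d → H} (hf : Continuous f)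
    {B : ℝ} (hB : ∀ x, ‖f x‖ ≤ B) {w : Rd d → ℝ≥0∞} (hw : Measurable w) :
    ∑' k : ℤ, ∫⁻ x, ‖smoothing k f x - smoothing (k - m) f x‖ₑ ^ 2 * w x
      ≤ m ^ 2 * squareConst d * ∫⁻ x, ‖f x‖ₑ ^ 2 * maximalFn volume w x := by
  set Y := squareConst d * ∫⁻ x, ‖f x‖ₑ ^ 2 * maximalFn volume w x
  have hsm : ∀ k, StronglyMeasurable (smoothing k f) := fun k => by
    have : Continuous fun q : Rd d × Rd d => f (q.1 - ((2 : ℝ) ^ k)⁻¹ • q.2) := by fun_prop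
    exact this.stronglyMeasurable.integral_prod_right'
  set a : ℤ → ℝ≥0∞ := fun k => ∫⁻ x, ‖smoothing (k + 1) f x - smoothing k f x‖ₑ ^ 2 * w x
  have ha : ∑' k, a k ≤ Y := by
    rw [ENNReal.tsum_eq_iSup_sum]
    refine iSup_le fun s => ?_
    obtain ⟨n, hn⟩ := s.bddBelow
    obtain ⟨n', hn'⟩ := s.bddAbove
    refine le_trans ?_ (sum_lintegral_smoothing_sub_le n (n' + 1 - n).toNat hf hB hw)
    have hinj : Function.Injective fun i : ℕ => n + (i : ℤ) := fun i j h => by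
      simpa using h
    have e : ∑ i ∈ Finset.range (n' + 1 - n).toNat, ∫⁻ x,
        ‖smoothing (n + i + 1) f x - smoothing (n + i) f x‖ₑ ^ 2 * w x =
        ∑ k ∈ (Finset.range (n' + 1 - n).toNat).image (fun i : ℕ => n + (i : ℤ)), a k := by
      rw [Finset.sum_image hinj.injOn]
    rw [e]
    refine Finset.sum_le_sum_of_subset fun k hk => ?_
    have h1 := hn (Finset.mem_coe.2 hk)
    have h2 := hn' (Finset.mem_coe.2 hk)
    exact Finset.mem_image.2 ⟨(k - n).toNat, by simp; omega, by omega⟩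
  have hk : ∀ k : ℤ, ∫⁻ x, ‖smoothing k f x - smoothing (k - m) f x‖ₑ ^ 2 * w x ≤
      m * ∑ i ∈ Finset.range m, a (k - (i + 1 : ℕ)) := by
    intro k
    have hpt : ∀ x, ‖smoothing k f x - smoothing (k - m) f x‖ₑ ^ 2 ≤ m * ∑ i ∈ Finset.range m,
        ‖smoothing (k - (i + 1 : ℕ) + 1) f x - smoothing (k - (i + 1 : ℕ)) f x‖ₑ ^ 2 := by
      intro x
      have e : smoothing k f x - smoothing (k - m) f x = ∑ i ∈ Finset.range m,
          (smoothing (k - (i + 1 : ℕ) + 1) f x - smoothing (k - (i + 1 : ℕ)) f x) := by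
        have := Finset.sum_range_sub' (fun i : ℕ => smoothing (k - (i : ℕ)) f x) m
        rw [Nat.cast_zero, sub_zero] at this
        rw [← this]
        refine Finset.sum_congr rfl fun i _ => ?_
        congr 2
        push_cast; ring
      have hsq : ∀ v : H, ‖v‖ₑ ^ 2 = ENNReal.ofReal (‖v‖ ^ 2) := fun v => by
        rw [← ofReal_norm, ENNReal.ofReal_pow (norm_nonneg _)]
      simp_rw [hsq]
      rw [← ENNReal.ofReal_sum_of_nonneg (fun _ _ => by positivity), ← ENNReal.ofReal_natCast,
        ← ENNReal.ofReal_mul (by positivity), e]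
      refine ENNReal.ofReal_le_ofReal ?_
      refine (pow_le_pow_left₀ (norm_nonneg _) (norm_sum_le _ _) 2).trans ?_
      refine (sq_sum_le_card_mul_sum_sq).trans ?_
      rw [Finset.card_range]
    calc _ ≤ ∫⁻ x, (m * ∑ i ∈ Finset.range m, ‖smoothing (k - (i + 1 : ℕ) + 1) f x -
          smoothing (k - (i + 1 : ℕ)) f x‖ₑ ^ 2) * w x := by
          gcongr with x
          exact hpt x
      _ = _ := by
          simp_rw [mul_assoc, Finset.sum_mul]
          rw [lintegral_const_mul' _ _ (by simp), lintegral_finsetSum]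
          intro i _
          exact (((hsm _).sub (hsm _)).enorm.pow_const 2).mul hw
  calc _ ≤ ∑' k : ℤ, m * ∑ i ∈ Finset.range m, a (k - (i + 1 : ℕ)) := ENNReal.tsum_le_tsum hk
    _ = m * ∑ i ∈ Finset.range m, ∑' k : ℤ, a (k - (i + 1 : ℕ)) := by
        rw [ENNReal.tsum_mul_left, Summable.tsum_finsetSum fun _ _ => ENNReal.summable]
    _ ≤ m * ∑ i ∈ Finset.range m, Y := by
        gcongr with i
        exact ((Equiv.subRight ((i + 1 : ℕ) : ℤ)).tsum_eq a).le.trans ha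
    _ = _ := by
        simp only [Finset.sum_const, Finset.card_range, nsmul_eq_mul, Y]
        ring

end

/-! ### Frequency cutoffs adapted to the smoothing operators -/

/-- The Riemann–Lebesgue lemma for the indicator function of the unit cube. -/
theorem tendsto_charFun_unitCube_cocompact :
    Filter.Tendsto (charFun (unitCube d)) (Filter.cocompact (Rd d)) (nhds 0) := by
  set S : Set (Rd d) := {x | ∀ i, x i ∈ Ico (0 : ℝ) 1}
  have hS : MeasurableSet S := by
    have : S = ⋂ i, (fun x : Rd d => x i) ⁻¹' Ico 0 1 := by ext; simp [S]
    rw [this]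
    exact MeasurableSet.iInter fun i => measurableSet_Ico.preimage (by fun_prop)
  have h := tendsto_integral_exp_inner_smul_cocompact (V := Rd d) (S.indicator fun _ => (1 : ℂ))
  have hm : Filter.Tendsto (fun t : Rd d => (-(2 * Real.pi)⁻¹ : ℝ) • t) (Filter.cocompact (Rd d))
      (Filter.cocompact (Rd d)) :=
    (Homeomorph.smulOfNeZero (-(2 * Real.pi)⁻¹ : ℝ) (by
      simp [Real.pi_ne_zero])).isClosedEmbedding.tendsto_cocompact
  refine (h.comp hm).congr fun t => ?_
  simp only [Function.comp_apply, charFun_apply, unitCube]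
  rw [← integral_indicator hS]
  refine integral_congr_ae (Filter.Eventually.of_forall fun v => ?_)
  by_cases hv : v ∈ S
  · simp only [hv, indicator_of_mem, Circle.smul_def, Real.fourierChar_apply, smul_eq_mul, mul_one]
    rw [inner_smul_right]
    congr 1
    push_cast
    have : (Real.pi : ℂ) ≠ 0 := by exact_mod_cast Real.pi_ne_zero
    field_simp
  · simp [hv]

theorem charFun_symCube (t : Rd d) :
    charFun (symCube d) t = charFun (unitCube d) t * charFun (unitCube d) (-t) := by
  have h := integral_prod_mul (μ := unitCube d) (ν := unitCube d)
    (fun x : Rd d => Complex.exp ((inner ℝ x t : ℝ) * Complex.I))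
    (fun x : Rd d => Complex.exp ((inner ℝ x (-t) : ℝ) * Complex.I))
  simp only [charFun_apply]
  rw [← h, symCube, integral_map (by fun_prop) (by fun_prop)]
  congr 1; ext p
  rw [← Complex.exp_add, ← add_mul, inner_sub_left, inner_neg_right]
  push_cast
  rw [sub_eq_add_neg]

theorem tendsto_charFun_symCube_cocompact :
    Filter.Tendsto (charFun (symCube d)) (Filter.cocompact (Rd d)) (nhds 0) := by
  refine squeeze_zero_norm (fun t => ?_) (tendsto_charFun_unitCube_cocompact.norm.trans (by simp))
  rw [charFun_symCube, norm_mul]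
  exact mul_le_of_le_one_right (norm_nonneg _) (norm_charFun_le_one _)

theorem norm_le_of_mem_unitCube {x : Rd d} (hx : ∀ i, x i ∈ Ico (0 : ℝ) 1) : ‖x‖ ≤ d + 1 := by
  rw [EuclideanSpace.norm_eq, Real.sqrt_le_left (by positivity)]
  calc ∑ i, ‖x i‖ ^ 2 ≤ ∑ _i : Fin d, (1 : ℝ) := Finset.sum_le_sum fun i _ => by
        rw [Real.norm_eq_abs, sq_abs]
        have := hx i
        nlinarith [this.1, this.2]
    _ = d := by simp
    _ ≤ _ := by nlinarith [(Nat.cast_nonneg d : (0 : ℝ) ≤ d)]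

theorem ae_unitCube_norm_le : ∀ᵐ x ∂(unitCube d), ‖x‖ ≤ d + 1 := by
  unfold unitCube
  have hS : MeasurableSet {x : Rd d | ∀ i, x i ∈ Ico (0 : ℝ) 1} := by
    have : {x : Rd d | ∀ i, x i ∈ Ico (0 : ℝ) 1} = ⋂ i, (fun x : Rd d => x i) ⁻¹' Ico 0 1 := by
      ext; simp
    rw [this]
    exact MeasurableSet.iInter fun i => measurableSet_Ico.preimage (by fun_prop)
  filter_upwards [ae_restrict_mem hS] with x hx
  exact norm_le_of_mem_unitCube hx

theorem ae_symCube_norm_le : ∀ᵐ x ∂(symCube d), ‖x‖ ≤ 2 * (d + 1) := by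
  unfold symCube
  rw [ae_map_iff (by fun_prop) (measurableSet_le (by fun_prop) measurable_const)]
  have h1 : ∀ᵐ p ∂((unitCube d).prod (unitCube d)), ‖p.1‖ ≤ d + 1 :=
    Measure.quasiMeasurePreserving_fst.ae ae_unitCube_norm_le
  have h2 : ∀ᵐ p ∂((unitCube d).prod (unitCube d)), ‖p.2‖ ≤ d + 1 :=
    Measure.quasiMeasurePreserving_snd.ae ae_unitCube_norm_le
  filter_upwards [h1, h2] with p hp1 hp2
  linarith [norm_sub_le p.1 p.2]

theorem contDiff_charFun_symCube : ContDiff ℝ ∞ (charFun (symCube d)) :=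
  contDiff_charFun' fun _ => MemLp.of_bound (by fun_prop) _ ae_symCube_norm_le

/-- The symbol of the operator `f ↦ smoothing 0 f - smoothing (-m) f`. -/
noncomputable def diffSymbol (d m : ℕ) (ξ : Rd d) : ℂ :=
  charFun (symCube d) (-ξ) - charFun (symCube d) (-((2 : ℝ) ^ m • ξ))

theorem contDiff_diffSymbol (m : ℕ) : ContDiff ℝ ∞ (diffSymbol d m) :=
  (contDiff_charFun_symCube.comp contDiff_neg).sub
    (contDiff_charFun_symCube.comp (contDiff_const_smul _).neg)

/-- A smooth dyadic partition of unity in frequency, `1 = ∑ₖ (θ(2⁻ᵏ ξ) - θ(2⁻ᵏ⁺¹ ξ))` for `ξ ≠ 0`,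
together with a factorization of its pieces through the symbol `diffSymbol d m`. -/
structure FreqCutoff (d : ℕ) where
  /-- the logarithmic ratio of the scales of the smoothing operators -/
  m : ℕ
  /-- the low frequency cutoff -/
  θ : Rd d → ℝ
  /-- the quotient of `θ(ξ) - θ(2ξ)` by `diffSymbol d m ξ` -/
  η : Rd d → ℂ
  /-- the inner radius of the annulus carrying `η` -/
  r : ℝ
  /-- the outer radius of the annulus carrying `η` -/
  R : ℝ
  r_pos : 0 < r
  contDiff_θ : ContDiff ℝ ∞ θ
  θ_nonneg : ∀ ξ, 0 ≤ θ ξ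
  θ_le_one : ∀ ξ, θ ξ ≤ 1
  θ_eq_one : ∀ ξ, ‖ξ‖ ≤ r → θ ξ = 1
  θ_eq_zero : ∀ ξ, R ≤ ‖ξ‖ → θ ξ = 0
  contDiff_η : ContDiff ℝ ∞ η
  η_eq_zero : ∀ ξ, ‖ξ‖ < r ∨ R < ‖ξ‖ → η ξ = 0
  η_mul : ∀ ξ, η ξ * diffSymbol d m ξ = θ ξ - θ ((2 : ℝ) • ξ)

/-- The symbol `diffSymbol d m` does not vanish on the annulus `a / 8 < |ξ| < a` if `a` is small,
since then `charFun (symCube d) ξ` is close to `1`, and if `2 ^ m a` is so large that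
`charFun (symCube d) (2 ^ m ξ)` is close to `0` by the Riemann–Lebesgue lemma. -/
theorem exists_diffSymbol_ne_zero :
    ∃ a : ℝ, 0 < a ∧ ∃ m : ℕ, ∀ ξ : Rd d, a / 8 < ‖ξ‖ → ‖ξ‖ < a → diffSymbol d m ξ ≠ 0 := by
  have hcont : Continuous (charFun (symCube d)) := contDiff_charFun_symCube.continuous
  have h0 : charFun (symCube d) 0 = 1 := by simp [charFun_zero]
  obtain ⟨a, ha, hball⟩ := Metric.continuous_iff.1 hcont 0 (1 / 2) (by norm_num)
  have h1 := tendsto_charFun_symCube_cocompact (d := d)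
  obtain ⟨R, hR⟩ : ∃ R : ℝ, ∀ x : Rd d, R < ‖x‖ → ‖charFun (symCube d) x‖ < 1 / 2 := by
    have h2 := (Metric.tendsto_nhds.1 h1) (1 / 2) (by norm_num)
    rw [← Metric.cobounded_eq_cocompact] at h2
    obtain ⟨R, -, hR⟩ := Filter.hasBasis_cobounded_norm.eventually_iff.1 h2
    exact ⟨R, fun x hx => by simpa using hR (le_of_lt hx)⟩
  obtain ⟨m, hm⟩ := pow_unbounded_of_one_lt (R / (a / 8)) (one_lt_two (α := ℝ))
  refine ⟨a, ha, m, fun ξ hξ hξ' h => ?_⟩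
  have e1 := hball (-ξ) (by simpa using hξ')
  rw [h0, dist_eq_norm] at e1
  have e2 := hR (-((2 : ℝ) ^ m • ξ)) (by
    rw [norm_neg, norm_smul, Real.norm_of_nonneg (by positivity)]
    rw [div_lt_iff₀ (by positivity)] at hm
    refine hm.trans_le ?_
    gcongr)
  have e3 := sub_eq_zero.1 h
  rw [← e3] at e2
  have := norm_sub_norm_le (1 : ℂ) (charFun (symCube d) (-ξ))
  rw [norm_one, norm_sub_rev] at this
  linarith

instance : Nonempty (FreqCutoff d) := by
  obtain ⟨a, ha, m, hm⟩ := exists_diffSymbol_ne_zero (d := d)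
  let b : ContDiffBump (0 : Rd d) := ⟨a / 3, a / 2, by positivity, by linarith⟩
  have hb0 : ∀ ξ : Rd d, a / 2 ≤ ‖ξ‖ → b ξ = 0 := fun ξ h => b.zero_of_le_dist (by simpa using h)
  have hb1 : ∀ ξ : Rd d, ‖ξ‖ ≤ a / 3 → b ξ = 1 := fun ξ h =>
    b.one_of_mem_closedBall (by simpa using h)
  set φ : Rd d → ℝ := fun ξ => b ξ - b ((2 : ℝ) • ξ)
  have hφs : ContDiff ℝ ∞ φ := b.contDiff.sub (b.contDiff.comp (contDiff_const_smul _))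
  have hφ0 : ∀ ξ : Rd d, ‖ξ‖ ≤ a / 6 ∨ a / 2 ≤ ‖ξ‖ → φ ξ = 0 := by
    rintro ξ (h | h)
    · have e : ‖(2 : ℝ) • ξ‖ = 2 * ‖ξ‖ := by rw [norm_smul]; simp
      simp only [φ]
      rw [hb1 ξ (by linarith), hb1 _ (by rw [e]; linarith), sub_self]
    · have e : ‖(2 : ℝ) • ξ‖ = 2 * ‖ξ‖ := by rw [norm_smul]; simp
      simp only [φ]
      rw [hb0 ξ h, hb0 _ (by rw [e]; linarith [norm_nonneg ξ]), sub_self]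
  refine ⟨⟨m, b, fun ξ => (φ ξ : ℂ) / diffSymbol d m ξ, a / 6, a / 2, by positivity, b.contDiff,
    fun _ => b.nonneg, fun _ => b.le_one, fun ξ h => hb1 ξ (by linarith), hb0, ?_, ?_, ?_⟩⟩
  · simp_rw [div_eq_mul_inv]
    rw [contDiff_iff_contDiffAt]
    intro ξ
    by_cases h : a / 8 < ‖ξ‖ ∧ ‖ξ‖ < a
    · exact (Complex.ofRealCLM.contDiff.comp hφs).contDiffAt.mul
        ((contDiff_diffSymbol m).contDiffAt.inv (hm ξ h.1 h.2))
    · have hev : ∀ᶠ ζ in nhds ξ, ‖ζ‖ ≤ a / 6 ∨ a / 2 ≤ ‖ζ‖ := by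
        rcases not_and_or.1 h with h | h
        · filter_upwards [(isOpen_lt continuous_norm continuous_const).mem_nhds
            (show ‖ξ‖ < a / 6 by linarith)] with ζ hζ
          exact Or.inl (le_of_lt hζ)
        · filter_upwards [(isOpen_lt continuous_const continuous_norm).mem_nhds
            (show a / 2 < ‖ξ‖ by linarith)] with ζ hζ
          exact Or.inr (le_of_lt hζ)
      refine (contDiffAt_const (c := (0 : ℂ))).congr_of_eventuallyEq ?_
      filter_upwards [hev] with ζ hζ
      simp [hφ0 ζ hζ]
  · intro ξ h
    have : φ ξ = 0 := hφ0 ξ (h.imp le_of_lt le_of_lt)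
    simp [this]
  · intro ξ
    by_cases h : ‖ξ‖ ≤ a / 6 ∨ a / 2 ≤ ‖ξ‖
    · have h1 := hφ0 ξ h
      simp only [h1, Complex.ofReal_zero, zero_div, zero_mul]
      have : ((φ ξ : ℝ) : ℂ) = 0 := by rw [h1]; simp
      rw [← this]
      simp [φ]
    · push Not at h
      rw [div_mul_cancel₀ _ (hm ξ (by linarith) (by linarith))]
      simp [φ]

/-! ### Kernels of smooth compactly supported symbols -/

section Bessel

open FourierTransform Complex ContinuousLinearMap
open scoped Convolution RealInnerProductSpace

/-- Bessel's inequality for the Fourier transform: the autocorrelation of `g` has the Fourier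
transform `|𝓕 g|²` and the value `∫ |g|²` at the origin, where it is recovered from its Fourier
transform by Gaussian summation. -/
theorem lintegral_fourier_sq_le {g : Rd d → ℂ} (hg : Continuous g) (hgs : HasCompactSupport g) :
    ∫⁻ w, ‖𝓕 g w‖ₑ ^ 2 ≤ ∫⁻ w, ‖g w‖ₑ ^ 2 := by
  set g' : Rd d → ℂ := fun x => starRingEnd ℂ (g (-x))
  have hg' : Continuous g' := by fun_prop
  have hgs' : HasCompactSupport g' :=
    (hgs.comp_homeomorph (Homeomorph.neg (Rd d))).comp_left (map_zero _)
  have hgi := hg.integrable_of_hasCompactSupport (μ := volume) hgs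
  have hgi' := hg'.integrable_of_hasCompactSupport (μ := volume) hgs'
  set f : Rd d → ℂ := g ⋆[mul ℂ ℂ] g'
  have hfc : Continuous f := hgs'.continuous_convolution_right _ hgi.locallyIntegrable hg'
  have hfi : Integrable f := hgi.integrable_convolution _ hgi'
  have hF' : ∀ w, 𝓕 g' w = starRingEnd ℂ (𝓕 g w) := fun w => by
    rw [Real.fourier_eq, Real.fourier_eq, ← integral_conj, ← integral_neg_eq_self]
    congr 1; ext v
    simp [g', Circle.smul_def, Real.fourierChar_apply, ← Complex.exp_conj,
      map_ofNat (starRingEnd ℂ)]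
  have hF : ∀ w, 𝓕 f w = ((‖𝓕 g w‖ ^ 2 : ℝ) : ℂ) := fun w => by
    rw [Real.fourier_mul_convolution_eq hgi hgi', hF', mul_conj']
    push_cast; rfl
  have hf0 : f 0 = ((∫ w, ‖g w‖ ^ 2 : ℝ) : ℂ) := by
    have e : ∀ w, g w * starRingEnd ℂ (g w) = ((‖g w‖ ^ 2 : ℝ) : ℂ) := fun w => by
      rw [mul_conj']; push_cast; rfl
    simp only [f, convolution, g', mul_apply', zero_sub, neg_neg, e]
    exact integral_ofReal
  -- Gaussian summation of the Fourier transform of `f` at the origin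
  have hlim := Real.tendsto_integral_gaussian_smul' hfi (hfc.continuousAt (x := 0))
  have hB : Filter.Tendsto (fun c : ℝ => ∫ w : Rd d, cexp (-c⁻¹ * ‖w‖ ^ 2 +
      2 * Real.pi * I * ⟪(0 : Rd d), w⟫) • 𝓕 f w) Filter.atTop (nhds (f 0)) := by
    refine hlim.congr' ?_
    filter_upwards [Filter.Ioi_mem_atTop 0] with c (hc : 0 < c)
    have J : Integrable (fun w : Rd d =>
        cexp (-c⁻¹ * ‖w‖ ^ 2 + 2 * Real.pi * I * ⟪(0 : Rd d), w⟫)) :=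
      GaussianFourier.integrable_cexp_neg_mul_sq_norm_add (by simpa) _ _
    have h2 : ∫ w, 𝓕 (fun w : Rd d => cexp (-c⁻¹ * ‖w‖ ^ 2 +
        2 * Real.pi * I * ⟪(0 : Rd d), w⟫)) w • f w = ∫ w : Rd d, cexp (-c⁻¹ * ‖w‖ ^ 2 +
        2 * Real.pi * I * ⟪(0 : Rd d), w⟫) • 𝓕 f w := by
      simpa using! (VectorFourier.integral_fourierIntegral_smul_eq_flip (L := innerₗ (Rd d))
        Real.continuous_fourierChar continuous_inner J hfi)
    rw [← h2]
    congr with w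
    rw [fourier_gaussian_innerProductSpace' (by simpa)]
    have e1 : (Real.pi : ℂ) / (((c⁻¹ : ℝ)) : ℂ) = Real.pi * c := by
      push_cast; rw [div_inv_eq_mul]
    have e2 : ∀ z : ℂ, -(Real.pi : ℂ) ^ 2 * z / (((c⁻¹ : ℝ)) : ℂ) = -Real.pi ^ 2 * c * z := by
      intro z
      push_cast; rw [div_inv_eq_mul]; ring
    rw [e1, e2]
  have hg2 : Integrable fun w => ‖g w‖ ^ 2 :=
    (hg.norm.pow 2).integrable_of_hasCompactSupport (hgs.mono fun x hx => by
      simpa using hx)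
  have hFc : Continuous (𝓕 g) :=
    VectorFourier.fourierIntegral_continuous Real.continuous_fourierChar continuous_inner hgi
  have hFb : ∀ w, ‖𝓕 g w‖ ≤ ∫ v, ‖g v‖ := fun w =>
    VectorFourier.norm_fourierIntegral_le_integral_norm _ _ _ _ _
  have hFE : ∀ c : ℝ, 0 < c →
      Integrable fun w : Rd d => Real.exp (-c⁻¹ * ‖w‖ ^ 2) * ‖𝓕 g w‖ ^ 2 := fun c hc => by
    have J : Integrable (fun w : Rd d => Real.exp (-c⁻¹ * ‖w‖ ^ 2)) := by
      have := (GaussianFourier.integrable_cexp_neg_mul_sq_norm_add (V := Rd d) (b := c⁻¹) (by simpa)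
        0 0).norm
      refine this.congr (Filter.Eventually.of_forall fun w => ?_)
      simp only [zero_mul, add_zero, Complex.norm_exp]
      congr 1
      rw [← ofReal_pow, ← ofReal_inv, ← ofReal_neg, ← ofReal_mul, ofReal_re]
    refine J.mul_bdd (c := (∫ v, ‖g v‖) ^ 2) (hFc.norm.pow 2).aestronglyMeasurable
      (Filter.Eventually.of_forall fun w => ?_)
    rw [norm_pow, norm_norm]
    gcongr
    exact hFb w
  have hsq : ∀ z : ℂ, ENNReal.ofReal (‖z‖ ^ 2) = ‖z‖ₑ ^ 2 := fun z => by
    rw [← ofReal_norm, ENNReal.ofReal_pow (norm_nonneg _)]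
  have e0 : ENNReal.ofReal (f 0).re = ∫⁻ w, ‖g w‖ₑ ^ 2 := by
    rw [hf0, ofReal_re, ofReal_integral_eq_lintegral_ofReal hg2
      (Filter.Eventually.of_forall fun _ => by positivity)]
    simp_rw [hsq]
  have hC : Filter.Tendsto (fun c : ℝ => ∫⁻ w : Rd d, ENNReal.ofReal (Real.exp (-c⁻¹ * ‖w‖ ^ 2)) *
      ‖𝓕 g w‖ₑ ^ 2) Filter.atTop (nhds (∫⁻ w, ‖g w‖ₑ ^ 2)) := by
    have h1 := (ENNReal.tendsto_ofReal ((Complex.continuous_re.tendsto _).comp hB))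
    rw [e0] at h1
    refine h1.congr' ?_
    filter_upwards [Filter.Ioi_mem_atTop 0] with c (hc : 0 < c)
    have e1 : ∀ w : Rd d, cexp (-c⁻¹ * ‖w‖ ^ 2 + 2 * Real.pi * I * ⟪(0 : Rd d), w⟫) • 𝓕 f w =
        ((Real.exp (-c⁻¹ * ‖w‖ ^ 2) * ‖𝓕 g w‖ ^ 2 : ℝ) : ℂ) := fun w => by
      rw [hF, inner_zero_left, ofReal_mul, ofReal_exp]
      simp
    have e2 : ∫ w : Rd d, cexp (-c⁻¹ * ‖w‖ ^ 2 + 2 * Real.pi * I * ⟪(0 : Rd d), w⟫) • 𝓕 f w =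
        ((∫ w : Rd d, Real.exp (-c⁻¹ * ‖w‖ ^ 2) * ‖𝓕 g w‖ ^ 2 : ℝ) : ℂ) := by
      simp_rw [e1]
      exact integral_ofReal
    have e3 : ((fun z : ℂ => z.re) ∘ fun c : ℝ => ∫ w : Rd d, cexp (-c⁻¹ * ‖w‖ ^ 2 +
        2 * Real.pi * I * ⟪(0 : Rd d), w⟫) • 𝓕 f w) c =
        ∫ w : Rd d, Real.exp (-c⁻¹ * ‖w‖ ^ 2) * ‖𝓕 g w‖ ^ 2 := by
      rw [Function.comp_apply, e2, ofReal_re]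
    refine (congrArg ENNReal.ofReal e3).trans ?_
    rw [ofReal_integral_eq_lintegral_ofReal (hFE c hc)
      (Filter.Eventually.of_forall fun _ => by positivity)]
    refine lintegral_congr fun w => ?_
    rw [ENNReal.ofReal_mul (by positivity), hsq]
  -- the integrands being nonnegative, Fatou's lemma suffices for the inequality
  have hn : Filter.Tendsto (fun n : ℕ => ∫⁻ w : Rd d,
      ENNReal.ofReal (Real.exp (-(n : ℝ)⁻¹ * ‖w‖ ^ 2)) * ‖𝓕 g w‖ₑ ^ 2) Filter.atTop
      (nhds (∫⁻ w, ‖g w‖ₑ ^ 2)) := hC.comp tendsto_natCast_atTop_atTop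
  have hFm : Measurable (𝓕 g) := hFc.measurable
  rw [← hn.liminf_eq]
  refine le_trans (le_of_eq ?_) (lintegral_liminf_le fun n => by fun_prop)
  refine lintegral_congr fun w => (Filter.Tendsto.liminf_eq ?_).symm
  have : Filter.Tendsto (fun n : ℕ => ENNReal.ofReal (Real.exp (-(n : ℝ)⁻¹ * ‖w‖ ^ 2)) *
      ‖𝓕 g w‖ₑ ^ 2) Filter.atTop
      (nhds (ENNReal.ofReal (Real.exp (-0 * ‖w‖ ^ 2)) * ‖𝓕 g w‖ₑ ^ 2)) := by
    refine ENNReal.Tendsto.mul_const (ENNReal.tendsto_ofReal ?_) (Or.inl (by simp))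
    refine (Real.continuous_exp.tendsto _).comp ?_
    exact (tendsto_inv_atTop_nhds_zero_nat.neg).mul_const _
  simpa using this

end Bessel

section WeightedKernel

open FourierTransform

/-- Comparison with the Fourier transform of Mathlib, whose character is `e^{-2πi x·ξ}`. -/
theorem invFourierT_eq_fourier (m : Rd d → ℂ) (x : Rd d) :
    invFourierT m x = ((((2 * Real.pi) ^ d)⁻¹ : ℝ) : ℂ) * 𝓕 m (-(2 * Real.pi)⁻¹ • x) := by
  rw [invFourierT, Real.fourier_eq]
  congr 2
  ext ξ
  rw [Circle.smul_def, Real.fourierChar_apply, smul_eq_mul, inner_smul_right]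
  congr 2
  have : (Real.pi : ℂ) ≠ 0 := by exact_mod_cast Real.pi_ne_zero
  push_cast
  field_simp

theorem lintegral_comp_smul (F : Rd d → ℝ≥0∞) {r : ℝ} (hr : r ≠ 0) :
    ∫⁻ x, F (r • x) = ENNReal.ofReal |(r ^ d)⁻¹| * ∫⁻ x, F x := by
  have h := Measure.map_addHaar_smul (volume : Measure (Rd d)) hr
  have h2 := (Homeomorph.smulOfNeZero r hr).measurableEmbedding.lintegral_map (μ := volume) F
  have e : (⇑(Homeomorph.smulOfNeZero r hr) : Rd d → Rd d) = fun x => r • x := rfl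
  rw [e] at h2
  rw [← h2, h, lintegral_smul_measure, finrank_euclideanSpace_fin, smul_eq_mul]

theorem norm_pow_le_sum_coord (x : Rd d) {a : ℕ} (ha : a ≠ 0) :
    ‖x‖ ^ (2 * a) ≤ d ^ (a - 1) * ∑ i, |x i| ^ (2 * a) := by
  obtain ⟨n, rfl⟩ := Nat.exists_eq_succ_of_ne_zero ha
  rw [pow_mul, EuclideanSpace.norm_sq_eq]
  simp_rw [pow_mul, Real.norm_eq_abs]
  rcases Nat.eq_zero_or_pos d with rfl | hd
  · simp
  have := pow_sum_div_card_le_sum_pow (s := Finset.univ) (f := fun i => |x i| ^ 2)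
    (fun i _ => by positivity) n
  rw [Finset.card_univ, Fintype.card_fin, div_le_iff₀ (by positivity)] at this
  simpa [mul_comm] using this

/-- Symbols with `a` bounded derivatives have kernels with a finite moment of order `a` in `L²`. -/
theorem lintegral_invFourierT_sq_mul_le (d : ℕ) {a : ℕ} (ha : a ≠ 0) (R : ℝ) :
    ∃ C : ℝ≥0, ∀ m : Rd d → ℂ, ContDiff ℝ a m → (∀ ξ, R < ‖ξ‖ → m ξ = 0) → ∀ B : ℝ,
      (∀ n ≤ a, ∀ ξ, ‖iteratedFDeriv ℝ n m ξ‖ ≤ B) →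
      ∫⁻ x, ‖invFourierT m x‖ₑ ^ 2 * ENNReal.ofReal (1 + ‖x‖ ^ (2 * a)) ≤
        C * ENNReal.ofReal (B ^ 2) := by
  have hb : volume (Metric.closedBall (0 : Rd d) R) ≠ ⊤ := measure_closedBall_lt_top.ne
  set c : ℝ := ((2 * Real.pi) ^ d)⁻¹
  have hc : 0 < c := by positivity
  set C : ℝ≥0∞ := ENNReal.ofReal (c ^ 2) * ENNReal.ofReal c⁻¹ * (1 + d ^ a) *
    volume (Metric.closedBall (0 : Rd d) R)
  have hC : C ≠ ⊤ := by
    refine ENNReal.mul_ne_top (ENNReal.mul_ne_top (ENNReal.mul_ne_top ?_ ?_) ?_) hb <;> finiteness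
  refine ⟨C.toNNReal, fun m hm hsupp B hB => ?_⟩
  rw [ENNReal.coe_toNNReal hC]
  have hB0 : 0 ≤ B := (norm_nonneg _).trans (hB 0 (Nat.zero_le _) 0)
  have hcs : HasCompactSupport m :=
    HasCompactSupport.intro (isCompact_closedBall (0 : Rd d) R) fun ξ hξ =>
      hsupp ξ (by simpa using hξ)
  -- Bessel's inequality for continuous functions bounded by `B` with support in the ball
  have key : ∀ g : Rd d → ℂ, Continuous g → (∀ ξ, ξ ∉ Metric.closedBall (0 : Rd d) R → g ξ = 0) →
      (∀ ξ, ‖g ξ‖ ≤ B) → ∫⁻ y, ‖𝓕 g y‖ₑ ^ 2 ≤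
        ENNReal.ofReal (B ^ 2) * volume (Metric.closedBall (0 : Rd d) R) := by
    intro g hg hg0 hgB
    refine (lintegral_fourier_sq_le hg (HasCompactSupport.intro
      (isCompact_closedBall (0 : Rd d) R) hg0)).trans ?_
    rw [← lintegral_indicator_const measurableSet_closedBall]
    refine lintegral_mono fun ξ => ?_
    by_cases h : ξ ∈ Metric.closedBall (0 : Rd d) R
    · rw [indicator_of_mem h, ← ofReal_norm, ← ENNReal.ofReal_pow (norm_nonneg _)]
      exact ENNReal.ofReal_le_ofReal (by gcongr; exact hgB ξ)
    · simp [h, hg0 ξ h]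
  -- the pure derivatives of order `a`
  set g : Fin d → Rd d → ℂ := fun i ξ =>
    iteratedFDeriv ℝ a m ξ fun _ => EuclideanSpace.single i (1 : ℝ)
  have hint : ∀ n : ℕ, (n : ℕ∞) ≤ (a : ℕ∞) → Integrable (iteratedFDeriv ℝ n m) := fun n hn =>
    (hm.continuous_iteratedFDeriv (by exact_mod_cast hn)).integrable_of_hasCompactSupport
      (hcs.iteratedFDeriv n)
  have hgF : ∀ i y, ‖𝓕 (g i) y‖ₑ ^ 2 =
      ENNReal.ofReal ((2 * Real.pi * |y i|) ^ (2 * a)) * ‖𝓕 m y‖ₑ ^ 2 := by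
    intro i y
    have h1 := congrFun (Real.fourier_iteratedFDeriv (N := (a : ℕ∞)) (by exact_mod_cast hm) hint
      (n := a) le_rfl) y
    have h2 := Real.fourier_continuousMultilinearMap_apply (hint a le_rfl)
      (m := fun _ => EuclideanSpace.single i (1 : ℝ)) (v := y)
    rw [h1] at h2
    have h3 : ‖𝓕 (g i) y‖ = (2 * Real.pi * |y i|) ^ a * ‖𝓕 m y‖ := by
      change ‖𝓕 (fun x => iteratedFDeriv ℝ a m x fun _ => EuclideanSpace.single i (1 : ℝ)) y‖ = _
      rw [← h2]
      rw [VectorFourier.fourierPowSMulRight_apply]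
      have e : innerSL ℝ y (EuclideanSpace.single i (1 : ℝ)) = y i :=
        (EuclideanSpace.inner_single_right i (1 : ℝ) y).trans (by simp)
      simp [mul_pow, abs_of_pos Real.pi_pos, mul_assoc, e]
    rw [← ofReal_norm, h3, ENNReal.ofReal_mul (by positivity), mul_pow, ofReal_norm,
      ← ENNReal.ofReal_pow (by positivity), ← pow_mul, mul_comm a 2]
  have hg0 : ∀ i ξ, ξ ∉ Metric.closedBall (0 : Rd d) R → g i ξ = 0 := by
    intro i ξ hξ
    have : ξ ∉ tsupport (iteratedFDeriv ℝ a m) := fun h => hξ <| by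
      refine (closure_minimal (fun z hz => ?_) Metric.isClosed_closedBall :
        tsupport m ⊆ Metric.closedBall 0 R) (tsupport_iteratedFDeriv_subset a h)
      by_contra hcon
      exact hz (hsupp z (by simpa using hcon))
    simp [g, image_eq_zero_of_notMem_tsupport this]
  have hgB : ∀ i ξ, ‖g i ξ‖ ≤ B := fun i ξ => by
    refine (ContinuousMultilinearMap.le_opNorm _ _).trans ?_
    simpa using hB a le_rfl ξ
  have hgc : ∀ i, Continuous (g i) := fun i =>
    (ContinuousMultilinearMap.apply ℝ (fun _ : Fin a => Rd d) ℂ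
      (fun _ => EuclideanSpace.single i (1 : ℝ))).continuous.comp
      (hm.continuous_iteratedFDeriv le_rfl)
  have hmB : ∀ ξ, ‖m ξ‖ ≤ B := fun ξ => by simpa using hB 0 (Nat.zero_le _) ξ
  have hm0 : ∀ ξ, ξ ∉ Metric.closedBall (0 : Rd d) R → m ξ = 0 := fun ξ hξ =>
    hsupp ξ (by simpa using hξ)
  set r : ℝ := -(2 * Real.pi)⁻¹
  have hr : r ≠ 0 := by simp [r, Real.pi_ne_zero]
  have hFm : Measurable fun y => ‖𝓕 m y‖ₑ ^ 2 :=
    ((VectorFourier.fourierIntegral_continuous Real.continuous_fourierChar continuous_inner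
      (hm.continuous.integrable_of_hasCompactSupport hcs)).enorm.measurable.pow_const 2)
  calc ∫⁻ x, ‖invFourierT m x‖ₑ ^ 2 * ENNReal.ofReal (1 + ‖x‖ ^ (2 * a))
      ≤ ∫⁻ x, ENNReal.ofReal (c ^ 2) * (fun y : Rd d => ‖𝓕 m y‖ₑ ^ 2 +
          d ^ (a - 1) * ∑ i, ‖𝓕 (g i) y‖ₑ ^ 2) (r • x) := by
        refine lintegral_mono fun x => ?_
        simp only [hgF]
        rw [invFourierT_eq_fourier, enorm_mul, mul_pow, mul_assoc, ← ofReal_norm, Complex.norm_real,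
          Real.norm_of_nonneg hc.le, ENNReal.ofReal_pow hc.le]
        refine mul_le_mul_right ?_ _
        rw [← Finset.sum_mul, ← mul_assoc, ← one_add_mul, mul_comm]
        refine mul_le_mul_left ?_ _
        have e : ∀ i, (2 * Real.pi * |(r • x) i|) = |x i| := fun i => by
          rw [PiLp.smul_apply, smul_eq_mul, abs_mul, ← mul_assoc, abs_neg,
            abs_of_pos (by positivity),
            mul_inv_cancel₀ (by positivity), one_mul]
        simp only [e]
        rw [ENNReal.ofReal_add zero_le_one (by positivity), ENNReal.ofReal_one]
        refine add_le_add_right ((ENNReal.ofReal_le_ofReal (norm_pow_le_sum_coord x ha)).trans ?_) _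
        rw [ENNReal.ofReal_mul (by positivity), ENNReal.ofReal_pow (by positivity),
          ENNReal.ofReal_natCast, ENNReal.ofReal_sum_of_nonneg fun i _ => by positivity]
    _ = ENNReal.ofReal (c ^ 2) * ENNReal.ofReal c⁻¹ * ∫⁻ y, (‖𝓕 m y‖ₑ ^ 2 +
          d ^ (a - 1) * ∑ i, ‖𝓕 (g i) y‖ₑ ^ 2) := by
        rw [lintegral_const_mul' _ _ ENNReal.ofReal_ne_top, 
          lintegral_comp_smul (fun y : Rd d => ‖𝓕 m y‖ₑ ^ 2 +
            d ^ (a - 1) * ∑ i, ‖𝓕 (g i) y‖ₑ ^ 2) hr, ← mul_assoc]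
        have e : |(r ^ d)⁻¹| = c⁻¹ := by
          rw [abs_inv, abs_pow, abs_neg, abs_of_pos (by positivity), inv_pow]
        rw [e]
    _ ≤ ENNReal.ofReal (c ^ 2) * ENNReal.ofReal c⁻¹ *
        (ENNReal.ofReal (B ^ 2) * volume (Metric.closedBall (0 : Rd d) R) +
          d ^ (a - 1) * ∑ _i : Fin d,
            ENNReal.ofReal (B ^ 2) * volume (Metric.closedBall (0 : Rd d) R)) := by
        rw [lintegral_add_left hFm, lintegral_const_mul' _ _ (by finiteness), lintegral_finsetSum']
        · gcongr with i
          · exact key m hm.continuous hm0 hmB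
          · exact key (g i) (hgc i) (hg0 i) (hgB i)
        · intro i _
          simp_rw [hgF]
          refine Measurable.aemeasurable (Measurable.mul ?_ hFm)
          fun_prop
    _ = _ := by
        simp only [Finset.sum_const, Finset.card_univ, Fintype.card_fin, nsmul_eq_mul, C]
        have : (d : ℝ≥0∞) ^ a = d ^ (a - 1) * d := by
          rw [← pow_succ, Nat.sub_add_cancel (Nat.one_le_iff_ne_zero.2 ha)]
        rw [this]
        ring

end WeightedKernel

section Convolution

open FourierTransform

/-- The Cauchy–Schwarz inequality. -/
theorem lintegral_mul_sq_le {X : Type*} [MeasurableSpace X] {μ : Measure X} {f g : X → ℝ≥0∞}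
    (hf : AEMeasurable f μ) (hg : AEMeasurable g μ) :
    (∫⁻ x, f x * g x ∂μ) ^ 2 ≤ (∫⁻ x, f x ^ 2 ∂μ) * ∫⁻ x, g x ^ 2 ∂μ := by
  have h := ENNReal.lintegral_mul_le_Lp_mul_Lq μ Real.HolderConjugate.two_two hf hg
  simp only [ENNReal.rpow_two, Pi.mul_apply] at h
  refine (pow_le_pow_left' h 2).trans_eq ?_
  rw [← ENNReal.mul_rpow_of_nonneg _ _ (by norm_num), ← ENNReal.rpow_two, ← ENNReal.rpow_mul]
  norm_num

/-- Averages against a rapidly decaying bump of any scale are dominated by the maximal function: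
the bump is at most a convergent sum of multiples of indicator functions of dyadic balls. -/
theorem lintegral_weight_mul_le_maximalFn (d : ℕ) {a : ℕ} (ha : d < 2 * a) :
    ∃ C : ℝ≥0, ∀ (u : Rd d → ℝ≥0∞) (x : Rd d) (k : ℤ), Measurable u →
      ∫⁻ y, ENNReal.ofReal (((2 : ℝ) ^ k) ^ d) *
        (ENNReal.ofReal (1 + ‖(2 : ℝ) ^ k • y‖ ^ (2 * a)))⁻¹ * u (x + y) ≤
        C * maximalFn volume u x := by
  set v := volume (Metric.ball (0 : Rd d) 1)
  have hv : v ≠ ⊤ := measure_ball_lt_top.ne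
  set q : ℝ≥0∞ := 2 ^ d * (2 ^ (2 * a))⁻¹
  have hq : q < 1 := by
    simp only [q]
    rw [← div_eq_mul_inv, ENNReal.div_lt_iff (by simp) (by simp), one_mul]
    exact_mod_cast (pow_lt_pow_right₀ one_lt_two ha : (2 : ℕ) ^ d < 2 ^ (2 * a))
  set C : ℝ≥0∞ := 2 ^ (2 * a) * v * (1 - q)⁻¹
  have hC : C ≠ ⊤ := by
    have : 1 - q ≠ 0 := (tsub_pos_of_lt hq).ne'
    simp only [C]
    finiteness
  refine ⟨C.toNNReal, fun u x k hu => ?_⟩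
  rw [ENNReal.coe_toNNReal hC]
  have h2 : (0 : ℝ) < 2 ^ k := by positivity
  -- the decomposition of the bump into dyadic shells
  have hΦ : ∀ y : Rd d, (ENNReal.ofReal (1 + ‖(2 : ℝ) ^ k • y‖ ^ (2 * a)))⁻¹ ≤
      ∑' l : ℕ, 2 ^ (2 * a) * ((2 ^ (2 * a))⁻¹) ^ l *
        (Metric.ball (0 : Rd d) ((2 : ℝ) ^ ((l : ℤ) - k))).indicator 1 y := by
    intro y
    have hmem : ∀ l : ℕ, ‖(2 : ℝ) ^ k • y‖ < 2 ^ l →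
        (Metric.ball (0 : Rd d) ((2 : ℝ) ^ ((l : ℤ) - k))).indicator (1 : Rd d → ℝ≥0∞) y = 1 := by
      intro l hl
      refine indicator_of_mem ?_ _
      rw [mem_ball_zero_iff, zpow_sub₀ two_ne_zero, lt_div_iff₀ h2, zpow_natCast]
      rwa [norm_smul, Real.norm_of_nonneg h2.le, mul_comm] at hl
    rcases lt_or_ge ‖(2 : ℝ) ^ k • y‖ 1 with h | h
    · refine le_trans ?_ (ENNReal.le_tsum 0)
      rw [hmem 0 (by simpa using h), pow_zero, mul_one, mul_one]
      calc _ ≤ (ENNReal.ofReal 1)⁻¹ := by gcongr; simp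
        _ = 1 := by simp
        _ ≤ _ := one_le_pow₀ one_le_two
    · obtain ⟨n, hn1, hn2⟩ := exists_nat_pow_near h one_lt_two
      refine le_trans ?_ (ENNReal.le_tsum (n + 1))
      rw [hmem (n + 1) hn2, mul_one, pow_succ', ← mul_assoc,
        ENNReal.mul_inv_cancel (by positivity) (by finiteness), one_mul, ← ENNReal.inv_pow]
      refine ENNReal.inv_le_inv.2 ?_
      rw [← pow_mul, mul_comm (2 * a) n, pow_mul]
      calc ((2 : ℝ≥0∞) ^ n) ^ (2 * a) = ENNReal.ofReal ((2 ^ n) ^ (2 * a)) := by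
            rw [ENNReal.ofReal_pow (by positivity), ENNReal.ofReal_pow (by positivity)]
            simp
        _ ≤ _ := ENNReal.ofReal_le_ofReal
            ((pow_le_pow_left₀ (by positivity) hn1 _).trans (by linarith))
  have hball : ∀ l : ℕ, ∫⁻ y, (Metric.ball (0 : Rd d) ((2 : ℝ) ^ ((l : ℤ) - k))).indicator 1 y *
      u (x + y) ≤ ENNReal.ofReal (((2 : ℝ) ^ ((l : ℤ) - k)) ^ d) * v * maximalFn volume u x := by
    intro l
    have h := lintegral_ball_le_maximalFn volume u x ((l : ℤ) - k)
    rw [Measure.addHaar_ball_of_pos _ _ (by positivity), finrank_euclideanSpace_fin] at h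
    refine le_trans (le_of_eq ?_) h
    rw [← lintegral_indicator Metric.isOpen_ball.measurableSet,
      ← lintegral_add_left_eq_self (indicator _ u) x]
    congr 1; ext y
    by_cases hy : y ∈ Metric.ball (0 : Rd d) ((2 : ℝ) ^ ((l : ℤ) - k))
    · have : x + y ∈ Metric.ball x ((2 : ℝ) ^ ((l : ℤ) - k)) := by simpa using hy
      rw [indicator_of_mem hy, indicator_of_mem this]; simp
    · have : x + y ∉ Metric.ball x ((2 : ℝ) ^ ((l : ℤ) - k)) := by simpa using hy
      rw [indicator_of_notMem hy, indicator_of_notMem this]; simp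
  calc ∫⁻ y, ENNReal.ofReal (((2 : ℝ) ^ k) ^ d) *
        (ENNReal.ofReal (1 + ‖(2 : ℝ) ^ k • y‖ ^ (2 * a)))⁻¹ * u (x + y)
      ≤ ∫⁻ y, ∑' l : ℕ, ENNReal.ofReal (((2 : ℝ) ^ k) ^ d) * (2 ^ (2 * a) *
          ((2 ^ (2 * a))⁻¹) ^ l) *
          ((Metric.ball (0 : Rd d) ((2 : ℝ) ^ ((l : ℤ) - k))).indicator 1 y * u (x + y)) := by
        refine lintegral_mono fun y => ?_
        refine (mul_le_mul_left (mul_le_mul_right (hΦ y) _) _).trans_eq ?_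
        rw [← ENNReal.tsum_mul_left, ← ENNReal.tsum_mul_right]
        congr 1; ext l; ring
    _ = ∑' l : ℕ, ENNReal.ofReal (((2 : ℝ) ^ k) ^ d) * (2 ^ (2 * a) *
          ((2 ^ (2 * a))⁻¹) ^ l) *
          ∫⁻ y, (Metric.ball (0 : Rd d) ((2 : ℝ) ^ ((l : ℤ) - k))).indicator 1 y * u (x + y) := by
        have hm : ∀ l : ℕ, Measurable fun y =>
            (Metric.ball (0 : Rd d) ((2 : ℝ) ^ ((l : ℤ) - k))).indicator 1 y * u (x + y) := fun l =>
          (measurable_one.indicator Metric.isOpen_ball.measurableSet).mul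
            (hu.comp (measurable_const_add x))
        rw [lintegral_tsum fun l => ((hm l).const_mul _).aemeasurable]
        exact tsum_congr fun l => lintegral_const_mul _ (hm l)
    _ ≤ ∑' l : ℕ, ENNReal.ofReal (((2 : ℝ) ^ k) ^ d) * (2 ^ (2 * a) *
          ((2 ^ (2 * a))⁻¹) ^ l) *
          (ENNReal.ofReal (((2 : ℝ) ^ ((l : ℤ) - k)) ^ d) * v * maximalFn volume u x) := by
        gcongr with l
        exact hball l
    _ = ∑' l : ℕ, 2 ^ (2 * a) * v * maximalFn volume u x * q ^ l := by
        refine tsum_congr fun l => ?_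
        have e : ENNReal.ofReal (((2 : ℝ) ^ k) ^ d) *
            ENNReal.ofReal (((2 : ℝ) ^ ((l : ℤ) - k)) ^ d) = (2 ^ d) ^ l := by
          rw [← ENNReal.ofReal_mul (by positivity), ← mul_pow, ← zpow_add₀ two_ne_zero,
            add_sub_cancel, zpow_natCast, ← pow_mul, ENNReal.ofReal_pow (by positivity), ← pow_mul,
            mul_comm d l]
          simp
        rw [mul_pow, ← e]
        ring
    _ = _ := by
        rw [ENNReal.tsum_mul_left, ENNReal.tsum_geometric]
        simp only [C]
        ring

theorem continuous_invFourierT {m : Rd d → ℂ} (hm : Integrable m) :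
    Continuous (invFourierT m) := by
  have : invFourierT m = fun x => ((((2 * Real.pi) ^ d)⁻¹ : ℝ) : ℂ) *
      𝓕 m (-(2 * Real.pi)⁻¹ • x) := funext fun x => invFourierT_eq_fourier m x
  rw [this]
  have h : Continuous (𝓕 m) := VectorFourier.fourierIntegral_continuous
    Real.continuous_fourierChar continuous_inner hm
  fun_prop

theorem invFourierT_comp_smul (m : Rd d → ℂ) {r : ℝ} (hr : 0 < r) (x : Rd d) :
    invFourierT (fun ξ => m (r⁻¹ • ξ)) x = ((r ^ d : ℝ) : ℂ) * invFourierT m (r • x) := by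
  simp only [invFourierT]
  have h := Measure.integral_comp_smul (volume : Measure (Rd d))
    (fun ξ : Rd d => Complex.exp (Complex.I * ((inner ℝ ξ (r • x) : ℝ) : ℂ)) * m ξ) r⁻¹
  rw [finrank_euclideanSpace_fin, inv_pow, inv_inv, abs_of_pos (by positivity)] at h
  have e : ∀ ξ : Rd d, (inner ℝ (r⁻¹ • ξ) (r • x) : ℝ) = inner ℝ ξ x := fun ξ => by
    rw [inner_smul_left, inner_smul_right]
    simp [hr.ne']
  simp only [e] at h
  rw [h, Complex.real_smul]
  ring

/-- Convolution with the kernel of a smooth symbol at frequency `2 ^ k`: a bound in `L¹` and a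
weighted bound in `L²`, both uniform in `k`. -/
theorem lintegral_invFourierT_comp_smul_le (d : ℕ) {a : ℕ} (ha : d < 2 * a) (R : ℝ) :
    ∃ C : ℝ≥0, ∀ (k : ℤ) (m : Rd d → ℂ), ContDiff ℝ a m → (∀ ξ, R < ‖ξ‖ → m ξ = 0) → ∀ B : ℝ,
      (∀ n ≤ a, ∀ ξ, ‖iteratedFDeriv ℝ n m ξ‖ ≤ B) →
      (∫⁻ x, ‖invFourierT (fun ξ => m (((2 : ℝ) ^ k)⁻¹ • ξ)) x‖ₑ ≤ C * ENNReal.ofReal B) ∧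
      ∀ G w : Rd d → ℝ≥0∞, Measurable G → Measurable w →
        ∫⁻ x, (∫⁻ y, ‖invFourierT (fun ξ => m (((2 : ℝ) ^ k)⁻¹ • ξ)) y‖ₑ * G (x - y)) ^ 2 * w x ≤
          C * ENNReal.ofReal (B ^ 2) * ∫⁻ x, G x ^ 2 * maximalFn volume w x := by
  have ha0 : a ≠ 0 := by omega
  obtain ⟨C₁, hC₁⟩ := lintegral_invFourierT_sq_mul_le d ha0 R
  obtain ⟨C₂, hC₂⟩ := lintegral_weight_mul_le_maximalFn d ha
  refine ⟨1 + C₁ * C₂, fun k m hm hsupp B hB => ?_⟩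
  have hB0 : 0 ≤ B := (norm_nonneg _).trans (hB 0 (Nat.zero_le _) 0)
  have hk : (0 : ℝ) < 2 ^ k := by positivity
  set W : Rd d → ℝ≥0∞ := fun y => ENNReal.ofReal (1 + ‖(2 : ℝ) ^ k • y‖ ^ (2 * a))
  set s : ℝ≥0∞ := ENNReal.ofReal (((2 : ℝ) ^ k) ^ d)
  have hs0 : s ≠ 0 := by simp only [s]; positivity
  have hst : s ≠ ⊤ := ENNReal.ofReal_ne_top
  have hW0 : ∀ y, W y ≠ 0 := fun y => by simp only [W]; positivity
  have hWt : ∀ y, W y ≠ ⊤ := fun y => ENNReal.ofReal_ne_top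
  have hWm : Measurable W := by fun_prop
  set K : Rd d → ℂ := invFourierT fun ξ => m (((2 : ℝ) ^ k)⁻¹ • ξ)
  have hcs : HasCompactSupport m :=
    HasCompactSupport.intro (isCompact_closedBall (0 : Rd d) R) fun ξ hξ =>
      hsupp ξ (by simpa using hξ)
  have hKm : Measurable fun y => ‖K y‖ₑ := by
    refine (continuous_invFourierT (Integrable.comp_smul ?_ (inv_ne_zero hk.ne'))).enorm.measurable
    exact hm.continuous.integrable_of_hasCompactSupport hcs
  have hQ : ∫⁻ y, ‖K y‖ₑ ^ 2 * (s⁻¹ * W y) ≤ C₁ * ENNReal.ofReal (B ^ 2) := by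
    refine le_trans (le_of_eq ?_) (hC₁ m hm hsupp B hB)
    have h := lintegral_comp_smul (d := d)
      (fun x => ‖invFourierT m x‖ₑ ^ 2 * ENNReal.ofReal (1 + ‖x‖ ^ (2 * a))) hk.ne'
    have e : ∀ y, ‖K y‖ₑ ^ 2 * (s⁻¹ * W y) = s * (‖invFourierT m ((2 : ℝ) ^ k • y)‖ₑ ^ 2 *
        ENNReal.ofReal (1 + ‖(2 : ℝ) ^ k • y‖ ^ (2 * a))) := by
      intro y
      simp only [K]
      rw [invFourierT_comp_smul m hk, enorm_mul, mul_pow, ← ofReal_norm (((_ : ℝ) : ℂ)),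
        Complex.norm_real, Real.norm_of_nonneg (by positivity)]
      change s ^ 2 * _ * (s⁻¹ * W y) = s * (_ * W y)
      calc _ = s * (s * s⁻¹) * (‖invFourierT m ((2 : ℝ) ^ k • y)‖ₑ ^ 2 * W y) := by ring
        _ = _ := by rw [ENNReal.mul_inv_cancel hs0 hst, mul_one]
    simp_rw [e]
    rw [lintegral_const_mul' _ _ hst, h, ← mul_assoc, ← ENNReal.ofReal_mul (by positivity),
      abs_of_pos (by positivity), mul_inv_cancel₀ (by positivity), ENNReal.ofReal_one, one_mul]
  -- the Cauchy–Schwarz inequality with the weight `W`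
  have hpt : ∀ G : Rd d → ℝ≥0∞, Measurable G → (∫⁻ y, ‖K y‖ₑ * G y) ^ 2 ≤
      C₁ * ENNReal.ofReal (B ^ 2) * ∫⁻ y, s * (W y)⁻¹ * G y ^ 2 := by
    intro G hG
    set V : Rd d → ℝ≥0∞ := fun y => (s⁻¹ * W y) ^ (1 / 2 : ℝ)
    have hVm : Measurable V := (hWm.const_mul _).pow_const _
    have hV0 : ∀ y, V y ≠ 0 := fun y => by
      have : s⁻¹ * W y ≠ 0 := mul_ne_zero (ENNReal.inv_ne_zero.2 hst) (hW0 y)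
      simp only [V, ne_eq, ENNReal.rpow_eq_zero_iff]
      simp [this]
    have hVt : ∀ y, V y ≠ ⊤ := fun y =>
      ENNReal.rpow_ne_top_of_nonneg (by norm_num)
        (ENNReal.mul_ne_top (ENNReal.inv_ne_top.2 hs0) (hWt y))
    have hV2 : ∀ y, V y ^ 2 = s⁻¹ * W y := fun y => by
      simp only [V]
      rw [← ENNReal.rpow_two, ← ENNReal.rpow_mul]
      norm_num
    have h := lintegral_mul_sq_le (μ := volume) (hKm.mul hVm).aemeasurable
      (hVm.inv.mul hG).aemeasurable
    simp only [Pi.mul_apply, Pi.inv_apply] at h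
    have e : ∀ y, ‖K y‖ₑ * V y * ((V y)⁻¹ * G y) = ‖K y‖ₑ * G y := fun y => by
      rw [mul_assoc, ← mul_assoc (V y), ENNReal.mul_inv_cancel (hV0 y) (hVt y), one_mul]
    have e2 : ∀ y, (‖K y‖ₑ * V y) ^ 2 = ‖K y‖ₑ ^ 2 * (s⁻¹ * W y) := fun y => by
      rw [mul_pow, hV2]
    have e3 : ∀ y, ((V y)⁻¹ * G y) ^ 2 = s * (W y)⁻¹ * G y ^ 2 := fun y => by
      rw [mul_pow, ← ENNReal.inv_pow, hV2, ENNReal.mul_inv (Or.inr (hWt y)) (Or.inr (hW0 y)),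
        inv_inv]
    simp_rw [e, e2, e3] at h
    exact h.trans (mul_le_mul_left hQ _)
  have hsW : Measurable fun y => s * (W y)⁻¹ := hWm.inv.const_mul s
  constructor
  · have h := hpt (fun _ => 1) measurable_const
    simp only [mul_one, one_pow] at h
    have h2 := hC₂ (fun _ => 1) 0 k measurable_const
    simp only [mul_one] at h2
    have h3 : (∫⁻ y, ‖K y‖ₑ) ^ 2 ≤ ((1 + C₁ * C₂ : ℝ≥0) * ENNReal.ofReal B) ^ 2 := by
      refine h.trans ((mul_le_mul_right
        (h2.trans (mul_le_mul_right (maximalFn_one_le volume 0) _)) _).trans ?_)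
      rw [mul_one, mul_pow, ENNReal.ofReal_pow hB0, mul_right_comm]
      refine mul_le_mul_left ?_ _
      norm_cast
      nlinarith [zero_le (a := C₁ * C₂), zero_le (a := (C₁ * C₂) ^ 2)]
    exact (ENNReal.pow_le_pow_left_iff two_ne_zero).1 h3
  · intro G w hG hw
    calc ∫⁻ x, (∫⁻ y, ‖K y‖ₑ * G (x - y)) ^ 2 * w x
        ≤ ∫⁻ x, (C₁ * ENNReal.ofReal (B ^ 2) * ∫⁻ y, s * (W y)⁻¹ * G (x - y) ^ 2) * w x := by
          refine lintegral_mono fun x => mul_le_mul_left (hpt (fun y => G (x - y)) ?_) _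
          exact hG.comp (measurable_const_sub x)
      _ = C₁ * ENNReal.ofReal (B ^ 2) *
          ∫⁻ x, ∫⁻ y, s * (W y)⁻¹ * G (x - y) ^ 2 * w x := by
          simp_rw [mul_assoc (C₁ * ENNReal.ofReal (B ^ 2))]
          rw [lintegral_const_mul' _ _ (by finiteness)]
          congr 1
          refine lintegral_congr fun x => ?_
          rw [lintegral_mul_const]
          exact hsW.mul ((hG.comp (measurable_const_sub x)).pow_const 2)
      _ = C₁ * ENNReal.ofReal (B ^ 2) *
          ∫⁻ x, G x ^ 2 * ∫⁻ y, s * (W y)⁻¹ * w (x + y) := by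
          congr 1
          have hm2 : Measurable fun z : Rd d × Rd d =>
              s * (W z.2)⁻¹ * G (z.1 - z.2) ^ 2 * w z.1 :=
            ((hsW.comp measurable_snd).mul
              ((hG.comp (measurable_fst.sub measurable_snd)).pow_const 2)).mul
              (hw.comp measurable_fst)
          have hm3 : Measurable fun z : Rd d × Rd d =>
              s * (W z.2)⁻¹ * G z.1 ^ 2 * w (z.1 + z.2) :=
            ((hsW.comp measurable_snd).mul ((hG.comp measurable_fst).pow_const 2)).mul
              (hw.comp (measurable_fst.add measurable_snd))
          rw [lintegral_lintegral_swap hm2.aemeasurable]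
          have : ∀ y, ∫⁻ x, s * (W y)⁻¹ * G (x - y) ^ 2 * w x =
              ∫⁻ x, s * (W y)⁻¹ * G x ^ 2 * w (x + y) := fun y => by
            rw [← lintegral_add_right_eq_self _ y]
            simp
          simp_rw [this]
          rw [← lintegral_lintegral_swap hm3.aemeasurable]
          refine lintegral_congr fun x => ?_
          rw [← lintegral_const_mul]
          · refine lintegral_congr fun y => ?_
            ring
          · exact hsW.mul (hw.comp (measurable_const_add x))
      _ ≤ C₁ * ENNReal.ofReal (B ^ 2) * ∫⁻ x, G x ^ 2 * (C₂ * maximalFn volume w x) := by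
          gcongr with x
          exact hC₂ w x k hw
      _ = C₁ * C₂ * ENNReal.ofReal (B ^ 2) * ∫⁻ x, G x ^ 2 * maximalFn volume w x := by
          simp_rw [mul_left_comm _ (C₂ : ℝ≥0∞)]
          rw [lintegral_const_mul' _ _ (by finiteness)]
          ring
      _ ≤ _ := by
          gcongr
          push_cast
          exact le_add_self

end Convolution

/-! ### Differentiation under the integral sign -/

section ParametricIntegral

open Filter Topology

theorem clm_eq_sum_smulRight {F : Type*} [NormedAddCommGroup F] [NormedSpace ℝ F]
    (L : Rd d →L[ℝ] F) :
    L = ∑ i, (EuclideanSpace.proj i : Rd d →L[ℝ] ℝ).smulRight (L (EuclideanSpace.single i 1)) := by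
  refine ContinuousLinearMap.coe_injective
    ((EuclideanSpace.basisFun (Fin d) ℝ).toBasis.ext fun i => ?_)
  simp

/-- On `ℝ^d`, a family of linear maps is measurable if its values at all vectors are. -/
theorem aestronglyMeasurable_clm {α : Type*} [MeasurableSpace α] {μ : Measure α}
    {F : Type*} [NormedAddCommGroup F] [NormedSpace ℝ F] {L : α → Rd d →L[ℝ] F}
    (h : ∀ v, AEStronglyMeasurable (fun r => L r v) μ) : AEStronglyMeasurable L μ := by
  have : L = fun r => ∑ i, (EuclideanSpace.proj i : Rd d →L[ℝ] ℝ).smulRight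
      (L r (EuclideanSpace.single i 1)) := funext fun r => clm_eq_sum_smulRight (L r)
  rw [this]
  refine Finset.aestronglyMeasurable_fun_sum _ fun i _ => ?_
  exact (ContinuousLinearMap.smulRightL ℝ (Rd d) F
    (EuclideanSpace.proj i : Rd d →L[ℝ] ℝ)).continuous.comp_aestronglyMeasurable (h _)

/-- An integral of functions with locally bounded derivatives up to the order `n` is `n` times
continuously differentiable, and inherits the bounds of the derivatives. -/
theorem contDiffOn_integral {α : Type*} [MeasurableSpace α] {μ : Measure α} [IsFiniteMeasure μ]
    {U : Set (Rd d)} (hU : IsOpen U) (n : ℕ) {F : Type} [NormedAddCommGroup F] [NormedSpace ℝ F]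
    [CompleteSpace F] {g : α → Rd d → F} {b : ℕ → Rd d → ℝ}
    (hm : ∀ ξ ∈ U, AEStronglyMeasurable (fun r => g r ξ) μ)
    (hd : ∀ᵐ r ∂μ, ContDiffOn ℝ n (g r) U)
    (hb : ∀ᵐ r ∂μ, ∀ k ≤ n, ∀ ξ ∈ U, ‖iteratedFDeriv ℝ k (g r) ξ‖ ≤ b k ξ)
    (hbc : ∀ k, ContinuousOn (b k) U) :
    ContDiffOn ℝ n (fun ξ => ∫ r, g r ξ ∂μ) U ∧
      ∀ k ≤ n, ∀ ξ ∈ U, ‖iteratedFDeriv ℝ k (fun ξ => ∫ r, g r ξ ∂μ) ξ‖ ≤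
        μ.real univ * b k ξ := by
  have hnear : ∀ k, ∀ ξ ∈ U, ∀ᶠ ζ in 𝓝 ξ, ζ ∈ U ∧ b k ζ ≤ b k ξ + 1 := fun k ξ hξ => by
    have h := ((hbc k).continuousAt (hU.mem_nhds hξ)).eventually_lt continuousAt_const
      (lt_add_one (b k ξ))
    filter_upwards [h, hU.mem_nhds hξ] with ζ h1 h2 using ⟨h2, h1.le⟩
  have hb0 : ∀ ξ ∈ U, ∀ᵐ r ∂μ, ‖g r ξ‖ ≤ b 0 ξ := fun ξ hξ => by
    filter_upwards [hb] with r hr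
    simpa using hr 0 (Nat.zero_le _) ξ hξ
  have hbd : ∀ ξ ∈ U, ‖∫ r, g r ξ ∂μ‖ ≤ μ.real univ * b 0 ξ := fun ξ hξ => by
    rw [mul_comm]
    exact norm_integral_le_of_norm_le_const (hb0 ξ hξ)
  induction n generalizing F b with
  | zero =>
    refine ⟨?_, fun k hk ξ hξ => ?_⟩
    · rw [Nat.cast_zero, contDiffOn_zero]
      intro ξ hξ
      refine ContinuousAt.continuousWithinAt ?_
      refine continuousAt_of_dominated (bound := fun _ => b 0 ξ + 1) ?_ ?_ (integrable_const _) ?_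
      · filter_upwards [hU.mem_nhds hξ] with ζ hζ using hm ζ hζ
      · filter_upwards [hnear 0 ξ hξ] with ζ hζ
        filter_upwards [hb0 ζ hζ.1] with r hr using hr.trans hζ.2
      · filter_upwards [hd] with r hr
        exact hr.continuousOn.continuousAt (hU.mem_nhds hξ)
    · obtain rfl : k = 0 := by omega
      simpa using hbd ξ hξ
  | succ n ih =>
    have hdiff : ∀ᵐ r ∂μ, ∀ ξ ∈ U, HasFDerivAt (g r) (fderiv ℝ (g r) ξ) ξ := by
      filter_upwards [hd] with r hr ξ hξ
      exact ((hr.differentiableOn (by simp)).differentiableAt (hU.mem_nhds hξ)).hasFDerivAt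
    have hm' : ∀ ξ ∈ U, AEStronglyMeasurable (fun r => fderiv ℝ (g r) ξ) μ := by
      intro ξ hξ
      -- the derivative is a limit of difference quotients with steps that remain in `U`
      refine aestronglyMeasurable_clm fun v => ?_
      have hlim : Tendsto (fun k : ℕ => ξ + ((k : ℝ) + 1)⁻¹ • v) atTop (𝓝 ξ) := by
        have h0 : Tendsto (fun k : ℕ => ((k : ℝ) + 1)⁻¹) atTop (𝓝 0) := by
          simpa using tendsto_one_div_add_atTop_nhds_zero_nat (𝕜 := ℝ)
        simpa using tendsto_const_nhds.add (h0.smul_const v)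
      obtain ⟨k₀, hk₀⟩ := eventually_atTop.1 (hlim.eventually (hU.mem_nhds hξ))
      refine aestronglyMeasurable_of_tendsto_ae (u := atTop)
        (f := fun (k : ℕ) r => (((k + k₀ : ℕ) : ℝ) + 1) •
          (g r (ξ + (((k + k₀ : ℕ) : ℝ) + 1)⁻¹ • v) - g r ξ)) (fun k => ?_) ?_
      · exact ((hm _ (hk₀ _ (Nat.le_add_left _ _))).sub (hm ξ hξ)).const_smul _
      · filter_upwards [hdiff] with r hr
        have h1 : Tendsto (fun k : ℕ => (((k + k₀ : ℕ) : ℝ) + 1)) atTop atTop :=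
          tendsto_atTop_add_const_right _ _
            (tendsto_natCast_atTop_atTop.comp (tendsto_add_atTop_nat k₀))
        have h2 := (hr ξ hξ).lim_real v
        exact h2.comp h1
    have hd' : ∀ᵐ r ∂μ, ContDiffOn ℝ n (fderiv ℝ (g r)) U := by
      filter_upwards [hd] with r hr
      exact ((contDiffOn_succ_iff_fderiv_of_isOpen hU).1 (by exact_mod_cast hr)).2.2
    have hb' : ∀ᵐ r ∂μ, ∀ k ≤ n, ∀ ξ ∈ U,
        ‖iteratedFDeriv ℝ k (fderiv ℝ (g r)) ξ‖ ≤ b (k + 1) ξ := by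
      filter_upwards [hb] with r hr k hk ξ hξ
      rw [norm_iteratedFDeriv_fderiv]
      exact hr (k + 1) (by omega) ξ hξ
    have hb0' : ∀ ξ ∈ U, ∀ᵐ r ∂μ, ‖fderiv ℝ (g r) ξ‖ ≤ b 1 ξ := fun ξ hξ => by
      filter_upwards [hb'] with r hr
      simpa using hr 0 (Nat.zero_le _) ξ hξ
    obtain ⟨ih1, ih2⟩ := ih (g := fun r => fderiv ℝ (g r)) (b := fun k => b (k + 1)) hm' hd' hb'
      (fun k => hbc (k + 1)) (fun k => hnear (k + 1)) hb0' (fun ξ hξ => by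
        rw [mul_comm]
        exact norm_integral_le_of_norm_le_const (hb0' ξ hξ))
    have hF : ∀ ξ ∈ U, HasFDerivAt (fun ξ => ∫ r, g r ξ ∂μ) (∫ r, fderiv ℝ (g r) ξ ∂μ) ξ := by
      intro ξ hξ
      refine hasFDerivAt_integral_of_dominated_of_fderiv_le (bound := fun _ => b 1 ξ + 1)
        (F' := fun ζ r => fderiv ℝ (g r) ζ) (hnear 1 ξ hξ) ?_ ?_ (hm' ξ hξ) ?_
        (integrable_const _) ?_
      · filter_upwards [hU.mem_nhds hξ] with ζ hζ using hm ζ hζ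
      · exact Integrable.of_bound (hm ξ hξ) _ (hb0 ξ hξ)
      · filter_upwards [hb'] with r hr ζ hζ
        exact (by simpa using hr 0 (Nat.zero_le _) ζ hζ.1 : ‖fderiv ℝ (g r) ζ‖ ≤ b 1 ζ).trans hζ.2
      · filter_upwards [hdiff] with r hr ζ hζ using hr ζ hζ.1
    have heq : EqOn (fderiv ℝ fun ξ => ∫ r, g r ξ ∂μ) (fun ξ => ∫ r, fderiv ℝ (g r) ξ ∂μ) U :=
      fun ξ hξ => (hF ξ hξ).fderiv
    refine ⟨?_, fun k hk ξ hξ => ?_⟩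
    · have h := (contDiffOn_succ_iff_fderiv_of_isOpen (n := (n : WithTop ℕ∞)) hU).2
        ⟨fun ξ hξ => (hF ξ hξ).differentiableAt.differentiableWithinAt, by simp, ih1.congr heq⟩
      exact_mod_cast h
    · rcases k with _ | k
      · simpa using hbd ξ hξ
      · rw [← norm_iteratedFDeriv_fderiv,
          (heq.eventuallyEq_of_mem (hU.mem_nhds hξ)).iteratedFDeriv ℝ k |>.eq_of_nhds]
        exact ih2 k (by omega) ξ hξ

/-- The norm of a multilinear map on `ℝ^d` is controlled by its values on the standard basis. -/
theorem norm_le_of_forall_single {n : ℕ} {F : Type*} [NormedAddCommGroup F] [NormedSpace ℝ F]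
    (T : ContinuousMultilinearMap ℝ (fun _ : Fin n => Rd d) F) {M : ℝ}
    (h : ∀ i : Fin n → Fin d, ‖T fun j => EuclideanSpace.single (i j) (1 : ℝ)‖ ≤ M) (hM : 0 ≤ M) :
    ‖T‖ ≤ d ^ n * M := by
  refine T.opNorm_le_bound (by positivity) fun m => ?_
  have e : m = fun j => ∑ i, m j i • EuclideanSpace.single i (1 : ℝ) := by
    funext j
    have := (EuclideanSpace.basisFun (Fin d) ℝ).sum_repr (m j)
    simpa using this.symm
  conv_lhs => rw [e, T.map_sum]
  refine (norm_sum_le _ _).trans ?_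
  have : ∀ r : Fin n → Fin d,
      ‖T fun j => m j (r j) • EuclideanSpace.single (r j) (1 : ℝ)‖ ≤ M * ∏ j, ‖m j‖ := fun r => by
    rw [T.map_smul_univ, norm_smul, Real.norm_eq_abs, Finset.abs_prod, mul_comm]
    refine mul_le_mul (h r) ?_ (by positivity) hM
    exact Finset.prod_le_prod (fun _ _ => abs_nonneg _) fun j _ => PiLp.norm_apply_le (m j) (r j)
  refine (Finset.sum_le_sum fun r _ => this r).trans_eq ?_
  simp
  ring

end ParametricIntegral

/-! ### Exponentials of homogeneous symbols -/

section Exponent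

open Filter Topology

theorem norm_iteratedFDeriv_cexp (n : ℕ) (z : ℂ) :
    ‖iteratedFDeriv ℝ n Complex.exp z‖ = Real.exp z.re := by
  rw [← ContDiffAt.restrictScalars_iteratedFDeriv (𝕜 := ℝ) (𝕜' := ℂ)
    Complex.contDiff_exp.contDiffAt, Function.comp_apply,
    ContinuousMultilinearMap.norm_restrictScalars, norm_iteratedFDeriv_eq_norm_iteratedDeriv,
    iteratedDeriv_eq_iterate, Complex.iter_deriv_exp, Complex.norm_exp]

/-- The Faà di Bruno formula for an exponential. -/
theorem norm_iteratedFDeriv_cexp_comp_le {U : Set (Rd d)} (hU : IsOpen U) {A : Rd d → ℂ} {n : ℕ}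
    (hA : ContDiffOn ℝ n A U) {ξ : Rd d} (hξ : ξ ∈ U) {D : ℝ}
    (hD : ∀ i, 1 ≤ i → i ≤ n → ‖iteratedFDeriv ℝ i A ξ‖ ≤ D ^ i) :
    ‖iteratedFDeriv ℝ n (fun ξ => Complex.exp (A ξ)) ξ‖ ≤
      n.factorial * Real.exp (A ξ).re * D ^ n := by
  have h := norm_iteratedFDerivWithin_comp_le (g := Complex.exp) (f := A) (n := n) (N := n)
    (t := univ) Complex.contDiff_exp.contDiffOn hA le_rfl uniqueDiffOn_univ
    hU.uniqueDiffOn (mapsTo_univ _ _) hξ (C := Real.exp (A ξ).re) (D := D) ?_ ?_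
  · rwa [iteratedFDerivWithin_of_isOpen n hU hξ] at h
  · intro i _
    rw [iteratedFDerivWithin_univ, norm_iteratedFDeriv_cexp]
  · intro i h1 h2
    rw [iteratedFDerivWithin_of_isOpen i hU hξ]
    exact hD i h1 h2

/-- Multiplication by a smooth function supported in an annulus removes a singularity at the origin,
and keeps the bounds of the derivatives. -/
theorem contDiff_mul_of_annulus (a : ℕ) {q : Rd d → ℂ} (hq : ContDiff ℝ ∞ q) {r R : ℝ}
    (hr : 0 < r) (hq0 : ∀ ξ, ‖ξ‖ < r ∨ R < ‖ξ‖ → q ξ = 0) :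
    ∃ C : ℝ≥0, ∀ (h : Rd d → ℂ) (δ : ℝ), ContDiffOn ℝ a h {0}ᶜ → 0 ≤ δ →
      (∀ n ≤ a, ∀ ξ, r ≤ ‖ξ‖ → ‖ξ‖ ≤ R → ‖iteratedFDeriv ℝ n h ξ‖ ≤ δ) →
      ContDiff ℝ a (fun ξ => q ξ * h ξ) ∧
        ∀ n ≤ a, ∀ ξ, ‖iteratedFDeriv ℝ n (fun ξ => q ξ * h ξ) ξ‖ ≤ C * δ := by
  have hqs : HasCompactSupport q :=
    HasCompactSupport.intro (isCompact_closedBall (0 : Rd d) R) fun ξ hξ =>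
      hq0 ξ (Or.inr (by simpa using hξ))
  have hbd : ∀ n : ℕ, ∃ B, ∀ ξ, ‖iteratedFDeriv ℝ n q ξ‖ ≤ B := fun n =>
    (hqs.iteratedFDeriv n).exists_bound_of_continuous
      (hq.continuous_iteratedFDeriv (by exact_mod_cast le_top))
  choose B hB using hbd
  have hB0 : ∀ n, 0 ≤ B n := fun n => (norm_nonneg _).trans (hB n 0)
  set S : ℝ := ∑ i ∈ Finset.range (a + 1), B i
  have hS0 : 0 ≤ S := Finset.sum_nonneg fun i _ => hB0 i
  have hBS : ∀ i ≤ a, B i ≤ S := fun i hi =>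
    Finset.single_le_sum (f := B) (fun j _ => hB0 j) (Finset.mem_range.2 (by omega))
  refine ⟨⟨2 ^ a * S, by positivity⟩, fun h δ hh hδ hbound => ?_⟩
  have hopen : IsOpen ({0}ᶜ : Set (Rd d)) := isOpen_compl_singleton
  have hzero : ∀ ξ : Rd d, ‖ξ‖ < r ∨ R < ‖ξ‖ → (fun ξ => q ξ * h ξ) =ᶠ[𝓝 ξ] fun _ => 0 := by
    intro ξ hξ
    have hO : IsOpen {ζ : Rd d | ‖ζ‖ < r ∨ R < ‖ζ‖} :=
      (isOpen_lt continuous_norm continuous_const).union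
        (isOpen_lt continuous_const continuous_norm)
    filter_upwards [hO.mem_nhds hξ] with ζ hζ
    rw [hq0 ζ hζ, zero_mul]
  constructor
  · rw [contDiff_iff_contDiffAt]
    intro ξ
    by_cases hξ : ‖ξ‖ < r
    · exact contDiffAt_const.congr_of_eventuallyEq (hzero ξ (Or.inl hξ))
    · have h0 : ξ ∈ ({0}ᶜ : Set (Rd d)) := by
        rintro rfl
        exact hξ (by simpa using hr)
      exact (hq.of_le (by exact_mod_cast le_top)).contDiffAt.mul (hh.contDiffAt (hopen.mem_nhds h0))
  · intro n hn ξ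
    change _ ≤ 2 ^ a * S * δ
    by_cases hξ : ‖ξ‖ < r ∨ R < ‖ξ‖
    · rw [((hzero ξ hξ).iteratedFDeriv ℝ n).eq_of_nhds]
      simp only [iteratedFDeriv_fun_zero, Pi.zero_apply, norm_zero]
      positivity
    · push Not at hξ
      have h0 : ξ ∈ ({0}ᶜ : Set (Rd d)) := by
        rintro rfl
        simp at hξ
        linarith
      have hl := norm_iteratedFDerivWithin_mul_le (N := a)
        (hq.of_le (by exact_mod_cast le_top)).contDiffOn hh hopen.uniqueDiffOn h0
        (by exact_mod_cast hn : (n : WithTop ℕ∞) ≤ a)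
      rw [iteratedFDerivWithin_of_isOpen n hopen h0] at hl
      refine hl.trans ?_
      calc _ ≤ ∑ i ∈ Finset.range (n + 1), (n.choose i : ℝ) * S * δ := by
            refine Finset.sum_le_sum fun i hi => ?_
            have hi' : i ≤ n := Nat.lt_succ_iff.1 (Finset.mem_range.1 hi)
            rw [iteratedFDerivWithin_of_isOpen i hopen h0,
              iteratedFDerivWithin_of_isOpen (n - i) hopen h0]
            have h1 := (hB i ξ).trans (hBS i (hi'.trans hn))
            have h2 := hbound (n - i) (by omega) ξ hξ.1 hξ.2
            gcongr
        _ = 2 ^ n * S * δ := by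
            rw [← Finset.sum_mul, ← Finset.sum_mul]
            congr 2
            exact_mod_cast Nat.sum_range_choose n
        _ ≤ _ := by
            gcongr
            exact one_le_two

/-- The number of derivatives of the symbols that are controlled. -/
abbrev symbolOrder (d : ℕ) : ℕ := d / 2 + 2

/-- The properties of the time integral of an elliptic symbol over an interval of length `T`. -/
structure IsExponent (d : ℕ) (γ ν C T : ℝ) (A : Rd d → ℂ) : Prop where
  contDiffOn : ContDiffOn ℝ (symbolOrder d) A {0}ᶜ
  norm_le : ∀ n ≤ symbolOrder d, ∀ ξ ≠ 0, ‖iteratedFDeriv ℝ n A ξ‖ ≤ C * T * ‖ξ‖ ^ (γ - n)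
  re_le : ∀ ξ ≠ 0, (A ξ).re ≤ -ν * T * ‖ξ‖ ^ γ

/-- The homogeneity of degree `γ`: a dilation of the frequency is a change of the length of the time
interval. -/
theorem IsExponent.comp_smul {γ ν C T : ℝ} {A : Rd d → ℂ} (hA : IsExponent d γ ν C T A)
    (hCT : 0 ≤ C * T) {t : ℝ} (ht : 0 < t) :
    IsExponent d γ ν C (T * t ^ γ) fun ξ => A (t • ξ) := by
  have hne : ∀ ξ : Rd d, ξ ≠ 0 → t • ξ ≠ 0 := fun ξ hξ => smul_ne_zero ht.ne' hξ
  have hopen : IsOpen ({0}ᶜ : Set (Rd d)) := isOpen_compl_singleton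
  refine ⟨?_, fun n hn ξ hξ => ?_, fun ξ hξ => ?_⟩
  · exact hA.contDiffOn.comp (contDiff_const_smul t).contDiffOn fun ξ hξ => hne ξ hξ
  · set e : Rd d ≃L[ℝ] Rd d := ContinuousLinearEquiv.smulLeft (Units.mk0 t ht.ne')
    have he : ∀ ζ, e ζ = t • ζ := fun ζ => rfl
    have hpre : e ⁻¹' {0}ᶜ = ({0}ᶜ : Set (Rd d)) := by
      ext ζ
      simp
    have h := e.iteratedFDerivWithin_comp_right A hopen.uniqueDiffOn (x := ξ) (hne ξ hξ) n
    rw [hpre, iteratedFDerivWithin_of_isOpen n hopen hξ,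
      he,
      iteratedFDerivWithin_of_isOpen n hopen (hne ξ hξ)] at h
    have h2 : iteratedFDeriv ℝ n (fun ξ => A (t • ξ)) ξ = iteratedFDeriv ℝ n (A ∘ e) ξ := rfl
    rw [h2, h]
    refine (ContinuousMultilinearMap.norm_compContinuousLinearMap_le _ _).trans ?_
    have hen : ‖(e : Rd d →L[ℝ] Rd d)‖ ≤ t := by
      refine ContinuousLinearMap.opNorm_le_bound _ ht.le fun ζ => ?_
      change ‖t • ζ‖ ≤ _
      rw [norm_smul, Real.norm_of_nonneg ht.le]
    rw [Finset.prod_const, Finset.card_univ, Fintype.card_fin]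
    calc _ ≤ C * T * ‖t • ξ‖ ^ (γ - n) * t ^ n :=
          mul_le_mul (hA.norm_le n hn _ (hne ξ hξ)) (pow_le_pow_left₀ (norm_nonneg _) hen n)
            (by positivity) (mul_nonneg hCT (by positivity))
      _ = _ := by
          rw [norm_smul, Real.norm_of_nonneg ht.le, Real.mul_rpow ht.le (norm_nonneg _),
            Real.rpow_sub ht, Real.rpow_natCast]
          field_simp
  · refine (hA.re_le _ (hne ξ hξ)).trans_eq ?_
    rw [norm_smul, Real.norm_of_nonneg ht.le, Real.mul_rpow ht.le (norm_nonneg _)]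
    ring

theorem IsExponent.contDiffOn_exp {γ ν C T : ℝ} {A : Rd d → ℂ} (hA : IsExponent d γ ν C T A) :
    ContDiffOn ℝ (symbolOrder d) (fun ξ => Complex.exp (A ξ)) {0}ᶜ :=
  Complex.contDiff_exp.comp_contDiffOn hA.contDiffOn

/-- On an annulus, the powers of `|ξ|` in the symbol bounds are comparable to constants. -/
theorem exists_norm_rpow_sub_le (γ : ℝ) (a : ℕ) {r R : ℝ} (hr : 0 < r) :
    ∃ M : ℝ, 0 ≤ M ∧ ∀ n ≤ a, ∀ x : ℝ, r ≤ x → x ≤ R → x ^ (γ - (n : ℝ)) ≤ M := by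
  rcases le_or_gt r R with hR | hR
  · have hpos : ∀ n : ℕ, 0 ≤ r ^ (γ - (n : ℝ)) + R ^ (γ - (n : ℝ)) := fun n =>
      add_nonneg (by positivity) (Real.rpow_nonneg (hr.le.trans hR) _)
    refine ⟨∑ n ∈ Finset.range (a + 1), (r ^ (γ - (n : ℝ)) + R ^ (γ - (n : ℝ))),
      Finset.sum_nonneg fun n _ => hpos n, fun n hn x h1 h2 => ?_⟩
    refine le_trans ?_ (Finset.single_le_sum (f := fun n : ℕ =>
      r ^ (γ - (n : ℝ)) + R ^ (γ - (n : ℝ))) (fun n _ => hpos n)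
      (Finset.mem_range.2 (Nat.lt_succ_of_le hn)))
    rcases le_total 0 (γ - (n : ℝ)) with h | h
    · exact (Real.rpow_le_rpow (hr.le.trans h1) h2 h).trans (le_add_of_nonneg_left (by positivity))
    · exact (Real.rpow_le_rpow_of_nonpos hr h1 h).trans
        (le_add_of_nonneg_right (Real.rpow_nonneg (hr.le.trans hR) _))
  · exact ⟨0, le_rfl, fun n _ x h1 h2 => absurd (h1.trans h2) (not_le.2 hR)⟩

/-- On an annulus, the derivatives of the exponential decay exponentially in time: a derivative
produces powers of `1 + T`, which the exponential factor absorbs. -/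
theorem IsExponent.exists_norm_iteratedFDeriv_exp_le (d : ℕ) {γ ν C r : ℝ} (R : ℝ) (hν : 0 < ν)
    (hC : 0 ≤ C) (hγ : 0 ≤ γ) (hr : 0 < r) :
    ∃ K c : ℝ, 0 ≤ K ∧ 0 < c ∧ ∀ (T : ℝ) (A : Rd d → ℂ), 0 ≤ T → IsExponent d γ ν C T A →
      ∀ n ≤ symbolOrder d, ∀ ξ, r ≤ ‖ξ‖ → ‖ξ‖ ≤ R →
        ‖iteratedFDeriv ℝ n (fun ξ => Complex.exp (A ξ)) ξ‖ ≤ K * Real.exp (-(c * T)) := by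
  obtain ⟨M, hM0, hM⟩ := exists_norm_rpow_sub_le γ (symbolOrder d) (R := R) hr
  set a := symbolOrder d
  have ha : (0 : ℝ) < a := by simp only [a, symbolOrder]; positivity
  set c := ν * r ^ γ / 2
  have hc : 0 < c := by positivity
  set κ := C * M
  have hκ : 0 ≤ κ := by positivity
  refine ⟨a.factorial * (1 + κ * a / c) ^ a, c, by positivity, hc,
    fun T A hT hA n hn ξ h1 h2 => ?_⟩
  have hξ : ξ ≠ 0 := fun h => by
    rw [h, norm_zero] at h1
    linarith
  have hDn : ∀ i ≤ a, ‖iteratedFDeriv ℝ i A ξ‖ ≤ κ * T := fun i hi =>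
    (hA.norm_le i hi ξ hξ).trans (by
      have := hM i hi ‖ξ‖ h1 h2
      calc _ ≤ C * T * M := by gcongr
        _ = _ := by simp only [κ]; ring)
  have h := norm_iteratedFDeriv_cexp_comp_le (n := n) isOpen_compl_singleton
    (hA.contDiffOn.of_le (by exact_mod_cast hn)) hξ (D := 1 + κ * T) fun i hi1 hi2 => by
      refine (hDn i (hi2.trans hn)).trans ?_
      calc κ * T ≤ (1 + κ * T) ^ 1 := by linarith
        _ ≤ _ := pow_le_pow_right₀ (by nlinarith [mul_nonneg hκ hT]) hi1
  refine h.trans ?_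
  have hκT : 0 ≤ κ * T := by positivity
  -- half of the decay absorbs the powers of `T`
  have hexp : (A ξ).re ≤ -(c * T) - c * T := by
    refine (hA.re_le ξ hξ).trans ?_
    have : r ^ γ ≤ ‖ξ‖ ^ γ := Real.rpow_le_rpow hr.le h1 hγ
    have h3 : ν * T * r ^ γ ≤ ν * T * ‖ξ‖ ^ γ := by gcongr
    simp only [c]
    linarith
  have hpow : (1 + κ * T) ^ n ≤ (1 + κ * a / c) ^ a * Real.exp (c * T) := by
    calc (1 + κ * T) ^ n ≤ (1 + κ * T) ^ a := pow_le_pow_right₀ (by linarith) hn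
      _ ≤ ((1 + κ * a / c) * Real.exp (c * T / a)) ^ a := by
          refine pow_le_pow_left₀ (by linarith) ?_ _
          have h4 := Real.add_one_le_exp (c * T / a)
          calc 1 + κ * T ≤ (1 + κ * a / c) * (c * T / a + 1) := by
                have : (1 + κ * a / c) * (c * T / a + 1) = 1 + κ * T + (c * T / a + κ * a / c) := by
                  field_simp
                  ring
                rw [this]
                have : 0 ≤ c * T / a + κ * a / c := by positivity
                linarith
            _ ≤ _ := by gcongr
      _ = _ := by
          rw [mul_pow, ← Real.exp_nat_mul]
          congr 2
          field_simp
  calc (n.factorial : ℝ) * Real.exp (A ξ).re * (1 + κ * T) ^ n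
      ≤ a.factorial * Real.exp (-(c * T) - c * T) * ((1 + κ * a / c) ^ a * Real.exp (c * T)) := by
        gcongr
    _ = _ := by
        rw [Real.exp_sub]
        field_simp

/-- At low frequencies the exponential is close to `1`, together with its derivatives. -/
theorem IsExponent.exists_norm_iteratedFDeriv_exp_sub_one_le (d : ℕ) {γ ν C r : ℝ} (R T : ℝ)
    (hν : 0 ≤ ν) (hC : 0 ≤ C) (hr : 0 < r) (hT : 0 ≤ T) :
    ∃ K : ℝ, 0 ≤ K ∧ ∀ (v : ℝ) (A : Rd d → ℂ), 0 ≤ v → v ≤ 1 →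
      IsExponent d γ ν C (T * v ^ symbolOrder d) A →
      ∀ n ≤ symbolOrder d, ∀ ξ, r ≤ ‖ξ‖ → ‖ξ‖ ≤ R →
        ‖iteratedFDeriv ℝ n (fun ξ => Complex.exp (A ξ) - 1) ξ‖ ≤ K * v := by
  obtain ⟨M, hM0, hM⟩ := exists_norm_rpow_sub_le γ (symbolOrder d) (R := R) hr
  set a := symbolOrder d
  have ha : a ≠ 0 := by simp [a, symbolOrder]
  set κ := C * M
  have hκ : 0 ≤ κ := by positivity
  have hκT : 0 ≤ κ * T := by positivity
  refine ⟨2 * a.factorial * (1 + κ * T) ^ a, by positivity, fun v A hv0 hv1 hA n hn ξ h1 h2 => ?_⟩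
  have hξ : ξ ≠ 0 := fun h => by
    rw [h, norm_zero] at h1
    linarith
  have hDn : ∀ i ≤ a, ‖iteratedFDeriv ℝ i A ξ‖ ≤ κ * T * v ^ a := fun i hi =>
    (hA.norm_le i hi ξ hξ).trans (by
      have := hM i hi ‖ξ‖ h1 h2
      calc _ ≤ C * (T * v ^ a) * M := by gcongr
        _ = _ := by simp only [κ]; ring)
  have hfac : (1 : ℝ) ≤ a.factorial := by
    exact_mod_cast Nat.one_le_iff_ne_zero.2 a.factorial_ne_zero
  have hpow1 : 1 + κ * T ≤ (1 + κ * T) ^ a := le_self_pow₀ (by linarith) ha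
  have hva : v ^ a ≤ v := pow_le_of_le_one hv0 hv1 ha
  have hre : (A ξ).re ≤ 0 := (hA.re_le ξ hξ).trans (by
    have : 0 ≤ ν * (T * v ^ a) * ‖ξ‖ ^ γ := by positivity
    linarith)
  have hexp : Real.exp (A ξ).re ≤ 1 := Real.exp_le_one_iff.2 hre
  rcases Nat.eq_zero_or_pos n with rfl | hn0
  · rw [norm_iteratedFDeriv_zero]
    have hA0 : ‖A ξ‖ ≤ κ * T * v ^ a := by simpa using hDn 0 (Nat.zero_le _)
    have : ‖Complex.exp (A ξ) - 1‖ ≤ 2 * ‖A ξ‖ := by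
      rcases le_or_gt ‖A ξ‖ 1 with h | h
      · exact Complex.norm_exp_sub_one_le h
      · refine (norm_sub_le _ _).trans ?_
        rw [Complex.norm_exp, norm_one]
        linarith
    calc _ ≤ 2 * (κ * T * v) := this.trans (by gcongr; exact hA0.trans (by gcongr))
      _ ≤ 2 * ((1 + κ * T) ^ a * v) := by gcongr; linarith
      _ ≤ 2 * (a.factorial * ((1 + κ * T) ^ a * v)) :=
        mul_le_mul_of_nonneg_left (le_mul_of_one_le_left (by positivity) hfac) two_pos.le
      _ = _ := by ring
  · have hat : ContDiffAt ℝ n (fun ξ => Complex.exp (A ξ)) ξ :=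
      (hA.contDiffOn_exp.contDiffAt (isOpen_compl_singleton.mem_nhds hξ)).of_le
        (by exact_mod_cast hn)
    have e : iteratedFDeriv ℝ n (fun ξ => Complex.exp (A ξ) - 1) ξ =
        iteratedFDeriv ℝ n (fun ξ => Complex.exp (A ξ)) ξ := by
      have := iteratedFDeriv_sub_apply hat (contDiffAt_const (c := (1 : ℂ)))
      rw [iteratedFDeriv_const_of_ne hn0.ne'] at this
      rwa [Pi.zero_apply, sub_zero] at this
    rw [e]
    have h := norm_iteratedFDeriv_cexp_comp_le (n := n) isOpen_compl_singleton
      (hA.contDiffOn.of_le (by exact_mod_cast hn)) hξ (D := (1 + κ * T) * v) fun i hi1 hi2 => by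
        refine (hDn i (hi2.trans hn)).trans ?_
        rw [mul_pow]
        have h3 : 1 + κ * T ≤ (1 + κ * T) ^ i := le_self_pow₀ (by linarith) (by omega)
        have h4 : v ^ a ≤ v ^ i := pow_le_pow_of_le_one hv0 hv1 (hi2.trans hn)
        exact mul_le_mul (by linarith) h4 (by positivity) (by positivity)
    refine h.trans ?_
    rw [mul_pow]
    have hvn : v ^ n ≤ v := pow_le_of_le_one hv0 hv1 hn0.ne'
    calc (n.factorial : ℝ) * Real.exp (A ξ).re * ((1 + κ * T) ^ n * v ^ n)
        ≤ a.factorial * 1 * ((1 + κ * T) ^ a * v) := by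
          gcongr
          linarith
      _ ≤ 2 * (a.factorial * 1 * ((1 + κ * T) ^ a * v)) :=
          le_mul_of_one_le_left (by positivity) one_le_two
      _ = _ := by ring

/-- The time integral of an elliptic symbol. -/
theorem IsEllipticSymbol.isExponent {γ ν : ℝ} (hν : 0 < ν) {ψ : ℝ → Rd d → ℂ}
    (hψ : IsEllipticSymbol d γ ν ψ) {s t : ℝ} (hs : 0 ≤ s) (hst : s ≤ t) :
    IsExponent d γ ν ((1 + d) ^ symbolOrder d * ν⁻¹) (t - s) fun ξ => ∫ r in s..t, ψ r ξ := by
  set μ := (volume : Measure ℝ).restrict (Ioc s t)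
  have hμ : μ.real univ = t - s := by
    simp [μ, measureReal_restrict_apply, hst]
  have hle : μ ≤ volume.restrict (Ioi 0) :=
    Measure.restrict_mono_set _ fun x hx => hs.trans_lt hx.1
  have hac := Measure.absolutelyContinuous_of_le hle
  have hm : ∀ ξ ∈ ({0}ᶜ : Set (Rd d)), AEStronglyMeasurable (fun r => ψ r ξ) μ := fun ξ hξ =>
    ((hψ.aemeasurable ξ hξ).mono_measure hle).aestronglyMeasurable
  set b : ℕ → Rd d → ℝ := fun n ξ => (1 + d) ^ symbolOrder d * ν⁻¹ * ‖ξ‖ ^ (γ - n)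
  have hb : ∀ᵐ r ∂μ, ∀ k ≤ symbolOrder d, ∀ ξ ∈ ({0}ᶜ : Set (Rd d)),
      ‖iteratedFDeriv ℝ k (ψ r) ξ‖ ≤ b k ξ := by
    filter_upwards [hac hψ.deriv_le] with r hr k hk ξ hξ
    refine (norm_le_of_forall_single _ (hr ξ hξ k hk) (by positivity)).trans ?_
    have : (d : ℝ) ^ k ≤ (1 + d) ^ symbolOrder d :=
      (pow_le_pow_left₀ (by positivity) (by linarith) k).trans
        (pow_le_pow_right₀ (by linarith [(Nat.cast_nonneg d : (0 : ℝ) ≤ d)]) hk)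
    rw [← mul_assoc]
    simp only [b]
    gcongr
  have hbc : ∀ k, ContinuousOn (b k) ({0}ᶜ : Set (Rd d)) := fun k =>
    continuousOn_const.mul (continuous_norm.continuousOn.rpow_const fun ξ hξ =>
      Or.inl (norm_ne_zero_iff.2 hξ))
  have h := contDiffOn_integral isOpen_compl_singleton (symbolOrder d) hm
    (hac hψ.contDiffOn) hb hbc
  have e : (fun ξ => ∫ r in s..t, ψ r ξ) = fun ξ => ∫ r, ψ r ξ ∂μ :=
    funext fun ξ => intervalIntegral.integral_of_le hst
  rw [e]
  refine ⟨h.1, fun n hn ξ hξ => (h.2 n hn ξ hξ).trans_eq ?_, fun ξ hξ => ?_⟩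
  · rw [hμ]
    simp only [b]
    ring
  · have hint : Integrable (fun r => ψ r ξ) μ := by
      refine Integrable.of_bound (hm ξ hξ) (b 0 ξ) ?_
      filter_upwards [hb] with r hr
      simpa using hr 0 (Nat.zero_le _) ξ hξ
    have h1 : (∫ r, ψ r ξ ∂μ).re = ∫ r, (ψ r ξ).re ∂μ :=
      (Complex.reCLM.integral_comp_comm hint).symm
    rw [h1]
    calc ∫ r, (ψ r ξ).re ∂μ ≤ ∫ _r, -ν * ‖ξ‖ ^ γ ∂μ := by
          refine integral_mono_ae hint.re (integrable_const _) ?_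
          filter_upwards [hac hψ.re_le] with r hr using hr ξ hξ
      _ = _ := by
          rw [integral_const, hμ, smul_eq_mul]
          ring

end Exponent

/-! ### The kernels belong to `L¹` -/

section KernelIntegrable

open Filter Topology FourierTransform

theorem integrable_norm_rpow_mul_exp (hd : d ≠ 0) {σ γ c : ℝ} (hσ : 0 ≤ σ) (hγ : 0 < γ)
    (hc : 0 < c) : Integrable fun ξ : Rd d => ‖ξ‖ ^ σ * Real.exp (-c * ‖ξ‖ ^ γ) := by
  have : Nonempty (Fin d) := ⟨⟨0, Nat.pos_of_ne_zero hd⟩⟩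
  refine (integrable_fun_norm_addHaar (E := Rd d) (μ := volume)
    (f := fun x : ℝ => x ^ σ * Real.exp (-c * x ^ γ))).2 ?_
  rw [finrank_euclideanSpace_fin]
  refine (integrableOn_rpow_mul_exp_neg_mul_rpow (s := (d - 1 : ℕ) + σ) (p := γ) (b := c)
    (by have := Nat.cast_nonneg (α := ℝ) (d - 1); linarith) hγ hc).congr_fun
    (fun x hx => ?_) measurableSet_Ioi
  change x ^ (((d - 1 : ℕ) : ℝ) + σ) * Real.exp (-c * x ^ γ) = _
  rw [smul_eq_mul, Real.rpow_add hx, Real.rpow_natCast, mul_assoc]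

theorem ae_ne_zero (hd : d ≠ 0) : ∀ᵐ ξ : Rd d, ξ ≠ 0 := by
  have : Nonempty (Fin d) := ⟨⟨0, Nat.pos_of_ne_zero hd⟩⟩
  exact Measure.ae_ne volume 0

theorem invFourierT_congr_ae {m m' : Rd d → ℂ} (h : m =ᵐ[volume] m') :
    invFourierT m = invFourierT m' := by
  funext x
  rw [invFourierT, invFourierT]
  congr 1
  refine integral_congr_ae ?_
  filter_upwards [h] with ξ hξ
  rw [hξ]

theorem integrable_exp_mul {m : Rd d → ℂ} (hm : Integrable m) (x : Rd d) :
    Integrable fun ξ : Rd d => Complex.exp (Complex.I * ((inner ℝ ξ x : ℝ) : ℂ)) * m ξ := by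
  refine hm.bdd_mul (c := 1) (by fun_prop) (ae_of_all _ fun ξ => ?_)
  rw [mul_comm, Complex.norm_exp_ofReal_mul_I]

theorem invFourierT_add {m m' : Rd d → ℂ} (hm : Integrable m) (hm' : Integrable m') (x : Rd d) :
    invFourierT (fun ξ => m ξ + m' ξ) x = invFourierT m x + invFourierT m' x := by
  simp only [invFourierT, mul_add]
  rw [integral_add (integrable_exp_mul hm x) (integrable_exp_mul hm' x), mul_add]

theorem invFourierT_sum {ι : Type*} (s : Finset ι) {m : ι → Rd d → ℂ}
    (hm : ∀ i ∈ s, Integrable (m i)) (x : Rd d) :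
    invFourierT (fun ξ => ∑ i ∈ s, m i ξ) x = ∑ i ∈ s, invFourierT (m i) x := by
  simp only [invFourierT, Finset.mul_sum]
  rw [integral_finsetSum _ fun i hi => integrable_exp_mul (hm i hi) x, Finset.mul_sum]

theorem norm_invFourierT_le (m : Rd d → ℂ) (x : Rd d) :
    ‖invFourierT m x‖ ≤ ((2 * Real.pi) ^ d)⁻¹ * ∫ ξ, ‖m ξ‖ := by
  rw [invFourierT, norm_mul, Complex.norm_real, Real.norm_of_nonneg (by positivity)]
  gcongr
  refine (norm_integral_le_integral_norm _).trans_eq ?_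
  congr 1; ext ξ
  rw [norm_mul, mul_comm Complex.I, Complex.norm_exp_ofReal_mul_I, one_mul]

theorem tendsto_invFourierT {m : ℕ → Rd d → ℂ} {m' : Rd d → ℂ} {b : Rd d → ℝ}
    (hm : ∀ k, AEStronglyMeasurable (m k)) (hb : Integrable b)
    (hmb : ∀ k, ∀ᵐ ξ, ‖m k ξ‖ ≤ b ξ) (hlim : ∀ᵐ ξ, Tendsto (fun k => m k ξ) atTop (𝓝 (m' ξ)))
    (x : Rd d) : Tendsto (fun k => invFourierT (m k) x) atTop (𝓝 (invFourierT m' x)) := by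
  refine Tendsto.const_mul _ (tendsto_integral_of_dominated_convergence b (fun k => ?_) hb
    (fun k => ?_) ?_)
  · exact AEStronglyMeasurable.mul (by fun_prop) (hm k)
  · filter_upwards [hmb k] with ξ hξ
    rwa [norm_mul, mul_comm Complex.I, Complex.norm_exp_ofReal_mul_I, one_mul]
  · filter_upwards [hlim] with ξ hξ using hξ.const_mul _

variable {γ ν C T : ℝ} {A : Rd d → ℂ}

theorem IsExponent.norm_exp_le (hA : IsExponent d γ ν C T A) {ξ : Rd d} (hξ : ξ ≠ 0) :
    ‖Complex.exp (A ξ)‖ ≤ Real.exp (-(ν * T) * ‖ξ‖ ^ γ) := by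
  rw [Complex.norm_exp, Real.exp_le_exp]
  exact (hA.re_le ξ hξ).trans_eq (by ring)

theorem IsExponent.aestronglyMeasurable_exp (hd : d ≠ 0) (hA : IsExponent d γ ν C T A) :
    AEStronglyMeasurable fun ξ => Complex.exp (A ξ) := by
  have : Nonempty (Fin d) := ⟨⟨0, Nat.pos_of_ne_zero hd⟩⟩
  have h := hA.contDiffOn_exp.continuousOn.aestronglyMeasurable (μ := volume)
    isOpen_compl_singleton.measurableSet
  rwa [restrict_compl_singleton] at h

theorem IsExponent.integrable (hd : d ≠ 0) (hγ : 0 < γ) (hνT : 0 < ν * T)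
    (hA : IsExponent d γ ν C T A) {σ : ℝ} (hσ : 0 ≤ σ) :
    Integrable fun ξ => ((‖ξ‖ ^ σ : ℝ) : ℂ) * Complex.exp (A ξ) := by
  refine (integrable_norm_rpow_mul_exp hd hσ hγ hνT).mono' ?_ ?_
  · refine AEStronglyMeasurable.mul ?_ (hA.aestronglyMeasurable_exp hd)
    exact (Complex.measurable_ofReal.comp
      (measurable_norm.pow_const σ)).aestronglyMeasurable
  · filter_upwards [ae_ne_zero hd] with ξ hξ
    rw [norm_mul, Complex.norm_real, Real.norm_of_nonneg (by positivity)]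
    exact mul_le_mul_of_nonneg_left (hA.norm_exp_le hξ) (by positivity)

theorem IsExponent.integrable_exp (hd : d ≠ 0) (hγ : 0 < γ) (hνT : 0 < ν * T)
    (hA : IsExponent d γ ν C T A) : Integrable fun ξ => Complex.exp (A ξ) := by
  simpa using hA.integrable hd hγ hνT le_rfl

/-- The conditions do not see the value at the origin. -/
theorem IsExponent.congr (hA : IsExponent d γ ν C T A) {B : Rd d → ℂ} (h : ∀ ξ ≠ 0, B ξ = A ξ) :
    IsExponent d γ ν C T B := by
  refine ⟨hA.contDiffOn.congr fun ξ hξ => h ξ hξ, fun n hn ξ hξ => ?_, fun ξ hξ => ?_⟩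
  · have : B =ᶠ[𝓝 ξ] A := by
      filter_upwards [isOpen_compl_singleton.mem_nhds hξ] with ζ hζ using h ζ hζ
    rw [(this.iteratedFDeriv ℝ n).eq_of_nhds]
    exact hA.norm_le n hn ξ hξ
  · rw [h ξ hξ]
    exact hA.re_le ξ hξ

theorem IsExponent.continuous (hγ : 0 < γ) (hA : IsExponent d γ ν C T A) (h0 : A 0 = 0) :
    Continuous A := by
  rw [continuous_iff_continuousAt]
  intro ξ
  by_cases hξ : ξ = 0
  · subst hξ
    rw [ContinuousAt, h0]
    have hb : ∀ ζ : Rd d, ‖A ζ‖ ≤ C * T * ‖ζ‖ ^ γ := fun ζ => by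
      by_cases hζ : ζ = 0
      · simp [hζ, h0, Real.zero_rpow hγ.ne']
      · simpa using hA.norm_le 0 (Nat.zero_le _) ζ hζ
    refine squeeze_zero_norm hb ?_
    have : Tendsto (fun ζ : Rd d => C * T * ‖ζ‖ ^ γ) (𝓝 0) (𝓝 (C * T * ‖(0 : Rd d)‖ ^ γ)) := by
      refine Continuous.tendsto ?_ 0
      exact continuous_const.mul (continuous_norm.rpow_const fun _ => Or.inr hγ.le)
    simpa [Real.zero_rpow hγ.ne'] using this
  · exact hA.contDiffOn.continuousOn.continuousAt (isOpen_compl_singleton.mem_nhds hξ)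

/-- The cutoff to the frequencies below the scale `2 ^ k`. -/
noncomputable def FreqCutoff.low (Θ : FreqCutoff d) (k : ℤ) (ξ : Rd d) : ℂ :=
  (Θ.θ (((2 : ℝ) ^ k)⁻¹ • ξ) : ℂ)

/-- The bump function at the frequencies of the scale `1`. -/
noncomputable def FreqCutoff.bump (Θ : FreqCutoff d) (ξ : Rd d) : ℂ :=
  ((Θ.θ ξ : ℝ) : ℂ) - ((Θ.θ ((2 : ℝ) • ξ) : ℝ) : ℂ)

theorem FreqCutoff.bump_eq (Θ : FreqCutoff d) (k : ℤ) (ξ : Rd d) :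
    Θ.bump (((2 : ℝ) ^ k)⁻¹ • ξ) = Θ.low k ξ - Θ.low (k - 1) ξ := by
  rw [bump, low, low, smul_smul, zpow_sub_one₀ two_ne_zero, mul_inv_rev, inv_inv]

theorem FreqCutoff.contDiff_bump (Θ : FreqCutoff d) : ContDiff ℝ ∞ Θ.bump := by
  have h : ContDiff ℝ ∞ fun ξ => ((Θ.θ ξ : ℝ) : ℂ) := Complex.ofRealCLM.contDiff.comp Θ.contDiff_θ
  exact h.sub (h.comp (contDiff_const_smul _))

theorem FreqCutoff.bump_eq_zero (Θ : FreqCutoff d) (ξ : Rd d) (h : ‖ξ‖ < Θ.r ∨ Θ.R < ‖ξ‖) :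
    Θ.bump ξ = 0 := by
  rw [bump, ← Θ.η_mul, Θ.η_eq_zero ξ h, zero_mul]

theorem FreqCutoff.norm_low_le (Θ : FreqCutoff d) (k : ℤ) (ξ : Rd d) : ‖Θ.low k ξ‖ ≤ 1 := by
  rw [low, Complex.norm_real, Real.norm_of_nonneg (Θ.θ_nonneg _)]
  exact Θ.θ_le_one _

theorem FreqCutoff.norm_low_sub_low_le (Θ : FreqCutoff d) (k l : ℤ) (ξ : Rd d) :
    ‖Θ.low k ξ - Θ.low l ξ‖ ≤ 1 := by
  rw [low, low, ← Complex.ofReal_sub, Complex.norm_real, Real.norm_eq_abs, abs_le]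
  constructor <;> linarith [Θ.θ_nonneg (((2 : ℝ) ^ k)⁻¹ • ξ), Θ.θ_nonneg (((2 : ℝ) ^ l)⁻¹ • ξ),
    Θ.θ_le_one (((2 : ℝ) ^ k)⁻¹ • ξ), Θ.θ_le_one (((2 : ℝ) ^ l)⁻¹ • ξ)]

theorem FreqCutoff.continuous_low (Θ : FreqCutoff d) (k : ℤ) : Continuous (Θ.low k) :=
  Complex.continuous_ofReal.comp (Θ.contDiff_θ.continuous.comp (continuous_const_smul _))

theorem FreqCutoff.hasCompactSupport_low (Θ : FreqCutoff d) (k : ℤ) :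
    HasCompactSupport (Θ.low k) := by
  refine HasCompactSupport.intro (isCompact_closedBall (0 : Rd d) (2 ^ k * Θ.R)) fun ξ hξ => ?_
  have hk : (0 : ℝ) < 2 ^ k := by positivity
  rw [low, Θ.θ_eq_zero, Complex.ofReal_zero]
  rw [norm_smul, norm_inv, Real.norm_of_nonneg hk.le, le_inv_mul_iff₀ hk]
  simpa using (not_le.1 fun h => hξ (mem_closedBall_zero_iff.2 h)).le

theorem FreqCutoff.tendsto_low (Θ : FreqCutoff d) (ξ : Rd d) :
    Tendsto (fun J : ℕ => Θ.low J ξ) atTop (𝓝 1) := by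
  have h : Tendsto (fun J : ℕ => ((2 : ℝ) ^ J)⁻¹ * ‖ξ‖) atTop (𝓝 0) := by
    have := (tendsto_inv_atTop_zero.comp
      (tendsto_pow_atTop_atTop_of_one_lt (one_lt_two (α := ℝ)))).mul_const ‖ξ‖
    simpa using this
  refine tendsto_const_nhds.congr' ?_
  filter_upwards [h.eventually_le_const Θ.r_pos] with J hJ
  rw [low, Θ.θ_eq_one, Complex.ofReal_one]
  rwa [norm_smul, norm_inv, zpow_natCast, Real.norm_of_nonneg (by positivity)]

theorem FreqCutoff.tendsto_low_neg (Θ : FreqCutoff d) {ξ : Rd d} (hξ : ξ ≠ 0) :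
    Tendsto (fun J : ℕ => Θ.low (-J) ξ) atTop (𝓝 0) := by
  have h : Tendsto (fun J : ℕ => (2 : ℝ) ^ J * ‖ξ‖) atTop atTop :=
    (tendsto_pow_atTop_atTop_of_one_lt one_lt_two).atTop_mul_const (norm_pos_iff.2 hξ)
  refine tendsto_const_nhds.congr' ?_
  filter_upwards [h.eventually_ge_atTop Θ.R] with J hJ
  rw [low, Θ.θ_eq_zero, Complex.ofReal_zero]
  rwa [norm_smul, zpow_neg, inv_inv, zpow_natCast, Real.norm_of_nonneg (by positivity)]

/-- The kernel with the symbol `exp A` is integrable. The symbol is decomposed into dyadic pieces,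
from which the constant `1` is removed at the low frequencies. -/
theorem IsExponent.lintegral_invFourierT_exp_lt_top (hd : d ≠ 0) (hγ : 0 < γ) (hν : 0 < ν)
    (hC : 0 ≤ C) (hT : 0 < T) (hA : IsExponent d γ ν C T A) :
    ∫⁻ x, ‖invFourierT (fun ξ => Complex.exp (A ξ)) x‖ₑ < ⊤ := by
  obtain ⟨Θ⟩ := (inferInstance : Nonempty (FreqCutoff d))
  set a := symbolOrder d
  have ha : d < 2 * a := by simp only [a, symbolOrder]; omega
  have ha0 : (0 : ℝ) < a := by simp only [a, symbolOrder]; positivity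
  obtain ⟨C₁, hC₁⟩ := lintegral_invFourierT_comp_smul_le d ha Θ.R
  obtain ⟨C₂, hC₂⟩ := contDiff_mul_of_annulus a Θ.contDiff_bump Θ.r_pos Θ.bump_eq_zero
  obtain ⟨K₁, c, hK₁, hc, hhigh⟩ :=
    IsExponent.exists_norm_iteratedFDeriv_exp_le d (γ := γ) (ν := ν) (C := C) Θ.R hν hC hγ.le
      Θ.r_pos
  obtain ⟨K₂, hK₂, hlow⟩ :=
    IsExponent.exists_norm_iteratedFDeriv_exp_sub_one_le d (γ := γ) (ν := ν) (C := C) Θ.R T hν.le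
      hC Θ.r_pos hT.le
  have hCT : 0 ≤ C * T := by positivity
  set E : Rd d → ℂ := fun ξ => Complex.exp (A ξ)
  have hEi : Integrable E := hA.integrable_exp hd hγ (by positivity)
  -- the pieces; at the low frequencies `|E - 1|` is of the size `2 ^ (-i γ) = (b ^ i) ^ a`
  set Qm : ℕ → Rd d → ℂ := fun i ξ => (E ξ - 1) * (Θ.low (-i) ξ - Θ.low (-i - 1) ξ)
  set Qp : ℕ → Rd d → ℂ := fun i ξ => E ξ * (Θ.low (i + 1) ξ - Θ.low i ξ)
  set b : ℝ := (2 : ℝ) ^ (-(γ / a))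
  have hb0 : 0 < b := by positivity
  have hb1 : b < 1 := Real.rpow_lt_one_of_one_lt_of_neg one_lt_two (by
    have : 0 < γ / a := by positivity
    linarith)
  have hQm : ∀ i, ∫⁻ x, ‖invFourierT (Qm i) x‖ₑ ≤ C₁ * ENNReal.ofReal (C₂ * (K₂ * b ^ i)) := by
    intro i
    have h2 : (0 : ℝ) < 2 ^ (-(i : ℤ)) := by positivity
    have hexp := hA.comp_smul hCT h2
    have hv : ((2 : ℝ) ^ (-(i : ℤ))) ^ γ = (b ^ i) ^ a := by
      rw [← pow_mul, ← Real.rpow_natCast b, ← Real.rpow_mul two_pos.le, ← Real.rpow_intCast,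
        ← Real.rpow_mul two_pos.le]
      congr 1
      push_cast
      field_simp
    rw [hv] at hexp
    obtain ⟨h3, h4⟩ := hC₂ (fun ξ => Complex.exp (A ((2 : ℝ) ^ (-(i : ℤ)) • ξ)) - 1) (K₂ * b ^ i)
      (hexp.contDiffOn_exp.sub contDiffOn_const) (by positivity)
      (hlow (b ^ i) _ (by positivity) (pow_le_one₀ hb0.le hb1.le) hexp)
    have h5 := (hC₁ (-(i : ℤ)) _ h3 (fun ξ hξ => by
      rw [Θ.bump_eq_zero ξ (Or.inr hξ), zero_mul]) _ h4).1
    refine le_trans (le_of_eq ?_) h5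
    congr 1; ext x; congr 2; ext ξ
    simp only [Qm]
    rw [Θ.bump_eq, smul_inv_smul₀ h2.ne', mul_comm]
  have hQp : ∀ i : ℕ, ∫⁻ x, ‖invFourierT (Qp i) x‖ₑ ≤
      C₁ * ENNReal.ofReal (C₂ * (K₁ * Real.exp (-(c * (T * ((2 : ℝ) ^ γ) ^ (i + 1)))))) := by
    intro i
    have h2 : (0 : ℝ) < 2 ^ ((i : ℤ) + 1) := by positivity
    have hexp := hA.comp_smul hCT h2
    have hv : ((2 : ℝ) ^ ((i : ℤ) + 1)) ^ γ = ((2 : ℝ) ^ γ) ^ (i + 1) := by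
      rw [← Real.rpow_natCast, ← Real.rpow_mul two_pos.le, ← Real.rpow_intCast,
        ← Real.rpow_mul two_pos.le]
      congr 1
      push_cast
      ring
    rw [hv] at hexp
    obtain ⟨h3, h4⟩ := hC₂ (fun ξ => Complex.exp (A ((2 : ℝ) ^ ((i : ℤ) + 1) • ξ)))
      (K₁ * Real.exp (-(c * (T * ((2 : ℝ) ^ γ) ^ (i + 1)))))
      hexp.contDiffOn_exp (by positivity) (hhigh _ _ (by positivity) hexp)
    have h5 := (hC₁ ((i : ℤ) + 1) _ h3 (fun ξ hξ => by
      rw [Θ.bump_eq_zero ξ (Or.inr hξ), zero_mul]) _ h4).1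
    refine le_trans (le_of_eq ?_) h5
    congr 1; ext x; congr 2; ext ξ
    simp only [Qp]
    rw [Θ.bump_eq, smul_inv_smul₀ h2.ne', mul_comm, add_sub_cancel_right]
  -- the total of the bounds
  set L₀ := ∫⁻ x, ‖invFourierT (Θ.low 0) x‖ₑ
  have hL₀ : L₀ ≠ ⊤ := by
    have hθ : ContDiff ℝ a fun ξ => ((Θ.θ ξ : ℝ) : ℂ) :=
      (Complex.ofRealCLM.contDiff.comp Θ.contDiff_θ).of_le (by exact_mod_cast le_top)
    have hθs : HasCompactSupport fun ξ => ((Θ.θ ξ : ℝ) : ℂ) := by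
      have e : Θ.low 0 = fun ξ => ((Θ.θ ξ : ℝ) : ℂ) := by
        funext ξ
        simp [FreqCutoff.low]
      exact e ▸ Θ.hasCompactSupport_low 0
    have hbd : ∀ n : ℕ, ∃ B, n ≤ a → ∀ ξ, ‖iteratedFDeriv ℝ n (fun ξ => ((Θ.θ ξ : ℝ) : ℂ)) ξ‖ ≤ B :=
      fun n => by
        by_cases hn : n ≤ a
        · obtain ⟨B, hB⟩ := (hθs.iteratedFDeriv (𝕜 := ℝ) n).exists_bound_of_continuous
            (hθ.continuous_iteratedFDeriv (by exact_mod_cast hn))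
          exact ⟨B, fun _ => hB⟩
        · exact ⟨0, fun h => absurd h hn⟩
    choose B hB using hbd
    have h := (hC₁ 0 _ hθ (fun ξ hξ => by rw [Θ.θ_eq_zero ξ hξ.le, Complex.ofReal_zero])
      (∑ n ∈ Finset.range (a + 1), B n) (fun n hn ξ => (hB n hn ξ).trans
        (Finset.single_le_sum (f := B) (fun j hj => (norm_nonneg _).trans
          (hB j (Nat.lt_succ_iff.1 (Finset.mem_range.1 hj)) 0))
          (Finset.mem_range.2 (Nat.lt_succ_of_le hn))))).1
    exact ne_top_of_le_ne_top (by finiteness) h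
  have hsum1 : ∑' i : ℕ, (C₁ : ℝ≥0∞) * ENNReal.ofReal (C₂ * (K₂ * b ^ i)) ≠ ⊤ := by
    rw [ENNReal.tsum_mul_left]
    refine ENNReal.mul_ne_top (by finiteness) ?_
    refine Summable.tsum_ofReal_ne_top ?_
    exact ((summable_geometric_of_lt_one hb0.le hb1).mul_left K₂).mul_left _
  have hsum2 : ∑' i : ℕ, (C₁ : ℝ≥0∞) *
      ENNReal.ofReal (C₂ * (K₁ * Real.exp (-(c * (T * ((2 : ℝ) ^ γ) ^ (i + 1)))))) ≠ ⊤ := by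
    rw [ENNReal.tsum_mul_left]
    refine ENNReal.mul_ne_top (by finiteness) ?_
    refine Summable.tsum_ofReal_ne_top ?_
    refine (Summable.mul_left K₁ ?_).mul_left _
    have hκ : 0 < c * T * (2 ^ γ - 1) := by
      have : (1 : ℝ) < 2 ^ γ := Real.one_lt_rpow one_lt_two hγ
      exact mul_pos (by positivity) (by linarith)
    refine Summable.of_nonneg_of_le (fun i => (Real.exp_pos _).le) (fun i => ?_)
      (summable_geometric_of_lt_one (Real.exp_pos (-(c * T * (2 ^ γ - 1)))).le
        (Real.exp_lt_one_iff.2 (by linarith)))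
    rw [← Real.exp_nat_mul, Real.exp_le_exp]
    have hB := one_add_mul_le_pow (a := (2 : ℝ) ^ γ - 1)
      (by linarith [Real.one_lt_rpow one_lt_two hγ]) (i + 1)
    rw [add_sub_cancel] at hB
    push_cast at hB
    have h6 : (i : ℝ) * (2 ^ γ - 1) ≤ ((2 : ℝ) ^ γ) ^ (i + 1) := by
      linarith [Real.one_lt_rpow one_lt_two hγ]
    have h7 := mul_le_mul_of_nonneg_left h6 (by positivity : 0 ≤ c * T)
    linarith
  -- the partial sums
  set S : ℕ → Rd d → ℂ := fun J ξ => Θ.low 0 ξ + ∑ i ∈ Finset.range J, (Qm i ξ + Qp i ξ)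
  have hlowi : ∀ k, Integrable (Θ.low k) := fun k =>
    (Θ.continuous_low k).integrable_of_hasCompactSupport (Θ.hasCompactSupport_low k)
  have hQpi : ∀ i, Integrable (Qp i) := fun i =>
    hEi.mul_bdd (c := 1) ((Θ.continuous_low _).sub (Θ.continuous_low _)).aestronglyMeasurable
      (ae_of_all _ fun ξ => Θ.norm_low_sub_low_le _ _ ξ)
  have hQmi : ∀ i, Integrable (Qm i) := fun i => by
    have h : Integrable fun ξ => E ξ * (Θ.low (-i) ξ - Θ.low (-i - 1) ξ) :=
      hEi.mul_bdd (c := 1) ((Θ.continuous_low _).sub (Θ.continuous_low _)).aestronglyMeasurable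
        (ae_of_all _ fun ξ => Θ.norm_low_sub_low_le _ _ ξ)
    refine (h.sub ((hlowi (-i)).sub (hlowi (-i - 1)))).congr (ae_of_all _ fun ξ => ?_)
    simp only [Qm, Pi.sub_apply]
    ring
  have hQi : ∀ i, Integrable fun ξ => Qm i ξ + Qp i ξ := fun i => (hQmi i).add (hQpi i)
  have hSeq : ∀ J ξ, S J ξ = Θ.low (-J) ξ + E ξ * (Θ.low J ξ - Θ.low (-J) ξ) := by
    intro J ξ
    induction J with
    | zero => simp [S]
    | succ J ih =>
      have : S (J + 1) ξ = S J ξ + (Qm J ξ + Qp J ξ) := by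
        simp only [S]
        rw [Finset.sum_range_succ, add_assoc]
      rw [this, ih]
      simp only [Qm, Qp]
      push_cast
      rw [neg_add']
      ring
  have hSinv : ∀ J x, invFourierT (S J) x = invFourierT (Θ.low 0) x +
      ∑ i ∈ Finset.range J, (invFourierT (Qm i) x + invFourierT (Qp i) x) := by
    intro J x
    simp only [S]
    rw [invFourierT_add (hlowi 0) (integrable_finsetSum _ fun i _ => hQi i),
      invFourierT_sum _ (fun i _ => hQi i)]
    congr 1
    exact Finset.sum_congr rfl fun i _ => invFourierT_add (hQmi i) (hQpi i) x
  have hmeas : ∀ {m : Rd d → ℂ}, Integrable m → Measurable fun x => ‖invFourierT m x‖ₑ := fun hm =>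
    (continuous_invFourierT hm).enorm.measurable
  have hmQ : ∀ i, Measurable fun x => ‖invFourierT (Qm i) x‖ₑ + ‖invFourierT (Qp i) x‖ₑ :=
    fun i => (hmeas (hQmi i)).add (hmeas (hQpi i))
  have hSb : ∀ J, ∫⁻ x, ‖invFourierT (S J) x‖ₑ ≤ L₀ +
      (∑' i : ℕ, (C₁ : ℝ≥0∞) * ENNReal.ofReal (C₂ * (K₂ * b ^ i)) + ∑' i : ℕ, (C₁ : ℝ≥0∞) *
        ENNReal.ofReal (C₂ * (K₁ * Real.exp (-(c * (T * ((2 : ℝ) ^ γ) ^ (i + 1))))))) := by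
    intro J
    calc _ ≤ ∫⁻ x, (‖invFourierT (Θ.low 0) x‖ₑ + ∑ i ∈ Finset.range J,
          (‖invFourierT (Qm i) x‖ₑ + ‖invFourierT (Qp i) x‖ₑ)) := by
          refine lintegral_mono fun x => ?_
          rw [hSinv]
          refine (enorm_add_le _ _).trans (add_le_add_right ?_ _)
          exact (enorm_sum_le _ _).trans (Finset.sum_le_sum fun i _ => enorm_add_le _ _)
      _ = L₀ + ∑ i ∈ Finset.range J,
          ((∫⁻ x, ‖invFourierT (Qm i) x‖ₑ) + ∫⁻ x, ‖invFourierT (Qp i) x‖ₑ) := by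
          rw [lintegral_add_left (hmeas (hlowi 0)), lintegral_finsetSum _
            fun i _ => hmQ i]
          congr 1
          exact Finset.sum_congr rfl fun i _ => lintegral_add_left (hmeas (hQmi i)) _
      _ ≤ _ := by
          refine add_le_add_right ?_ _
          rw [← ENNReal.tsum_add]
          exact (Finset.sum_le_sum fun i _ => add_le_add (hQm i) (hQp i)).trans
            (ENNReal.sum_le_tsum _)
  have hlim : ∀ x, Tendsto (fun J => invFourierT (S J) x) atTop (𝓝 (invFourierT E x)) := by
    intro x
    refine tendsto_invFourierT (b := fun ξ => (Metric.closedBall (0 : Rd d) Θ.R).indicator 1 ξ +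
      ‖E ξ‖) (fun J => ?_) ?_ (fun J => ae_of_all _ fun ξ => ?_) ?_ x
    · exact ((hlowi 0).add
        (integrable_finsetSum _ fun i _ => hQi i)).aestronglyMeasurable
    · refine Integrable.add ?_ hEi.norm
      exact (integrable_indicator_iff measurableSet_closedBall).2
        (integrableOn_const measure_closedBall_lt_top.ne)
    · rw [hSeq]
      refine (norm_add_le _ _).trans (add_le_add ?_ ?_)
      · by_cases h : ξ ∈ Metric.closedBall (0 : Rd d) Θ.R
        · rw [indicator_of_mem h]
          exact Θ.norm_low_le _ _
        · rw [indicator_of_notMem h, FreqCutoff.low, Θ.θ_eq_zero]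
          · simp
          · rw [norm_smul, zpow_neg, inv_inv, zpow_natCast, Real.norm_of_nonneg (by positivity)]
            have h8 : Θ.R < ‖ξ‖ := by simpa using h
            exact h8.le.trans (le_mul_of_one_le_left (norm_nonneg _) (one_le_pow₀ one_le_two))
      · rw [norm_mul]
        exact mul_le_of_le_one_right (norm_nonneg _) (Θ.norm_low_sub_low_le _ _ _)
    · filter_upwards [ae_ne_zero hd] with ξ hξ
      have h := (Θ.tendsto_low_neg hξ).add (((Θ.tendsto_low ξ).sub
        (Θ.tendsto_low_neg hξ)).const_mul (E ξ))
      simp only [sub_zero, mul_one, zero_add] at h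
      exact h.congr fun J => (hSeq J ξ).symm
  -- the symbols `S J` converge to `E`, and the bound of their kernels in `L¹` passes to the limit
  have hfatou := lintegral_liminf_le (μ := volume) (u := atTop)
    (f := fun J x => ‖invFourierT (S J) x‖ₑ) fun J => hmeas ((hlowi 0).add
        (integrable_finsetSum _ fun i _ => hQi i))
  have e : ∀ x, liminf (fun J => ‖invFourierT (S J) x‖ₑ) atTop = ‖invFourierT E x‖ₑ := fun x =>
    ((hlim x).enorm).liminf_eq
  simp_rw [e] at hfatou
  refine hfatou.trans_lt (lt_of_le_of_lt (liminf_le_of_frequently_le'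
    (Frequently.of_forall hSb)) ?_)
  exact (ENNReal.add_ne_top.2 ⟨hL₀, ENNReal.add_ne_top.2 ⟨hsum1, hsum2⟩⟩).lt_top

end KernelIntegrable

/-! ### Frequency decomposition of the kernels -/

section Inversion

open Filter Topology FourierTransform

/-- Fourier inversion, from the theorem of Mathlib by a change of variables. -/
theorem fourierT_invFourierT {E : Rd d → ℂ} (hEc : Continuous E) (hEi : Integrable E)
    (hE : Integrable (invFourierT E)) : fourierT (invFourierT E) = E := by
  have hpi : (0 : ℝ) < 2 * Real.pi := by positivity
  have hF : Integrable (𝓕 E) := by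
    have h1 : Integrable fun x : Rd d => 𝓕 E (-(2 * Real.pi)⁻¹ • x) := by
      refine (hE.const_mul ((((2 * Real.pi) ^ d : ℝ)) : ℂ)).congr (ae_of_all _ fun x => ?_)
      simp only
      rw [invFourierT_eq_fourier, ← mul_assoc, ← Complex.ofReal_mul,
        mul_inv_cancel₀ (by positivity), Complex.ofReal_one, one_mul]
    exact (integrable_comp_smul_iff volume (𝓕 E) (neg_ne_zero.2 (inv_ne_zero hpi.ne'))).1 h1
  have hinv : ∀ x, invFourierT E x = ((((2 * Real.pi) ^ d)⁻¹ : ℝ) : ℂ) *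
      𝓕⁻ E ((2 * Real.pi)⁻¹ • x) := fun x => by
    rw [invFourierT_eq_fourier, Real.fourierInv_eq_fourier_neg, neg_smul]
  funext ξ
  have key := congrFun (hEc.fourier_fourierInv_eq hEi hF) ξ
  conv_rhs => rw [← key]
  rw [fourierT, Real.fourier_eq]
  simp only [hinv]
  have h := Measure.integral_comp_smul (volume : Measure (Rd d)) (fun y : Rd d =>
    Complex.exp (-(Complex.I * ((inner ℝ ((2 * Real.pi) • y) ξ : ℝ) : ℂ))) *
      (((((2 * Real.pi) ^ d)⁻¹ : ℝ) : ℂ) * 𝓕⁻ E y)) (2 * Real.pi)⁻¹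
  simp only [smul_inv_smul₀ hpi.ne'] at h
  rw [h, finrank_euclideanSpace_fin, abs_of_pos (by positivity), ← integral_smul]
  congr 1; ext y
  rw [Circle.smul_def, Real.fourierChar_apply, inner_smul_left, smul_eq_mul, Complex.real_smul,
    mul_left_comm, ← mul_assoc (Complex.ofReal _), ← Complex.ofReal_mul, inv_pow, inv_inv,
    mul_inv_cancel₀ (by positivity), Complex.ofReal_one, one_mul]
  congr 2
  simp only [map_mul, conj_trivial, mul_neg, Complex.ofReal_neg, Complex.ofReal_mul]
  ring

variable {γ ν C T : ℝ} {A : Rd d → ℂ}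

/-- By Fourier inversion, `(-Δ)^{σ/2}` acts on the kernel by multiplication of its symbol. For the
inversion the symbol is made continuous by setting `A 0 = 0`. -/
theorem IsExponent.fracLaplacian_invFourierT (hd : d ≠ 0) (hγ : 0 < γ) (hν : 0 < ν)
    (hC : 0 ≤ C) (hT : 0 < T) (hA : IsExponent d γ ν C T A) (σ : ℝ) :
    fracLaplacian σ (invFourierT fun ξ => Complex.exp (A ξ)) =
      invFourierT fun ξ => ((‖ξ‖ ^ σ : ℝ) : ℂ) * Complex.exp (A ξ) := by
  classical
  set B : Rd d → ℂ := Function.update A 0 0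
  have hBA : ∀ ξ ≠ 0, B ξ = A ξ := fun ξ hξ => Function.update_of_ne hξ _ _
  have hB : IsExponent d γ ν C T B := hA.congr hBA
  have hae : (fun ξ => Complex.exp (A ξ)) =ᵐ[volume] fun ξ => Complex.exp (B ξ) := by
    filter_upwards [ae_ne_zero hd] with ξ hξ
    rw [hBA ξ hξ]
  have hBi := hB.integrable_exp hd hγ (by positivity)
  have hcont : Continuous fun ξ => Complex.exp (B ξ) :=
    Complex.continuous_exp.comp (hB.continuous hγ (Function.update_self _ _ _))
  have hK : Integrable (invFourierT fun ξ => Complex.exp (B ξ)) :=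
    ⟨(continuous_invFourierT hBi).aestronglyMeasurable,
      hB.lintegral_invFourierT_exp_lt_top hd hγ hν hC hT⟩
  rw [fracLaplacian, invFourierT_congr_ae hae, fourierT_invFourierT hcont hBi hK]
  refine invFourierT_congr_ae ?_
  filter_upwards [hae] with ξ hξ
  rw [hξ]

end Inversion

section Decomposition

open Filter Topology

/-- A piece of the kernel at the frequencies of the scale `2 ^ j`, with the symbol divided by the
symbol of the difference of smoothing operators at that scale. -/
noncomputable def FreqCutoff.piece (Θ : FreqCutoff d) (w : Rd d → ℂ) (j : ℤ) : Rd d → ℂ :=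
  invFourierT fun ξ => w ξ * Θ.η (((2 : ℝ) ^ j)⁻¹ • ξ)

theorem FreqCutoff.exists_norm_η_le (Θ : FreqCutoff d) : ∃ B, ∀ ξ, ‖Θ.η ξ‖ ≤ B :=
  (HasCompactSupport.intro (isCompact_closedBall (0 : Rd d) Θ.R) fun ξ hξ =>
    Θ.η_eq_zero ξ (Or.inr (by simpa using hξ))).exists_bound_of_continuous Θ.contDiff_η.continuous

theorem FreqCutoff.integrable_mul_η (Θ : FreqCutoff d) {w : Rd d → ℂ} (hw : Integrable w) (j : ℤ) :
    Integrable fun ξ => w ξ * Θ.η (((2 : ℝ) ^ j)⁻¹ • ξ) := by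
  obtain ⟨B, hB⟩ := Θ.exists_norm_η_le
  exact hw.mul_bdd (c := B)
    (Θ.contDiff_η.continuous.comp (continuous_const_smul _)).aestronglyMeasurable
    (ae_of_all _ fun ξ => hB _)

theorem FreqCutoff.continuous_piece (Θ : FreqCutoff d) {w : Rd d → ℂ} (hw : Integrable w) (j : ℤ) :
    Continuous (Θ.piece w j) :=
  continuous_invFourierT (Θ.integrable_mul_η hw j)

variable {H : Type*} [NormedAddCommGroup H] [InnerProductSpace ℂ H] [CompleteSpace H]

/-- Multiplication of the symbol by the characteristic function of `symCube d` amounts to smoothing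
the function with which the kernel is convolved. -/
theorem integral_invFourierT_mul_charFun_smul {g : Rd d → ℂ} (hg : Integrable g) (k : ℤ)
    {f : Rd d → H} (hf : Continuous f) (hfs : HasCompactSupport f) (x : Rd d) :
    Integrable (fun y => invFourierT g y • smoothing k f (x - y)) ∧
    ∫ y, invFourierT (fun ξ => g ξ * charFun (symCube d) (-(((2 : ℝ) ^ k)⁻¹ • ξ))) y • f (x - y) =
      ∫ y, invFourierT g y • smoothing k f (x - y) := by
  set σ : ℝ := ((2 : ℝ) ^ k)⁻¹
  set μ := symCube d
  have hfi : Integrable f := hf.integrable_of_hasCompactSupport hfs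
  set M : ℝ := ((2 * Real.pi) ^ d)⁻¹ * ∫ ξ, ‖g ξ‖
  have hKM : ∀ y, ‖invFourierT g y‖ ≤ M := norm_invFourierT_le g
  have hKc : Continuous (invFourierT g) := continuous_invFourierT hg
  have hK : ∀ y, invFourierT (fun ξ => g ξ * charFun μ (-(σ • ξ))) y =
      ∫ z, invFourierT g (y - σ • z) ∂μ := by
    intro y
    simp only [invFourierT]
    rw [integral_const_mul]
    congr 1
    have hint : Integrable (fun p : Rd d × Rd d =>
        Complex.exp (Complex.I * ((inner ℝ p.2 (y - σ • p.1) : ℝ) : ℂ)) * g p.2)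
        (μ.prod volume) := by
      refine (hg.comp_snd μ).bdd_mul (c := 1) (by fun_prop) (ae_of_all _ fun p => ?_)
      rw [mul_comm, Complex.norm_exp_ofReal_mul_I]
    rw [integral_integral_swap hint]
    congr 1; ext ξ
    rw [charFun_apply, integral_mul_const, mul_comm (g ξ), ← mul_assoc, ← integral_const_mul]
    congr 2; ext z
    rw [← Complex.exp_add]
    congr 1
    simp only [inner_sub_right, inner_smul_right, inner_neg_right, real_inner_comm ξ z]
    push_cast
    ring
  have hF1 : Integrable (fun p : Rd d × Rd d => invFourierT g (p.1 - σ • p.2) • f (x - p.1))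
      (volume.prod μ) := by
    have h1 : Integrable (fun p : Rd d × Rd d => f (x - p.1)) (volume.prod μ) :=
      (hfi.comp_sub_left x).comp_fst μ
    exact h1.bdd_smul M (Continuous.aestronglyMeasurable (by fun_prop)) (ae_of_all _ fun p => hKM _)
  have hF2 : Integrable (fun p : Rd d × Rd d => invFourierT g p.2 • f (x - p.2 - σ • p.1))
      (μ.prod volume) := by
    have hshift : ∀ z : Rd d, Integrable fun y => f (x - y - σ • z) := fun z => by
      have := hfi.comp_sub_left (x - σ • z)
      refine this.congr (ae_of_all _ fun y => ?_)
      simp only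
      congr 1
      abel
    have h1 : Integrable (fun p : Rd d × Rd d => f (x - p.2 - σ • p.1)) (μ.prod volume) := by
      rw [integrable_prod_iff (Continuous.aestronglyMeasurable (by fun_prop))]
      refine ⟨ae_of_all _ hshift, ?_⟩
      have : ∀ z : Rd d, ∫ y, ‖f (x - y - σ • z)‖ = ∫ y, ‖f y‖ := fun z => by
        rw [← integral_sub_left_eq_self (fun y => ‖f y‖) volume (x - σ • z)]
        congr 1; ext y
        congr 2
        abel
      simp only [this]
      exact integrable_const _
    exact h1.bdd_smul M (Continuous.aestronglyMeasurable (by fun_prop)) (ae_of_all _ fun p => hKM _)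
  have hsm : ∀ y, invFourierT g y • smoothing k f (x - y) =
      ∫ z, invFourierT g y • f (x - y - σ • z) ∂μ := fun y => by
    rw [smoothing, integral_smul]
  simp only [hsm]
  refine ⟨hF2.integral_prod_right, ?_⟩
  simp only [hK]
  calc ∫ y, (∫ z, invFourierT g (y - σ • z) ∂μ) • f (x - y)
      = ∫ y, ∫ z, invFourierT g (y - σ • z) • f (x - y) ∂μ := by
        congr 1; ext y
        rw [integral_smul_const]
    _ = ∫ z, (∫ y, invFourierT g (y - σ • z) • f (x - y)) ∂μ := integral_integral_swap hF1
    _ = ∫ z, (∫ y, invFourierT g y • f (x - y - σ • z)) ∂μ := by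
        congr 1; ext z
        rw [← integral_add_right_eq_self (μ := volume) _ (σ • z)]
        congr 1; ext y
        rw [add_sub_cancel_right, sub_sub]
    _ = _ := integral_integral_swap hF2

/-- A piece of the kernel factors through the difference of two smoothing operators. -/
theorem enorm_integral_piece_le (Θ : FreqCutoff d) {w : Rd d → ℂ} (hw : Integrable w) (j : ℤ)
    {f : Rd d → H} (hf : Continuous f) (hfs : HasCompactSupport f) (x : Rd d) :
    ‖∫ y, invFourierT (fun ξ => w ξ * Θ.bump (((2 : ℝ) ^ j)⁻¹ • ξ)) y • f (x - y)‖ₑ ≤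
      ∫⁻ y, ‖Θ.piece w j y‖ₑ * ‖smoothing j f (x - y) - smoothing (j - Θ.m) f (x - y)‖ₑ := by
  set g : Rd d → ℂ := fun ξ => w ξ * Θ.η (((2 : ℝ) ^ j)⁻¹ • ξ)
  have hg : Integrable g := Θ.integrable_mul_η hw j
  obtain ⟨h1, h2⟩ := integral_invFourierT_mul_charFun_smul hg j hf hfs x
  obtain ⟨h3, h4⟩ := integral_invFourierT_mul_charFun_smul hg (j - Θ.m) hf hfs x
  have hi : ∀ k : ℤ,
      Integrable fun ξ => g ξ * charFun (symCube d) (-(((2 : ℝ) ^ k)⁻¹ • ξ)) := fun k =>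
    hg.mul_bdd (c := 1) ((contDiff_charFun_symCube.continuous.comp
      (continuous_const_smul _).neg)).aestronglyMeasurable
      (ae_of_all _ fun ξ => norm_charFun_le_one _)
  have hsub : ∀ y, invFourierT (fun ξ => w ξ * Θ.bump (((2 : ℝ) ^ j)⁻¹ • ξ)) y =
      invFourierT (fun ξ => g ξ * charFun (symCube d) (-(((2 : ℝ) ^ j)⁻¹ • ξ))) y -
      invFourierT (fun ξ => g ξ * charFun (symCube d) (-(((2 : ℝ) ^ (j - Θ.m))⁻¹ • ξ))) y := by
    intro y
    rw [eq_sub_iff_add_eq]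
    have hb : (fun ξ => w ξ * Θ.bump (((2 : ℝ) ^ j)⁻¹ • ξ)) = fun ξ =>
        g ξ * charFun (symCube d) (-(((2 : ℝ) ^ j)⁻¹ • ξ)) -
          g ξ * charFun (symCube d) (-(((2 : ℝ) ^ (j - Θ.m))⁻¹ • ξ)) := by
      funext ξ
      have e : ((2 : ℝ) ^ (j - Θ.m))⁻¹ = 2 ^ Θ.m * ((2 : ℝ) ^ j)⁻¹ := by
        rw [zpow_sub₀ two_ne_zero, inv_div, zpow_natCast, div_eq_mul_inv]
      rw [FreqCutoff.bump, ← Θ.η_mul, diffSymbol, smul_smul, e]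
      simp only [g]
      ring
    have hij : Integrable fun ξ => g ξ * charFun (symCube d) (-(((2 : ℝ) ^ j)⁻¹ • ξ)) -
        g ξ * charFun (symCube d) (-(((2 : ℝ) ^ (j - Θ.m))⁻¹ • ξ)) := (hi j).sub (hi _)
    rw [hb, ← invFourierT_add hij (hi _)]
    congr 1
    funext ξ
    ring
  have hfi : ∀ k : ℤ, Integrable fun y => invFourierT
      (fun ξ => g ξ * charFun (symCube d) (-(((2 : ℝ) ^ k)⁻¹ • ξ))) y • f (x - y) := fun k =>
    ((hf.integrable_of_hasCompactSupport hfs).comp_sub_left x).bdd_smul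
      (((2 * Real.pi) ^ d)⁻¹ *
        ∫ ξ, ‖g ξ * charFun (symCube d) (-(((2 : ℝ) ^ k)⁻¹ • ξ))‖)
      (continuous_invFourierT (hi k)).aestronglyMeasurable
      (ae_of_all _ fun y => norm_invFourierT_le _ y)
  simp only [hsub, sub_smul]
  rw [integral_sub (hfi _) (hfi _), h2, h4, ← integral_sub h1 h3]
  refine (enorm_integral_le_lintegral_enorm _).trans_eq ?_
  congr 1; ext y
  rw [← smul_sub, enorm_smul]
  rfl

/-- The frequency decomposition of a convolution. It converges pointwise since `w` is integrable. -/
theorem enorm_integral_invFourierT_smul_le (hd : d ≠ 0) (Θ : FreqCutoff d) {w : Rd d → ℂ}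
    (hw : Integrable w) {f : Rd d → H} (hf : Continuous f) (hfs : HasCompactSupport f) (x : Rd d) :
    ‖∫ y, invFourierT w y • f (x - y)‖ₑ ≤ ∑' j : ℤ,
      ∫⁻ y, ‖Θ.piece w j y‖ₑ * ‖smoothing j f (x - y) - smoothing (j - Θ.m) f (x - y)‖ₑ := by
  -- the sum over `j` is enumerated by pairs `-i`, `i + 1`, so that the partial sums telescope
  set u : ℤ → Rd d → ℂ := fun j ξ => w ξ * Θ.bump (((2 : ℝ) ^ j)⁻¹ • ξ)
  set S : ℕ → Rd d → ℂ := fun J ξ => ∑ i ∈ Finset.range J, (u (-i) ξ + u (i + 1) ξ)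
  have hfi : Integrable fun y => f (x - y) :=
    (hf.integrable_of_hasCompactSupport hfs).comp_sub_left x
  have hSeq : ∀ J ξ, S J ξ = w ξ * (Θ.low J ξ - Θ.low (-J) ξ) := by
    intro J ξ
    induction J with
    | zero => simp [S]
    | succ J ih =>
      have : S (J + 1) ξ = S J ξ + (u (-J) ξ + u (J + 1) ξ) := by
        simp only [S]
        rw [Finset.sum_range_succ]
      rw [this, ih]
      simp only [u, Θ.bump_eq]
      push_cast
      rw [neg_add', add_sub_cancel_right]
      ring
  have hlow : ∀ (k l : ℤ), Integrable fun ξ => w ξ * (Θ.low k ξ - Θ.low l ξ) := fun k l =>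
    hw.mul_bdd (c := 1) ((Θ.continuous_low _).sub (Θ.continuous_low _)).aestronglyMeasurable
      (ae_of_all _ fun ξ => Θ.norm_low_sub_low_le _ _ ξ)
  have hu : ∀ j : ℤ, Integrable (u j) := fun j => by
    simp only [u, Θ.bump_eq]
    exact hlow j (j - 1)
  have hui : ∀ i : ℕ, Integrable fun ξ => u (-i) ξ + u (i + 1) ξ := fun i =>
    (hu (-i)).add (hu (i + 1))
  have hSi : ∀ J, Integrable (S J) := fun J => by
    have : S J = fun ξ => w ξ * (Θ.low J ξ - Θ.low (-J) ξ) := funext fun ξ => hSeq J ξ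
    rw [this]
    exact hlow _ _
  have hsm : ∀ {v : Rd d → ℂ}, Integrable v → Integrable fun y => invFourierT v y • f (x - y) :=
    fun {v} hv => hfi.bdd_smul (((2 * Real.pi) ^ d)⁻¹ * ∫ ξ, ‖v ξ‖)
      (continuous_invFourierT hv).aestronglyMeasurable
      (ae_of_all _ fun y => norm_invFourierT_le v y)
  have hint : ∀ J, ∫ y, invFourierT (S J) y • f (x - y) = ∑ i ∈ Finset.range J,
      ((∫ y, invFourierT (u (-i)) y • f (x - y)) + ∫ y, invFourierT (u (i + 1)) y • f (x - y)) := by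
    intro J
    have : ∀ y, invFourierT (S J) y • f (x - y) = ∑ i ∈ Finset.range J,
        (invFourierT (u (-i)) y • f (x - y) + invFourierT (u (i + 1)) y • f (x - y)) := by
      intro y
      simp only [S]
      rw [invFourierT_sum _ fun i _ => hui i, Finset.sum_smul]
      refine Finset.sum_congr rfl fun i _ => ?_
      rw [← add_smul]
      congr 1
      exact invFourierT_add (hu _) (hu _) y
    simp only [this]
    have hsmi : ∀ i : ℕ, Integrable fun y => invFourierT (u (-i)) y • f (x - y) +
        invFourierT (u (i + 1)) y • f (x - y) := fun i => (hsm (hu _)).add (hsm (hu _))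
    rw [integral_finsetSum _ fun i _ => hsmi i]
    exact Finset.sum_congr rfl fun i _ => integral_add (hsm (hu _)) (hsm (hu _))
  have hlim : Tendsto (fun J => ∫ y, invFourierT (S J) y • f (x - y)) atTop
      (𝓝 (∫ y, invFourierT w y • f (x - y))) := by
    have hSw : ∀ J ξ, ‖S J ξ‖ ≤ ‖w ξ‖ := fun J ξ => by
      rw [hSeq, norm_mul]
      exact mul_le_of_le_one_right (norm_nonneg _) (Θ.norm_low_sub_low_le _ _ _)
    refine tendsto_integral_of_dominated_convergence
      (fun y => (((2 * Real.pi) ^ d)⁻¹ * ∫ ξ, ‖w ξ‖) * ‖f (x - y)‖)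
      (fun J => (hsm (hSi J)).aestronglyMeasurable) (hfi.norm.const_mul _)
      (fun J => ae_of_all _ fun y => ?_) (ae_of_all _ fun y => ?_)
    · rw [norm_smul]
      refine mul_le_mul_of_nonneg_right ((norm_invFourierT_le _ y).trans ?_) (norm_nonneg _)
      exact mul_le_mul_of_nonneg_left (integral_mono (hSi J).norm hw.norm (hSw J)) (by positivity)
    · refine Tendsto.smul_const ?_ _
      refine tendsto_invFourierT (fun J => (hSi J).aestronglyMeasurable) hw.norm
        (fun J => ae_of_all _ (hSw J)) ?_ y
      filter_upwards [ae_ne_zero hd] with ξ hξ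
      have h := (((Θ.tendsto_low ξ).sub (Θ.tendsto_low_neg hξ)).const_mul (w ξ))
      simp only [sub_zero, mul_one] at h
      exact h.congr fun J => (hSeq J ξ).symm
  set a : ℤ → ℝ≥0∞ := fun j =>
    ∫⁻ y, ‖Θ.piece w j y‖ₑ * ‖smoothing j f (x - y) - smoothing (j - Θ.m) f (x - y)‖ₑ
  have ha : ∑' j, a j = ∑' i : ℕ, (a (-i) + a (i + 1)) := by
    have h := HasSum.of_nat_of_neg_add_one (f := fun j : ℤ => a (-j))
      (ENNReal.summable (f := fun n : ℕ => a (-n))).hasSum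
      (ENNReal.summable (f := fun n : ℕ => a (-(-((n : ℤ) + 1))))).hasSum
    rw [← (Equiv.neg ℤ).tsum_eq, ENNReal.tsum_add]
    refine (h.tsum_eq).trans ?_
    simp only [neg_neg]
  rw [ha]
  refine le_of_tendsto hlim.enorm (Eventually.of_forall fun J => ?_)
  rw [hint]
  refine (enorm_sum_le _ _).trans (le_trans (Finset.sum_le_sum fun i _ => ?_)
    (ENNReal.sum_le_tsum (Finset.range J)))
  exact (enorm_add_le _ _).trans (add_le_add (enorm_integral_piece_le Θ hw _ hf hfs x)
    (enorm_integral_piece_le Θ hw _ hf hfs x))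

/-- The weighted bound for the pieces of the kernel `(-Δ)^{γ/4} p(t,s,·)`, where `T = t - s` and
`A = ∫_s^t ψ`. Rescaling by `2 ^ j` turns `T` into `T 2 ^ (j γ)`. -/
theorem IsExponent.exists_lintegral_piece_le (Θ : FreqCutoff d) {γ ν C : ℝ} (hγ : 0 < γ)
    (hν : 0 < ν) (hC : 0 ≤ C) :
    ∃ (N : ℝ≥0) (c : ℝ), 0 < c ∧ ∀ (T : ℝ) (A : Rd d → ℂ), 0 ≤ T → IsExponent d γ ν C T A →
      ∀ (j : ℤ) (G h : Rd d → ℝ≥0∞), Measurable G → Measurable h →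
      ∫⁻ x, (∫⁻ y, ‖Θ.piece (fun ξ => ((‖ξ‖ ^ (γ / 2) : ℝ) : ℂ) * Complex.exp (A ξ)) j y‖ₑ *
          G (x - y)) ^ 2 * h x ≤
        N * ENNReal.ofReal ((((2 : ℝ) ^ (γ / 2)) ^ j *
          Real.exp (-(c * (T * (((2 : ℝ) ^ (γ / 2)) ^ j) ^ 2)))) ^ 2) *
          ∫⁻ x, G x ^ 2 * maximalFn volume h x := by
  set a := symbolOrder d
  have ha : d < 2 * a := by simp only [a, symbolOrder]; omega
  -- `‖ξ‖ ^ (γ / 2)` is smooth on the annulus carrying `η`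
  set q : Rd d → ℂ := fun ξ => ((‖ξ‖ ^ (γ / 2) : ℝ) : ℂ) * Θ.η ξ
  have hq0 : ∀ ξ, ‖ξ‖ < Θ.r ∨ Θ.R < ‖ξ‖ → q ξ = 0 := fun ξ hξ => by
    simp only [q]
    rw [Θ.η_eq_zero ξ hξ, mul_zero]
  have hq : ContDiff ℝ ∞ q := by
    rw [contDiff_iff_contDiffAt]
    intro ξ
    by_cases hξ : ‖ξ‖ < Θ.r
    · refine (contDiffAt_const (c := (0 : ℂ))).congr_of_eventuallyEq ?_
      filter_upwards [(isOpen_lt continuous_norm continuous_const).mem_nhds hξ] with ζ hζ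
      exact hq0 ζ (Or.inl hζ)
    · have h0 : ξ ≠ 0 := by
        rintro rfl
        exact hξ (by simpa using Θ.r_pos)
      have h1 : ContDiffAt ℝ ∞ (fun ξ : Rd d => ‖ξ‖ ^ (γ / 2)) ξ :=
        (contDiffAt_norm ℝ h0).rpow_const_of_ne (norm_ne_zero_iff.2 h0)
      exact (Complex.ofRealCLM.contDiff.contDiffAt.comp ξ h1).mul Θ.contDiff_η.contDiffAt
  obtain ⟨C₁, hC₁⟩ := lintegral_invFourierT_comp_smul_le d ha Θ.R
  obtain ⟨C₂, hC₂⟩ := contDiff_mul_of_annulus a hq Θ.r_pos hq0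
  obtain ⟨K, c, hK, hc, hexp⟩ :=
    IsExponent.exists_norm_iteratedFDeriv_exp_le d (γ := γ) (ν := ν) (C := C) Θ.R hν hC hγ.le
      Θ.r_pos
  refine ⟨C₁ * C₂ ^ 2 * K.toNNReal ^ 2, c, hc, fun T A hT hA j G h hG hh => ?_⟩
  set b : ℝ := ((2 : ℝ) ^ (γ / 2)) ^ j
  have hb : 0 < b := by positivity
  have h2 : (0 : ℝ) < 2 ^ j := by positivity
  have hbj : ((2 : ℝ) ^ j) ^ (γ / 2) = b := by
    simp only [b]
    rw [← Real.rpow_intCast, ← Real.rpow_intCast, ← Real.rpow_mul two_pos.le,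
      ← Real.rpow_mul two_pos.le, mul_comm]
  have hbj2 : ((2 : ℝ) ^ j) ^ γ = b ^ 2 := by
    rw [← hbj, ← Real.rpow_natCast, ← Real.rpow_mul h2.le]
    congr 1
    push_cast
    ring
  have hAj := hA.comp_smul (by positivity) h2
  rw [hbj2] at hAj
  obtain ⟨h3, h4⟩ := hC₂ (fun ξ => Complex.exp (A ((2 : ℝ) ^ j • ξ)))
    (K * Real.exp (-(c * (T * b ^ 2)))) hAj.contDiffOn_exp (by positivity)
    (hexp _ _ (by positivity) hAj)
  have h5 := (hC₁ j _ h3 (fun ξ hξ => by rw [hq0 ξ (Or.inr hξ), zero_mul]) _ h4).2 G h hG hh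
  have hpiece : ∀ y, Θ.piece (fun ξ => ((‖ξ‖ ^ (γ / 2) : ℝ) : ℂ) * Complex.exp (A ξ)) j y =
      (b : ℂ) * invFourierT (fun ξ => (fun ξ => q ξ * Complex.exp (A ((2 : ℝ) ^ j • ξ)))
        (((2 : ℝ) ^ j)⁻¹ • ξ)) y := by
    intro y
    simp only [FreqCutoff.piece, invFourierT]
    rw [mul_left_comm]
    congr 1
    rw [← integral_const_mul]
    refine integral_congr_ae (ae_of_all _ fun ξ => ?_)
    simp only [q]
    rw [smul_inv_smul₀ h2.ne', norm_smul, norm_inv, Real.norm_of_nonneg h2.le,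
      Real.mul_rpow (by positivity) (norm_nonneg _), Real.inv_rpow h2.le, hbj]
    push_cast
    have : (b : ℂ) ≠ 0 := by exact_mod_cast hb.ne'
    field_simp
  have hbe : ‖(b : ℂ)‖ₑ = ENNReal.ofReal b := by
    rw [← ofReal_norm, Complex.norm_real, Real.norm_of_nonneg hb.le]
  calc _ = ∫⁻ x, ENNReal.ofReal b ^ 2 * ((∫⁻ y, ‖invFourierT (fun ξ =>
        (fun ξ => q ξ * Complex.exp (A ((2 : ℝ) ^ j • ξ))) (((2 : ℝ) ^ j)⁻¹ • ξ)) y‖ₑ *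
          G (x - y)) ^ 2 * h x) := by
        refine lintegral_congr fun x => ?_
        simp only [hpiece, enorm_mul, hbe, mul_assoc]
        rw [lintegral_const_mul' _ _ ENNReal.ofReal_ne_top, mul_pow, mul_assoc]
    _ ≤ ENNReal.ofReal b ^ 2 *
          (C₁ * ENNReal.ofReal ((C₂ * (K * Real.exp (-(c * (T * b ^ 2))))) ^ 2) *
            ∫⁻ x, G x ^ 2 * maximalFn volume h x) := by
        rw [lintegral_const_mul' _ _ (by finiteness)]
        exact mul_le_mul_right h5 _
    _ = _ := by
        have e : ENNReal.ofReal K = (K.toNNReal : ℝ≥0∞) := rfl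
        rw [mul_pow (C₂ : ℝ), mul_pow K, mul_pow b, ENNReal.ofReal_mul (by positivity),
          ENNReal.ofReal_mul (by positivity), ENNReal.ofReal_mul (by positivity),
          ENNReal.ofReal_pow hK, ENNReal.ofReal_pow hb.le, ENNReal.ofReal_pow C₂.coe_nonneg, e,
          ENNReal.ofReal_coe_nnreal]
        push_cast
        ring

end Decomposition

/-! ### Summation over the frequencies and integration in time -/

section TimeKernel

open Filter Topology

theorem tsum_mul_sq_le {ι : Type*} (u v : ι → ℝ≥0∞) :
    (∑' i, u i * v i) ^ 2 ≤ (∑' i, u i ^ 2) * ∑' i, v i ^ 2 := by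
  let _ : MeasurableSpace ι := ⊤
  have h := lintegral_mul_sq_le (μ := Measure.count) (f := u) (g := v)
    (measurable_from_top).aemeasurable (measurable_from_top).aemeasurable
  simpa only [lintegral_count] using h

/-- The Cauchy–Schwarz inequality with the weights `β_j = b ^ j exp(-c T b ^ (2 j))`,
`b = 2 ^ (γ / 2)`, whose sum is of order `T ^ (-1/2)`, applied to the bounds of the pieces of the
kernel. -/
theorem IsExponent.exists_lintegral_tsum_piece_le (Θ : FreqCutoff d) {γ ν C : ℝ} (hγ : 0 < γ)
    (hν : 0 < ν) (hC : 0 ≤ C) :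
    ∃ (N : ℝ≥0) (c : ℝ), 0 < c ∧ ∀ (T : ℝ) (A : Rd d → ℂ), 0 < T → IsExponent d γ ν C T A →
      ∀ (D : ℤ → Rd d → ℝ≥0∞) (h : Rd d → ℝ≥0∞), (∀ j, Measurable (D j)) → Measurable h →
      Integrable (fun ξ => ((‖ξ‖ ^ (γ / 2) : ℝ) : ℂ) * Complex.exp (A ξ)) →
      ∫⁻ x, (∑' j : ℤ, ∫⁻ y,
          ‖Θ.piece (fun ξ => ((‖ξ‖ ^ (γ / 2) : ℝ) : ℂ) * Complex.exp (A ξ)) j y‖ₑ *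
          D j (x - y)) ^ 2 * h x ≤
        N * ∑' j : ℤ, ENNReal.ofReal ((√T)⁻¹ * (((2 : ℝ) ^ (γ / 2)) ^ j *
          Real.exp (-(c * (T * (((2 : ℝ) ^ (γ / 2)) ^ j) ^ 2))))) *
          ∫⁻ x, D j x ^ 2 * maximalFn volume h x := by
  obtain ⟨N, c, hc, hN⟩ := IsExponent.exists_lintegral_piece_le Θ hγ hν hC
  have hb1 : (1 : ℝ) < 2 ^ (γ / 2) := Real.one_lt_rpow one_lt_two (by positivity)
  obtain ⟨C₁, hC₁⟩ := tsum_zpow_mul_exp_le hb1 hc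
  refine ⟨C₁ * N, c, hc, fun T A hT hA D h hD hh hint => ?_⟩
  set b : ℝ := 2 ^ (γ / 2)
  have hb : 0 < b := by positivity
  set β : ℤ → ℝ := fun j => b ^ j * Real.exp (-(c * (T * (b ^ j) ^ 2)))
  have hβ : ∀ j, 0 < β j := fun j => by positivity
  set k : ℤ → Rd d → ℝ≥0∞ := fun j y =>
    ‖Θ.piece (fun ξ => ((‖ξ‖ ^ (γ / 2) : ℝ) : ℂ) * Complex.exp (A ξ)) j y‖ₑ
  have hk : ∀ j, Measurable (k j) := fun j => (Θ.continuous_piece hint j).enorm.measurable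
  set a : ℤ → Rd d → ℝ≥0∞ := fun j x => ∫⁻ y, k j y * D j (x - y)
  have ha : ∀ j, Measurable (a j) := fun j => by
    have : Measurable fun p : Rd d × Rd d => k j p.2 * D j (p.1 - p.2) :=
      ((hk j).comp measurable_snd).mul ((hD j).comp (measurable_fst.sub measurable_snd))
    exact this.lintegral_prod_right'
  have hsum : ∑' j, ENNReal.ofReal (β j) ≤ C₁ * ENNReal.ofReal (√T)⁻¹ := by
    refine le_trans (le_of_eq ?_) (hC₁ (√T) (Real.sqrt_pos.2 hT))
    refine tsum_congr fun j => ?_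
    simp only [β]
    rw [mul_pow, Real.sq_sqrt hT.le]
  have hβ0 : ∀ j, ENNReal.ofReal (β j) ≠ 0 := fun j => by simpa using hβ j
  have hβt : ∀ j, ENNReal.ofReal (β j) ≠ ⊤ := fun j => ENNReal.ofReal_ne_top
  have hcs : ∀ x, (∑' j, a j x) ^ 2 ≤ C₁ * ENNReal.ofReal (√T)⁻¹ *
      ∑' j, (ENNReal.ofReal (β j))⁻¹ * a j x ^ 2 := by
    intro x
    have h2 : ∀ j, ENNReal.ofReal (β j) = ENNReal.ofReal (√(β j)) ^ 2 := fun j => by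
      rw [← ENNReal.ofReal_pow (Real.sqrt_nonneg _), Real.sq_sqrt (hβ j).le]
    have hs0 : ∀ j, ENNReal.ofReal (√(β j)) ≠ 0 := fun j => by
      simpa using hβ j
    have h := tsum_mul_sq_le (fun j => ENNReal.ofReal (√(β j)))
      (fun j => (ENNReal.ofReal (√(β j)))⁻¹ * a j x)
    have e : ∀ j, ENNReal.ofReal (√(β j)) * ((ENNReal.ofReal (√(β j)))⁻¹ * a j x) = a j x :=
      fun j => by rw [← mul_assoc, ENNReal.mul_inv_cancel (hs0 j) ENNReal.ofReal_ne_top, one_mul]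
    simp only [e, mul_pow, ← ENNReal.inv_pow, ← h2] at h
    exact h.trans (mul_le_mul_left hsum _)
  have hm : ∀ j, Measurable fun x => (ENNReal.ofReal (β j))⁻¹ * a j x ^ 2 * h x := fun j =>
    (((ha j).pow_const 2).const_mul _).mul hh
  calc ∫⁻ x, (∑' j, a j x) ^ 2 * h x
      ≤ ∫⁻ x, C₁ * ENNReal.ofReal (√T)⁻¹ *
          ∑' j, (ENNReal.ofReal (β j))⁻¹ * a j x ^ 2 * h x := by
        refine lintegral_mono fun x => ?_
        rw [ENNReal.tsum_mul_right, ← mul_assoc]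
        exact mul_le_mul_left (hcs x) _
    _ = C₁ * ENNReal.ofReal (√T)⁻¹ *
          ∑' j, (ENNReal.ofReal (β j))⁻¹ * ∫⁻ x, a j x ^ 2 * h x := by
        rw [lintegral_const_mul' _ _ (by finiteness), lintegral_tsum fun j => (hm j).aemeasurable]
        congr 1
        refine tsum_congr fun j => ?_
        simp only [mul_assoc]
        rw [lintegral_const_mul' _ _ (ENNReal.inv_ne_top.2 (hβ0 j))]
    _ ≤ C₁ * ENNReal.ofReal (√T)⁻¹ * ∑' j, (ENNReal.ofReal (β j))⁻¹ *
          (N * ENNReal.ofReal (β j ^ 2) * ∫⁻ x, D j x ^ 2 * maximalFn volume h x) := by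
        gcongr with j
        exact hN T A hT.le hA j (D j) h (hD j) hh
    _ = _ := by
        rw [← ENNReal.tsum_mul_left, ← ENNReal.tsum_mul_left]
        refine tsum_congr fun j => ?_
        have e : ENNReal.ofReal ((√T)⁻¹ * (b ^ j * Real.exp (-(c * (T * (b ^ j) ^ 2))))) =
            ENNReal.ofReal (√T)⁻¹ * ENNReal.ofReal (β j) := ENNReal.ofReal_mul (by positivity)
        rw [ENNReal.ofReal_pow (hβ j).le, e]
        calc _ = C₁ * N * (ENNReal.ofReal (√T)⁻¹ *
              (ENNReal.ofReal (β j) * (ENNReal.ofReal (β j) * (ENNReal.ofReal (β j))⁻¹)) *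
                ∫⁻ x, D j x ^ 2 * maximalFn volume h x) := by ring
          _ = _ := by
              rw [ENNReal.mul_inv_cancel (hβ0 j) (hβt j), mul_one]
              push_cast
              rfl

/-- The averages in time that arise from a single frequency are dominated by the one-dimensional
maximal function, uniformly in the frequency. -/
theorem lintegral_time_le_maximalFn {c : ℝ} (hc : 0 < c) :
    ∃ C : ℝ≥0, ∀ (B : ℝ) (u : ℝ → ℝ≥0∞) (s : ℝ), 0 < B → Measurable u →
      ∫⁻ t, ENNReal.ofReal ((√(t - s))⁻¹ * (B * Real.exp (-(c * ((t - s) * B ^ 2))))) *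
        u t ≤ C * maximalFn volume u s := by
  have h2 : (1 : ℝ) < √2 := by
    rw [Real.lt_sqrt (by norm_num)]
    norm_num
  obtain ⟨C, hC⟩ := tsum_zpow_mul_exp_le h2 hc
  refine ⟨4 * C, fun B u s hB hu => ?_⟩
  -- a bound for the kernel on `2 ^ k ≤ t - s < 2 ^ (k + 1)`
  set e : ℤ → ℝ := fun k => ((√2) ^ k)⁻¹ * (B * Real.exp (-(c * (B * (√2) ^ k) ^ 2)))
  have hsq : ∀ k : ℤ, ((√2) ^ k) ^ 2 = (2 : ℝ) ^ k := fun k => by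
    rw [← zpow_natCast, zpow_comm, zpow_natCast, Real.sq_sqrt two_pos.le]
  have hpt : ∀ t,
      ENNReal.ofReal ((√(t - s))⁻¹ * (B * Real.exp (-(c * ((t - s) * B ^ 2))))) ≤
      ∑' k : ℤ, ENNReal.ofReal (e k) *
        (Metric.ball s ((2 : ℝ) ^ (k + 1))).indicator 1 t := by
    intro t
    rcases le_or_gt t s with ht | ht
    · -- the kernel vanishes for `t ≤ s`, by the convention for the inverse of `0`
      rw [Real.sqrt_eq_zero_of_nonpos (sub_nonpos.2 ht)]
      simp
    have hθ : 0 < t - s := sub_pos.2 ht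
    obtain ⟨k, hk1, hk2⟩ := exists_mem_Ico_zpow hθ one_lt_two
    refine le_trans ?_ (ENNReal.le_tsum k)
    have hmem : t ∈ Metric.ball s ((2 : ℝ) ^ (k + 1)) := by
      rw [Metric.mem_ball, Real.dist_eq, abs_of_pos hθ]
      exact hk2
    rw [indicator_of_mem hmem, Pi.one_apply, mul_one]
    refine ENNReal.ofReal_le_ofReal ?_
    simp only [e]
    have h3 : (√2) ^ k ≤ √(t - s) := Real.le_sqrt_of_sq_le (by rw [hsq]; exact hk1)
    have h4 : (B * (√2) ^ k) ^ 2 ≤ (t - s) * B ^ 2 := by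
      rw [mul_pow, hsq, mul_comm]
      gcongr
    gcongr
  have hm : ∀ k : ℤ, Measurable fun t =>
      ENNReal.ofReal (e k) * (Metric.ball s ((2 : ℝ) ^ (k + 1))).indicator u t := fun k =>
    (hu.indicator Metric.isOpen_ball.measurableSet).const_mul _
  calc _ ≤ ∫⁻ t, ∑' k : ℤ, ENNReal.ofReal (e k) *
        (Metric.ball s ((2 : ℝ) ^ (k + 1))).indicator u t := by
        refine lintegral_mono fun t => ?_
        refine (mul_le_mul_left (hpt t) _).trans_eq ?_
        rw [← ENNReal.tsum_mul_right]
        refine tsum_congr fun k => ?_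
        rw [mul_assoc]
        congr 1
        by_cases h : t ∈ Metric.ball s ((2 : ℝ) ^ (k + 1))
        · rw [indicator_of_mem h, indicator_of_mem h, Pi.one_apply, one_mul]
        · rw [indicator_of_notMem h, indicator_of_notMem h, zero_mul]
    _ = ∑' k : ℤ, ENNReal.ofReal (e k) * ∫⁻ t in Metric.ball s ((2 : ℝ) ^ (k + 1)), u t := by
        rw [lintegral_tsum fun k => (hm k).aemeasurable]
        refine tsum_congr fun k => ?_
        rw [lintegral_const_mul' _ _ ENNReal.ofReal_ne_top,
          lintegral_indicator Metric.isOpen_ball.measurableSet]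
    _ ≤ ∑' k : ℤ, ENNReal.ofReal (e k) *
          (ENNReal.ofReal (2 * (2 : ℝ) ^ (k + 1)) * maximalFn volume u s) := by
        gcongr with k
        have := lintegral_ball_le_maximalFn volume u s (k + 1)
        rwa [Real.volume_ball] at this
    _ = ∑' k : ℤ, 4 * ENNReal.ofReal B * maximalFn volume u s *
          ENNReal.ofReal ((√2) ^ k * Real.exp (-(c * (B * (√2) ^ k) ^ 2))) := by
        refine tsum_congr fun k => ?_
        have h4 : (4 : ℝ≥0∞) = ENNReal.ofReal 4 := by simp
        rw [← mul_assoc, ← ENNReal.ofReal_mul (by positivity), mul_right_comm _ (maximalFn _ _ _),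
          h4, ← ENNReal.ofReal_mul (by norm_num), ← ENNReal.ofReal_mul (by positivity)]
        congr 2
        simp only [e]
        rw [zpow_add_one₀ two_ne_zero, ← hsq]
        have : (√2) ^ k ≠ 0 := by positivity
        field_simp
        ring
    _ ≤ 4 * ENNReal.ofReal B * maximalFn volume u s * (C * ENNReal.ofReal B⁻¹) := by
        rw [ENNReal.tsum_mul_left]
        exact mul_le_mul_right (hC B hB) _
    _ = _ := by
        have : ENNReal.ofReal B * ENNReal.ofReal B⁻¹ = 1 := by
          rw [← ENNReal.ofReal_mul hB.le, mul_inv_cancel₀ hB.ne', ENNReal.ofReal_one]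
        calc _ = 4 * C * maximalFn volume u s * (ENNReal.ofReal B * ENNReal.ofReal B⁻¹) := by ring
          _ = _ := by
            rw [this, mul_one]
            push_cast
            rfl

end TimeKernel

/-! ### Measurability of the square function -/

section Measurability

open Filter Topology

variable {γ ν : ℝ} {ψ : ℝ → Rd d → ℂ}

theorem IsEllipticSymbol.intervalIntegrable_indicator (hν : 0 < ν)
    (hψ : IsEllipticSymbol d γ ν ψ) {ξ : Rd d} (hξ : ξ ≠ 0) (a b : ℝ) :
    IntervalIntegrable ((Ioi (0 : ℝ)).indicator fun r => ψ r ξ) volume a b := by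
  have hm : AEStronglyMeasurable ((Ioi (0 : ℝ)).indicator fun r => ψ r ξ) volume :=
    ((aemeasurable_indicator_iff measurableSet_Ioi).2 (hψ.aemeasurable ξ hξ)).aestronglyMeasurable
  have hb : ∀ᵐ r, ‖(Ioi (0 : ℝ)).indicator (fun r => ψ r ξ) r‖ ≤ ν⁻¹ * ‖ξ‖ ^ (γ - (0 : ℕ)) := by
    filter_upwards [(ae_restrict_iff' measurableSet_Ioi).1 hψ.deriv_le] with r hr
    by_cases h : r ∈ Ioi (0 : ℝ)
    · rw [indicator_of_mem h]
      simpa using hr h ξ hξ 0 (Nat.zero_le _) Fin.elim0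
    · rw [indicator_of_notMem h, norm_zero]
      positivity
  rw [intervalIntegrable_iff]
  exact Measure.integrableOn_of_bounded (measure_Ioc_lt_top.ne) hm (ae_restrict_of_ae hb)

/-- The time integrals of the symbol are differences of a jointly measurable function. -/
theorem IsEllipticSymbol.exists_measurable_primitive (hγ : 0 < γ) (hν : 0 < ν)
    (hψ : IsEllipticSymbol d γ ν ψ) :
    ∃ Ψ : ℝ → Rd d → ℂ, Measurable (Function.uncurry Ψ) ∧
      ∀ s t, 0 ≤ s → s ≤ t → ∀ ξ ≠ 0, Ψ t ξ - Ψ s ξ = ∫ r in s..t, ψ r ξ := by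
  classical
  set Ψ : ℝ → Rd d → ℂ := fun t ξ =>
    if ξ = 0 then 0 else ∫ r in 0..t, (Ioi (0 : ℝ)).indicator (fun r => ψ r ξ) r
  have heq : ∀ s t, 0 ≤ s → s ≤ t → ∀ ξ,
      ∫ r in s..t, (Ioi (0 : ℝ)).indicator (fun r => ψ r ξ) r = ∫ r in s..t, ψ r ξ := by
    intro s t hs hst ξ
    rw [intervalIntegral.integral_of_le hst, intervalIntegral.integral_of_le hst]
    refine setIntegral_congr_fun measurableSet_Ioc fun r hr => ?_
    exact indicator_of_mem (hs.trans_lt hr.1 : r ∈ Ioi (0 : ℝ)) _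
  refine ⟨Ψ, measurable_uncurry_of_continuous_of_measurable (fun ξ => ?_) fun t => ?_,
    fun s t hs hst ξ hξ => ?_⟩
  · by_cases hξ : ξ = 0
    · simp only [Ψ, hξ, if_true]
      exact continuous_const
    · simp only [Ψ, hξ, if_false]
      exact intervalIntegral.continuous_primitive (hψ.intervalIntegrable_indicator hν hξ) 0
  · rcases le_total t 0 with ht | ht
    · have : Ψ t = fun _ => 0 := by
        funext ξ
        simp only [Ψ]
        split_ifs with h
        · rfl
        · rw [intervalIntegral.integral_symm, intervalIntegral.integral_of_le ht,
            setIntegral_eq_zero_of_forall_eq_zero, neg_zero]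
          exact fun r hr => indicator_of_notMem (not_lt.2 hr.2 : r ∉ Ioi (0 : ℝ)) _
      rw [this]
      exact measurable_const
    · have h := (hψ.isExponent hν le_rfl ht).congr (B := Ψ t) fun ξ hξ => by
        simp only [Ψ, hξ, if_false]
        exact heq 0 t le_rfl ht ξ
      exact (h.continuous hγ (by simp [Ψ])).measurable
  · simp only [Ψ, hξ, if_false]
    rw [intervalIntegral.integral_interval_sub_left
      (hψ.intervalIntegrable_indicator hν hξ 0 t) (hψ.intervalIntegrable_indicator hν hξ 0 s),
      heq s t hs hst]

/-- The symbol of the operator `(-Δ)^{γ/4} p(t,s,·) *`. -/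
noncomputable def evolutionSymbol (γ : ℝ) (ψ : ℝ → Rd d → ℂ) (t s : ℝ) (ξ : Rd d) : ℂ :=
  ((‖ξ‖ ^ (γ / 2) : ℝ) : ℂ) * Complex.exp (∫ r in s..t, ψ r ξ)

theorem IsEllipticSymbol.integrable_evolutionSymbol (hd : d ≠ 0) (hγ : 0 < γ) (hν : 0 < ν)
    (hψ : IsEllipticSymbol d γ ν ψ) {s t : ℝ} (hs : 0 ≤ s) (hst : s < t) :
    Integrable (evolutionSymbol γ ψ t s) :=
  (hψ.isExponent hν hs hst.le).integrable hd hγ (mul_pos hν (sub_pos.2 hst)) (by positivity)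

theorem IsEllipticSymbol.fracLaplacian_kernel (hd : d ≠ 0) (hγ : 0 < γ) (hν : 0 < ν)
    (hψ : IsEllipticSymbol d γ ν ψ) {s t : ℝ} (hs : 0 ≤ s) (hst : s < t) :
    fracLaplacian (γ / 2) (kernel ψ t s) = invFourierT (evolutionSymbol γ ψ t s) := by
  have : kernel ψ t s = invFourierT fun ξ => Complex.exp (∫ r in s..t, ψ r ξ) := by
    funext x
    rw [kernel, if_pos ⟨hs, hst⟩]
  rw [this, (hψ.isExponent hν hs hst.le).fracLaplacian_invFourierT hd hγ hν (by positivity)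
    (sub_pos.2 hst)]
  rfl

variable {H : Type*} [NormedAddCommGroup H] [InnerProductSpace ℂ H]

/-- The convolutions in the square function are jointly measurable in `t`, `s` and `x`. The
values of `V` for `s < 0` or `t ≤ s` are irrelevant. -/
theorem IsEllipticSymbol.exists_stronglyMeasurable_convolution (hd : d ≠ 0) (hγ : 0 < γ)
    (hν : 0 < ν) (hψ : IsEllipticSymbol d γ ν ψ) {f : ℝ × Rd d → H} (hf : Continuous f) :
    ∃ V : (ℝ × ℝ) × Rd d → H, StronglyMeasurable V ∧ ∀ t s x, 0 ≤ s → s < t →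
      V ((t, s), x) = ∫ y, invFourierT (evolutionSymbol γ ψ t s) y • f (s, x - y) := by
  obtain ⟨Ψ, hΨ, hΨeq⟩ := hψ.exists_measurable_primitive hγ hν
  set W : (ℝ × ℝ) × Rd d → ℂ := fun p =>
    ((‖p.2‖ ^ (γ / 2) : ℝ) : ℂ) * Complex.exp (Ψ p.1.1 p.2 - Ψ p.1.2 p.2)
  have hW : Measurable W := by
    have h1 : Measurable fun p : (ℝ × ℝ) × Rd d => Ψ p.1.1 p.2 :=
      hΨ.comp ((measurable_fst.comp measurable_fst).prodMk measurable_snd)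
    have h2 : Measurable fun p : (ℝ × ℝ) × Rd d => Ψ p.1.2 p.2 :=
      hΨ.comp ((measurable_snd.comp measurable_fst).prodMk measurable_snd)
    exact (Complex.measurable_ofReal.comp (measurable_snd.norm.pow_const _)).mul
      (Complex.measurable_exp.comp (h1.sub h2))
  set K : (ℝ × ℝ) × Rd d → ℂ := fun p => invFourierT (fun ξ => W (p.1, ξ)) p.2
  have hK : StronglyMeasurable K := by
    have h : Measurable fun q : ((ℝ × ℝ) × Rd d) × Rd d =>
        Complex.exp (Complex.I * ((inner ℝ q.2 q.1.2 : ℝ) : ℂ)) * W (q.1.1, q.2) := by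
      refine Measurable.mul ?_
        (hW.comp ((measurable_fst.comp measurable_fst).prodMk measurable_snd))
      exact Continuous.measurable (by fun_prop)
    exact h.stronglyMeasurable.integral_prod_right'.const_mul _
  refine ⟨fun p => ∫ y, K (p.1, y) • f (p.1.2, p.2 - y), ?_, fun t s x hs hst => ?_⟩
  · have h1 : StronglyMeasurable fun q : ((ℝ × ℝ) × Rd d) × Rd d => K (q.1.1, q.2) :=
      hK.comp_measurable ((measurable_fst.comp measurable_fst).prodMk measurable_snd)
    have h2 : StronglyMeasurable fun q : ((ℝ × ℝ) × Rd d) × Rd d => f (q.1.1.2, q.1.2 - q.2) :=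
      Continuous.stronglyMeasurable (by fun_prop)
    exact (h1.smul h2).integral_prod_right'
  · have h : invFourierT (fun ξ => W ((t, s), ξ)) = invFourierT (evolutionSymbol γ ψ t s) := by
      refine invFourierT_congr_ae ?_
      filter_upwards [ae_ne_zero hd] with ξ hξ
      simp only [W, evolutionSymbol]
      rw [hΨeq s t hs hst.le ξ hξ]
    simp only [K, h]

theorem measurable_setLIntegral_enorm_sq {F : Type*} [NormedAddCommGroup F]
    {V : (ℝ × ℝ) × Rd d → F} (hV : StronglyMeasurable V) :
    Measurable fun z : ℝ × Rd d => ∫⁻ s in Ioo 0 z.1, ‖V ((z.1, s), z.2)‖ₑ ^ 2 := by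
  have h : ∀ z : ℝ × Rd d, ∫⁻ s in Ioo 0 z.1, ‖V ((z.1, s), z.2)‖ₑ ^ 2 =
      ∫⁻ s, ({q : (ℝ × Rd d) × ℝ | 0 < q.2 ∧ q.2 < q.1.1}.indicator
        fun q => ‖V ((q.1.1, q.2), q.1.2)‖ₑ ^ 2) (z, s) := fun z => by
    rw [← lintegral_indicator measurableSet_Ioo]
    rfl
  simp_rw [h]
  refine Measurable.lintegral_prod_right' (Measurable.indicator ?_ ?_)
  · refine (hV.comp_measurable ?_).enorm.pow_const 2
    exact ((measurable_fst.comp measurable_fst).prodMk measurable_snd).prodMk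
      (measurable_snd.comp measurable_fst)
  · exact (measurableSet_lt measurable_const measurable_snd).inter
      (measurableSet_lt measurable_snd (measurable_fst.comp measurable_fst))

theorem measurable_smoothing_sub {f : ℝ × Rd d → H} (hf : Continuous f) (j k : ℤ) :
    StronglyMeasurable fun z : ℝ × Rd d =>
      smoothing j (fun y => f (z.1, y)) z.2 - smoothing k (fun y => f (z.1, y)) z.2 := by
  have h : ∀ k : ℤ, StronglyMeasurable fun z : ℝ × Rd d => smoothing k (fun y => f (z.1, y)) z.2 :=
    fun k => by
      have : StronglyMeasurable fun q : (ℝ × Rd d) × Rd d =>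
          f (q.1.1, q.1.2 - ((2 : ℝ) ^ k)⁻¹ • q.2) := Continuous.stronglyMeasurable (by fun_prop)
      exact this.integral_prod_right'
  exact (h j).sub (h k)

end Measurability

/-! ### The weighted inequality for the square function -/

section Maximal

theorem maximalFn_mono {E : Type*} [NormedAddCommGroup E] [MeasurableSpace E] (μ : Measure E)
    {u v : E → ℝ≥0∞} (h : ∀ y, u y ≤ v y) (x : E) : maximalFn μ u x ≤ maximalFn μ v x :=
  iSup_mono fun _ => mul_le_mul_right (lintegral_mono h) _

/-- The maximal function in the space variable. -/
noncomputable def spaceMaximal (h : ℝ × Rd d → ℝ≥0∞) (z : ℝ × Rd d) : ℝ≥0∞ :=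
  maximalFn volume (fun y => h (z.1, y)) z.2

/-- The maximal function in the time variable. -/
noncomputable def timeMaximal (h : ℝ × Rd d → ℝ≥0∞) (z : ℝ × Rd d) : ℝ≥0∞ :=
  maximalFn volume (fun t => h (t, z.2)) z.1

theorem measurable_spaceMaximal {h : ℝ × Rd d → ℝ≥0∞} (hh : Measurable h) :
    Measurable (spaceMaximal h) :=
  measurable_maximalFn_prod volume hh

theorem measurable_timeMaximal {h : ℝ × Rd d → ℝ≥0∞} (hh : Measurable h) :
    Measurable (timeMaximal h) := by
  have hswap : ∀ F : Rd d → ℝ → ℝ≥0∞, (Measurable fun q : Rd d × ℝ => F q.1 q.2) →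
      Measurable fun z : ℝ × Rd d => F z.2 z.1 := fun F hF => hF.comp measurable_swap
  exact hswap (fun x => maximalFn volume fun t => h (t, x))
    (measurable_maximalFn_prod volume (hh.comp measurable_swap))

theorem exists_lintegral_spaceMaximal_rpow_le (d : ℕ) {q : ℝ} (hq : 1 < q) :
    ∃ C : ℝ≥0, ∀ h : ℝ × Rd d → ℝ≥0∞, Measurable h →
      ∫⁻ z, spaceMaximal h z ^ q ≤ C * ∫⁻ z, h z ^ q := by
  obtain ⟨C, hC⟩ := lintegral_maximalFn_rpow_le (volume : Measure (Rd d)) hq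
  refine ⟨C, fun h hh => ?_⟩
  rw [Measure.volume_eq_prod,
    lintegral_prod _ ((measurable_spaceMaximal hh).pow_const q).aemeasurable,
    lintegral_prod _ (hh.pow_const q).aemeasurable, ← lintegral_const_mul' _ _ ENNReal.coe_ne_top]
  exact lintegral_mono fun t => hC _ (hh.comp measurable_prodMk_left)

theorem exists_lintegral_timeMaximal_rpow_le (d : ℕ) {q : ℝ} (hq : 1 < q) :
    ∃ C : ℝ≥0, ∀ h : ℝ × Rd d → ℝ≥0∞, Measurable h →
      ∫⁻ z, timeMaximal h z ^ q ≤ C * ∫⁻ z, h z ^ q := by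
  obtain ⟨C, hC⟩ := lintegral_maximalFn_rpow_le (volume : Measure ℝ) hq
  refine ⟨C, fun h hh => ?_⟩
  rw [Measure.volume_eq_prod,
    lintegral_prod_symm _ ((measurable_timeMaximal hh).pow_const q).aemeasurable,
    lintegral_prod_symm _ (hh.pow_const q).aemeasurable,
    ← lintegral_const_mul' _ _ ENNReal.coe_ne_top]
  exact lintegral_mono fun x => hC _ (hh.comp measurable_prodMk_right)

end Maximal

section WeightedInequality

open Filter Topology

universe u

/-- The weighted inequality for the square function, from which the `L_p` bound follows by duality.
The maximal functions in space come from the kernels of the frequency pieces and from the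
Littlewood–Paley inequality, the one in time from the integration over `t`. -/
theorem exists_lintegral_sq_mul_le (hd : d ≠ 0) {γ ν : ℝ} (hγ : 0 < γ) (hν : 0 < ν) :
    ∃ N : ℝ≥0, ∀ ψ : ℝ → Rd d → ℂ, IsEllipticSymbol d γ ν ψ →
      ∀ (H : Type u) [NormedAddCommGroup H] [InnerProductSpace ℂ H] [CompleteSpace H]
        (f : ℝ × Rd d → H) (V : (ℝ × ℝ) × Rd d → H) (h : ℝ × Rd d → ℝ≥0∞), Continuous f →
        HasCompactSupport f → StronglyMeasurable V → (∀ t s x, 0 ≤ s → s < t →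
          V ((t, s), x) = ∫ y, invFourierT (evolutionSymbol γ ψ t s) y • f (s, x - y)) →
        Measurable h →
        ∫⁻ z : ℝ × Rd d, (∫⁻ s in Ioo 0 z.1, ‖V ((z.1, s), z.2)‖ₑ ^ 2) * h z ≤
          N * ∫⁻ z, ‖f z‖ₑ ^ 2 * spaceMaximal (timeMaximal (spaceMaximal h)) z := by
  obtain ⟨Θ⟩ := (inferInstance : Nonempty (FreqCutoff d))
  obtain ⟨N₁, c, hc, hN₁⟩ := IsExponent.exists_lintegral_tsum_piece_le Θ hγ hν
    (by positivity : 0 ≤ (1 + (d : ℝ)) ^ symbolOrder d * ν⁻¹)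
  obtain ⟨N₂, hN₂⟩ := lintegral_time_le_maximalFn hc
  have hsq : squareConst d ≠ ⊤ := squareConst_ne_top
  refine ⟨N₁ * N₂ * (Θ.m ^ 2 * squareConst d).toNNReal, ?_⟩
  intro ψ hψ H _ _ _ f V h hf hfs hV hVeq hh
  set b : ℝ := 2 ^ (γ / 2)
  have hb : 0 < b := by positivity
  set κ : ℤ → ℝ → ℝ≥0∞ := fun j θ =>
    ENNReal.ofReal ((√θ)⁻¹ * (b ^ j * Real.exp (-(c * (θ * (b ^ j) ^ 2)))))
  have hκ : ∀ j, Measurable (κ j) := fun j => by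
    refine ENNReal.measurable_ofReal.comp (Measurable.mul ?_ (Continuous.measurable (by fun_prop)))
    exact Real.continuous_sqrt.measurable.inv
  have hf1 : ∀ s, Continuous fun y => f (s, y) := fun s => by fun_prop
  have hfs1 : ∀ s, HasCompactSupport fun y => f (s, y) := fun s =>
    HasCompactSupport.intro (hfs.isCompact.image continuous_snd) fun y hy =>
      image_eq_zero_of_notMem_tsupport fun h => hy ⟨(s, y), h, rfl⟩
  obtain ⟨B, hB⟩ := hfs.exists_bound_of_continuous hf
  set P : ℤ → ℝ × Rd d → ℝ≥0∞ := fun j z =>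
    ‖smoothing j (fun y => f (z.1, y)) z.2 - smoothing (j - Θ.m) (fun y => f (z.1, y)) z.2‖ₑ
  have hP : ∀ j, Measurable (P j) := fun j => (measurable_smoothing_sub hf j _).enorm
  set Mh := spaceMaximal h
  have hMh : Measurable Mh := measurable_spaceMaximal hh
  -- the bound for fixed times
  have hts : ∀ t s, 0 ≤ s → s < t → ∫⁻ x, ‖V ((t, s), x)‖ₑ ^ 2 * h (t, x) ≤
      N₁ * ∑' j, κ j (t - s) * ∫⁻ x, P j (s, x) ^ 2 * Mh (t, x) := by
    intro t s hs hst
    have hint := hψ.integrable_evolutionSymbol hd hγ hν hs hst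
    refine le_trans (lintegral_mono fun x => ?_)
      (hN₁ (t - s) _ (sub_pos.2 hst) (hψ.isExponent hν hs hst.le) (fun j x => P j (s, x))
        (fun x => h (t, x)) (fun j => (hP j).comp measurable_prodMk_left)
        (hh.comp measurable_prodMk_left) hint)
    rw [hVeq t s x hs hst]
    exact mul_le_mul_left (pow_le_pow_left'
      (enorm_integral_invFourierT_smul_le hd Θ hint (hf1 s) (hfs1 s) x) 2) _
  -- measurability
  have hF : ∀ j, Measurable fun q : (ℝ × ℝ) × Rd d =>
      κ j (q.1.1 - q.1.2) * (P j (q.1.2, q.2) ^ 2 * Mh (q.1.1, q.2)) := fun j => by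
    refine ((hκ j).comp (by fun_prop)).mul ((((hP j).comp ?_).pow_const 2).mul (hMh.comp ?_))
    · fun_prop
    · fun_prop
  have hF2 : ∀ j, Measurable fun q : ℝ × ℝ => κ j (q.1 - q.2) *
      ∫⁻ x, P j (q.2, x) ^ 2 * Mh (q.1, x) := fun j => by
    refine ((hκ j).comp (by fun_prop)).mul ?_
    refine Measurable.lintegral_prod_right'
      (f := fun q : (ℝ × ℝ) × Rd d => P j (q.1.2, q.2) ^ 2 * Mh (q.1.1, q.2)) ?_
    exact (((hP j).comp (by fun_prop)).pow_const 2).mul (hMh.comp (by fun_prop))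
  have hMTM : Measurable (timeMaximal Mh) := measurable_timeMaximal hMh
  have hVm : ∀ t, Measurable fun q : Rd d × ℝ => ‖V ((t, q.2), q.1)‖ₑ ^ 2 * h (t, q.1) := fun t =>
    ((hV.comp_measurable (by fun_prop)).enorm.pow_const 2).mul (hh.comp (by fun_prop))
  calc ∫⁻ z : ℝ × Rd d, (∫⁻ s in Ioo 0 z.1, ‖V ((z.1, s), z.2)‖ₑ ^ 2) * h z
      = ∫⁻ t, ∫⁻ x, (∫⁻ s in Ioo 0 t, ‖V ((t, s), x)‖ₑ ^ 2) * h (t, x) := by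
        rw [Measure.volume_eq_prod, lintegral_prod]
        exact ((measurable_setLIntegral_enorm_sq hV).mul hh).aemeasurable
    _ = ∫⁻ t, ∫⁻ s in Ioo 0 t, ∫⁻ x, ‖V ((t, s), x)‖ₑ ^ 2 * h (t, x) := by
        refine lintegral_congr fun t => ?_
        rw [← lintegral_lintegral_swap (hVm t).aemeasurable]
        refine lintegral_congr fun x => ?_
        rw [lintegral_mul_const]
        exact (hV.comp_measurable (by fun_prop)).enorm.pow_const 2
    _ ≤ ∫⁻ t, ∫⁻ s in Ioo 0 t, N₁ * ∑' j, κ j (t - s) * ∫⁻ x, P j (s, x) ^ 2 * Mh (t, x) := by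
        refine lintegral_mono fun t => setLIntegral_mono' measurableSet_Ioo fun s hs => ?_
        exact hts t s hs.1.le hs.2
    _ ≤ ∫⁻ t, ∫⁻ s, N₁ * ∑' j, κ j (t - s) * ∫⁻ x, P j (s, x) ^ 2 * Mh (t, x) :=
        lintegral_mono fun t => setLIntegral_le_lintegral _ _
    _ = N₁ * ∑' j, ∫⁻ t, ∫⁻ s, κ j (t - s) * ∫⁻ x, P j (s, x) ^ 2 * Mh (t, x) := by
        rw [← lintegral_tsum]
        · rw [← lintegral_const_mul' _ _ ENNReal.coe_ne_top]
          refine lintegral_congr fun t => ?_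
          rw [lintegral_const_mul' _ _ ENNReal.coe_ne_top, lintegral_tsum]
          exact fun j => ((hF2 j).comp measurable_prodMk_left).aemeasurable
        · exact fun j => (hF2 j).lintegral_prod_right'.aemeasurable
    _ = N₁ * ∑' j, ∫⁻ s, ∫⁻ x, P j (s, x) ^ 2 * ∫⁻ t, κ j (t - s) * Mh (t, x) := by
        congr 1
        refine tsum_congr fun j => ?_
        rw [lintegral_lintegral_swap (hF2 j).aemeasurable]
        refine lintegral_congr fun s => ?_
        have e : ∀ t, κ j (t - s) * ∫⁻ x, P j (s, x) ^ 2 * Mh (t, x) =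
            ∫⁻ x, κ j (t - s) * (P j (s, x) ^ 2 * Mh (t, x)) := fun t => by
          rw [lintegral_const_mul' _ _ ENNReal.ofReal_ne_top]
        simp_rw [e]
        have hm : Measurable fun q : ℝ × Rd d =>
            κ j (q.1 - s) * (P j (s, q.2) ^ 2 * Mh (q.1, q.2)) :=
          (hF j).comp (by fun_prop : Measurable fun q : ℝ × Rd d => ((q.1, s), q.2))
        rw [lintegral_lintegral_swap hm.aemeasurable]
        refine lintegral_congr fun x => ?_
        simp_rw [mul_left_comm (κ j _)]
        rw [lintegral_const_mul]
        exact ((hκ j).comp (by fun_prop)).mul (hMh.comp (by fun_prop))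
    _ ≤ N₁ * ∑' j, ∫⁻ s, ∫⁻ x, P j (s, x) ^ 2 * (N₂ * timeMaximal Mh (s, x)) := by
        gcongr with j s x
        exact hN₂ (b ^ j) (fun t => Mh (t, x)) s (by positivity)
          (hMh.comp measurable_prodMk_right)
    _ = N₁ * N₂ * ∫⁻ s, ∑' j, ∫⁻ x, P j (s, x) ^ 2 * timeMaximal Mh (s, x) := by
        rw [lintegral_tsum, mul_assoc, ← ENNReal.tsum_mul_left (a := (N₂ : ℝ≥0∞))]
        · congr 1
          refine tsum_congr fun j => ?_
          rw [← lintegral_const_mul' _ _ ENNReal.coe_ne_top]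
          refine lintegral_congr fun s => ?_
          rw [← lintegral_const_mul' _ _ ENNReal.coe_ne_top]
          refine lintegral_congr fun x => ?_
          ring
        · exact fun j => Measurable.aemeasurable (Measurable.lintegral_prod_right'
            (f := fun q : ℝ × Rd d => P j (q.1, q.2) ^ 2 * timeMaximal Mh (q.1, q.2))
            (((hP j).pow_const 2).mul hMTM))
    _ ≤ N₁ * N₂ * ∫⁻ s, Θ.m ^ 2 * squareConst d *
          ∫⁻ x, ‖f (s, x)‖ₑ ^ 2 * spaceMaximal (timeMaximal Mh) (s, x) := by
        gcongr with s
        exact tsum_lintegral_smoothing_sub_le Θ.m (hf1 s) (fun x => hB (s, x))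
          (hMTM.comp measurable_prodMk_left)
    _ = _ := by
        have hC : (Θ.m ^ 2 * squareConst d : ℝ≥0∞) ≠ ⊤ := by finiteness
        rw [lintegral_const_mul' _ _ hC, ENNReal.coe_mul, ENNReal.coe_toNNReal hC,
          Measure.volume_eq_prod, lintegral_prod]
        · push_cast
          ring
        · exact ((hf.enorm.measurable.pow_const 2).mul
            (measurable_spaceMaximal hMTM)).aemeasurable

end WeightedInequality

/-! ### From weighted estimates to `L^p` estimates -/

section LpEstimate

variable {γ ν : ℝ}

/-- The maximal operators do not increase the weight `1`, which is the one needed for `p = 2`. -/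
theorem iterated_maximal_one_le (z : ℝ × Rd d) :
    spaceMaximal (timeMaximal (spaceMaximal fun _ => 1)) z ≤ 1 := by
  have h1 : ∀ z : ℝ × Rd d, spaceMaximal (fun _ => 1) z ≤ 1 := fun z => maximalFn_one_le _ _
  have h2 : ∀ z : ℝ × Rd d, timeMaximal (spaceMaximal fun _ => 1) z ≤ 1 := fun z =>
    (maximalFn_mono volume (fun t => h1 (t, z.2)) z.1).trans (maximalFn_one_le _ _)
  exact (maximalFn_mono volume (fun y => h2 (z.1, y)) z.2).trans (maximalFn_one_le _ _)

theorem exists_lintegral_iterated_maximal_rpow_le (d : ℕ) {q : ℝ} (hq : 1 < q) :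
    ∃ C : ℝ≥0, ∀ h : ℝ × Rd d → ℝ≥0∞, Measurable h →
      ∫⁻ z, spaceMaximal (timeMaximal (spaceMaximal h)) z ^ q ≤ C * ∫⁻ z, h z ^ q := by
  obtain ⟨A, hA⟩ := exists_lintegral_spaceMaximal_rpow_le d hq
  obtain ⟨B, hB⟩ := exists_lintegral_timeMaximal_rpow_le d hq
  refine ⟨A * (B * A), fun h hh => ?_⟩
  calc _ ≤ A * (B * (A * ∫⁻ z, h z ^ q)) := by
        refine (hA _ (measurable_timeMaximal (measurable_spaceMaximal hh))).trans ?_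
        gcongr
        refine (hB _ (measurable_spaceMaximal hh)).trans ?_
        gcongr
        exact hA _ hh
    _ = _ := by push_cast; ring

universe u

/-- The `L^p` estimate of the square function, in terms of its integrand `V`. For `p > 2` the
weighted inequality is tested against all `h` in the dual of `L^{p/2}`, and the maximal operators
are bounded on that space. -/
theorem exists_lintegral_sq_rpow_le (hd : d ≠ 0) (hγ : 0 < γ) (hν : 0 < ν) {p : ℝ} (hp : 2 ≤ p) :
    ∃ N : ℝ≥0, ∀ ψ : ℝ → Rd d → ℂ, IsEllipticSymbol d γ ν ψ →
      ∀ (H : Type u) [NormedAddCommGroup H] [InnerProductSpace ℂ H] [CompleteSpace H]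
        (f : ℝ × Rd d → H) (V : (ℝ × ℝ) × Rd d → H), Continuous f → HasCompactSupport f →
        StronglyMeasurable V →
        (∀ t s x, 0 ≤ s → s < t →
          V ((t, s), x) = ∫ y, invFourierT (evolutionSymbol γ ψ t s) y • f (s, x - y)) →
        ∫⁻ z : ℝ × Rd d, (∫⁻ s in Ioo 0 z.1, ‖V ((z.1, s), z.2)‖ₑ ^ 2) ^ (p / 2) ≤
          N * ∫⁻ z, ‖f z‖ₑ ^ p := by
  obtain ⟨N, hN⟩ := exists_lintegral_sq_mul_le.{u} hd hγ hν
  rcases hp.eq_or_lt with rfl | hp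
  · refine ⟨N, fun ψ hψ H _ _ _ f V hf hfc hV hVf => ?_⟩
    have h := hN ψ hψ H f V (fun _ => 1) hf hfc hV hVf measurable_const
    simp only [mul_one] at h
    simp only [div_self (two_ne_zero' ℝ), ENNReal.rpow_one, ENNReal.rpow_two]
    refine h.trans ?_
    gcongr with z
    exact mul_le_of_le_one_right' (iterated_maximal_one_le z)
  · have ha : 1 < p / 2 := by linarith
    have hab := Real.HolderConjugate.conjExponent ha
    set a := p / 2
    set b := a.conjExponent
    have ha0 : 0 < a := hab.pos
    have hb0 : 0 < b := hab.symm.pos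
    obtain ⟨C, hC⟩ := exists_lintegral_iterated_maximal_rpow_le d hab.symm.lt
    refine ⟨(N * C ^ (1 / b)) ^ a, fun ψ hψ H _ _ _ f V hf hfc hV hVf => ?_⟩
    have key := lintegral_rpow_le_of_forall_lintegral_mul_le (μ := volume) hab
      (measurable_setLIntegral_enorm_sq hV)
      (N * C ^ (1 / b) * (∫⁻ z, ‖f z‖ₑ ^ p) ^ (1 / a)) fun h hh => ?_
    · refine key.trans_eq ?_
      rw [ENNReal.mul_rpow_of_nonneg _ _ ha0.le, ← ENNReal.rpow_mul, one_div_mul_cancel ha0.ne',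
        ENNReal.rpow_one, ENNReal.coe_rpow_of_nonneg _ ha0.le, ENNReal.coe_mul,
        ENNReal.coe_rpow_of_nonneg _ (by positivity)]
    · have hm := measurable_spaceMaximal (measurable_timeMaximal (measurable_spaceMaximal hh))
      have hsq : ∀ z, (‖f z‖ₑ ^ 2) ^ a = ‖f z‖ₑ ^ p := fun z => by
        rw [← ENNReal.rpow_two, ← ENNReal.rpow_mul, mul_div_cancel₀ p two_ne_zero]
      have hH := ENNReal.lintegral_mul_le_Lp_mul_Lq volume hab
        (hf.enorm.measurable.pow_const 2).aemeasurable hm.aemeasurable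
      simp only [Pi.mul_apply, hsq] at hH
      calc _ ≤ N * ((∫⁻ z, ‖f z‖ₑ ^ p) ^ (1 / a) * (C * ∫⁻ z, h z ^ b) ^ (1 / b)) := by
            refine (hN ψ hψ H f V h hf hfc hV hVf hh).trans ?_
            gcongr
            refine hH.trans ?_
            gcongr
            exact hC h hh
        _ = _ := by
            rw [ENNReal.mul_rpow_of_nonneg _ _ (by positivity)]
            ring

/-- In dimension zero the symbol `‖ξ‖ ^ σ` vanishes identically. -/
theorem fracLaplacian_eq_zero {σ : ℝ} (hσ : 0 < σ) (u : Rd 0 → ℂ) : fracLaplacian σ u = 0 := by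
  funext x
  simp [fracLaplacian, invFourierT, Subsingleton.elim _ (0 : Rd 0), Real.zero_rpow hσ.ne']

theorem squareFunction_eq_zero {H : Type*} [NormedAddCommGroup H] [InnerProductSpace ℂ H]
    (hγ : 0 < γ) (ψ : ℝ → Rd 0 → ℂ) (f : ℝ × Rd 0 → H) : squareFunction γ ψ f = 0 := by
  funext z
  simp [squareFunction, fracLaplacian_eq_zero (half_pos hγ), zero_convolution]

theorem IsEllipticSymbol.squareFunction_eq {H : Type*} [NormedAddCommGroup H]
    [InnerProductSpace ℂ H] (hd : d ≠ 0) (hγ : 0 < γ) (hν : 0 < ν) {ψ : ℝ → Rd d → ℂ}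
    (hψ : IsEllipticSymbol d γ ν ψ) {f : ℝ × Rd d → H} {V : (ℝ × ℝ) × Rd d → H}
    (hV : ∀ t s x, 0 ≤ s → s < t →
      V ((t, s), x) = ∫ y, invFourierT (evolutionSymbol γ ψ t s) y • f (s, x - y)) :
    squareFunction γ ψ f = fun z =>
      (∫⁻ s in Ioo 0 z.1, ‖V ((z.1, s), z.2)‖ₑ ^ 2) ^ (1 / 2 : ℝ) := by
  funext z
  unfold squareFunction
  congr 1
  refine setLIntegral_congr_fun measurableSet_Ioo fun s hs => ?_
  simp only [ENNReal.rpow_two, hV z.1 s z.2 hs.1.le hs.2, convolution,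
    hψ.fracLaplacian_kernel hd hγ hν hs.1.le hs.2, ContinuousLinearMap.lsmul_apply]

end LpEstimate

end ParabolicLP

theorem mainTheorem2 (d : ℕ) (p γ ν : ℝ) (hp : 2 ≤ p) (hγ : 0 < γ) (hν : 0 < ν) :
    ∃ N : ℝ≥0, ∀ ψ : ℝ → ParabolicLP.Rd d → ℂ, ParabolicLP.IsEllipticSymbol d γ ν ψ →
      ∀ (H : Type*) [NormedAddCommGroup H] [InnerProductSpace ℂ H] [CompleteSpace H]
        (f : ℝ × ParabolicLP.Rd d → H), ContDiff ℝ ∞ f → HasCompactSupport f →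
        AEMeasurable (ParabolicLP.squareFunction γ ψ f) volume ∧
        eLpNorm (ParabolicLP.squareFunction γ ψ f) (ENNReal.ofReal p) volume
          ≤ N * eLpNorm (fun z => ‖f z‖) (ENNReal.ofReal p) volume := by
  rcases eq_or_ne d 0 with rfl | hd
  · refine ⟨0, fun ψ _ H _ _ _ f _ _ => ?_⟩
    rw [ParabolicLP.squareFunction_eq_zero hγ]
    simp [aemeasurable_const, Pi.zero_def]
  · obtain ⟨N, hN⟩ := ParabolicLP.exists_lintegral_sq_rpow_le hd hγ hν hp
    refine ⟨N ^ (1 / p), fun ψ hψ H _ _ _ f hf hfc => ?_⟩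
    obtain ⟨V, hV, hVf⟩ := hψ.exists_stronglyMeasurable_convolution hd hγ hν hf.continuous
    rw [hψ.squareFunction_eq hd hγ hν hVf]
    have hp0 : 0 < p := by linarith
    refine ⟨((ParabolicLP.measurable_setLIntegral_enorm_sq hV).pow_const _).aemeasurable, ?_⟩
    have hp1 : ENNReal.ofReal p ≠ 0 := by simpa using hp0
    simp only [eLpNorm_eq_lintegral_rpow_enorm_toReal hp1 ENNReal.ofReal_ne_top,
      ENNReal.toReal_ofReal hp0.le, enorm_eq_self, enorm_norm, ← ENNReal.rpow_mul]
    rw [ENNReal.coe_rpow_of_nonneg _ (by positivity),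
      ← ENNReal.mul_rpow_of_nonneg _ _ (by positivity), one_div_mul_eq_div]
    gcongr
    exact hN ψ hψ H f V hf.continuous hfc hV hVf
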